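/- Let $G=(V,E,w)$ be a finite connected undirected graph with edge weights $w:E\to\mathbb R_{\ge 0}$, let $n=|V|$, let $d_G$ be its shortest path metric, and let $\Delta>0$. A partition of $V$ is *strongly $\Delta$-bounded* if for every cluster $C$ the induced weighted graph $G[C]$ has diameter at most $\Delta$. A *strongly $(\beta,\Delta)$-separating decomposition* of $G$ is a probability distribution $\mathcal D$ over partitions of $V$ such that every partition in the support of $\mathcal D$ is strongly $\Delta$-bounded and, for every pair $u,v\in V$, $$\Pr_{\mathcal P\sim\mathcal D}\bigl[u \text{ and } v \text{ lie in different clusters of } \mathcal P\bigr]\;\le\;\beta\cdot\frac{d_G(u,v)}{\Delta}.$$ It is *efficient* if it can be sampled in polynomial time: a single randomized algorithm, not depending on the graph, samples a partition with distribution exactly $\mathcal D$ and always halts within $q(n)$ steps, for a fixed polynomial $q$. Running time is measured on a randomized real RAM with unit cost for each operation: addition, subtraction and comparison of natural numbers, indirect addressing, exact arithmetic, $\exp$, $\log$ and comparison on real numbers (no rounding), and drawing an independent uniform sample from $[0,1]$. There is a universal constant $c>0$ such that the following hold for all such $G$ and $\Delta$. 1. If $G$ excludes $K_r$ as a minor,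 then $G$ admits an efficient strongly $(c\,r,\Delta)$-separating decomposition. The algorithm is given $G$, $w$, $\Delta$ and $r$, and the polynomial $q$ does not depend on $r$. 2. If $G$ has doubling dimension $\mathrm{ddim}$, that is, for every $v\in V$ and $\rho>0$ the ball $\{u\in V: d_G(v,u)\le 2\rho\}$ is covered by at most $2^{\mathrm{ddim}}$ balls of radius $\rho$, then $G$ admits an efficient strongly $(c\cdot\mathrm{ddim},\Delta)$-separating decomposition. The algorithm is given $G$, $w$ and $\Delta$, and the polynomial $q$ does not depend on $\mathrm{ddim}$. -/

import Mathlib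

open scoped NNReal ENNReal

universe u

/-! Weighted graphs: a simple graph `G` on `V` and a weight function `w` with nonnegative real
values, of which only the values on edges of `G` ever matter. -/

namespace WGraph

variable {V : Type u}

/-- Total weight of a walk. -/
noncomputable def walkWeight {G : SimpleGraph V} (w : Sym2 V → ℝ≥0) {u v : V}
    (p : G.Walk u v) : ℝ≥0 :=
  (p.edges.map w).sum

/-- Shortest path distance; it is `∞` when there is no walk from `u` to `v`. -/
noncomputable def dist (G : SimpleGraph V) (w : Sym2 V → ℝ≥0) (u v : V) : ℝ≥0∞ :=
  ⨅ p : G.Walk u v, (walkWeight w p : ℝ≥0∞)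

/-- The closed ball of radius `ρ` around `v` in the shortest path metric. -/
def ball (G : SimpleGraph V) (w : Sym2 V → ℝ≥0) (v : V) (ρ : ℝ) : Set V :=
  {u | dist G w v u ≤ ENNReal.ofReal ρ}

/-- The diameter of the induced graph `G[C]`, i.e. the strong diameter of `C`. -/
noncomputable def strongDiam (G : SimpleGraph V) (w : Sym2 V → ℝ≥0) (C : Set V) : ℝ≥0∞ :=
  ⨆ (x : C) (y : C), dist (G.induce C) (fun s => w (s.map Subtype.val)) x y

/-- `H` is a minor of `G`: there are nonempty, connected, pairwise disjoint branch sets in `G`, one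
for each vertex of `H`, such that branch sets of adjacent vertices are joined by an edge of `G`. -/
def IsMinor {U : Type*} (H : SimpleGraph U) (G : SimpleGraph V) : Prop :=
  ∃ B : U → Set V,
    (∀ x, (G.induce (B x)).Connected) ∧
    (∀ x y, x ≠ y → Disjoint (B x) (B y)) ∧
    (∀ x y, H.Adj x y → ∃ a ∈ B x, ∃ b ∈ B y, G.Adj a b)

/-- The shortest path metric has doubling dimension (at most) `ddim`: every ball of radius `2ρ` is
covered by at most `2 ^ ddim` balls of radius `ρ`. -/
def HasDoublingDim (G : SimpleGraph V) (w : Sym2 V → ℝ≥0) (ddim : ℝ) : Prop :=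
  ∀ (v : V) (ρ : ℝ), 0 < ρ → ∃ S : Finset V, (S.card : ℝ) ≤ (2 : ℝ) ^ ddim ∧
    ball G w v (2 * ρ) ⊆ ⋃ x ∈ S, ball G w x ρ

/-- A partition of `V` is given as an equivalence relation, whose classes are the clusters. It is
strongly `Δ`-bounded if every cluster has strong diameter at most `Δ`. -/
def StronglyBounded (G : SimpleGraph V) (w : Sym2 V → ℝ≥0) (Δ : ℝ) (P : Setoid V) : Prop :=
  ∀ C ∈ P.classes, strongDiam G w C ≤ ENNReal.ofReal Δ

/-- The distribution `D` over partitions is a strongly `(β, Δ)`-separating decomposition. -/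
def StronglySeparating (G : SimpleGraph V) (w : Sym2 V → ℝ≥0) (β Δ : ℝ)
    (D : PMF (Setoid V)) : Prop :=
  (∀ P ∈ D.support, StronglyBounded G w Δ P) ∧
    ∀ u v : V, D.toOuterMeasure {P | ¬ P u v} ≤
      ENNReal.ofReal β * (dist G w u v / ENNReal.ofReal Δ)

end WGraph

/-! A randomized real RAM, as a language of while-programs. The store consists of two-dimensional
arrays of natural numbers and of real numbers, with indirect addressing. Every operation has unit
cost. Natural numbers can only be added, subtracted and compared, so that they cannot be used to
perform more than polynomially many bit operations in polynomially many steps. On real numbers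
there are exact arithmetic, `exp`, `log` and comparison, but no rounding. Random numbers are
independent uniform samples from `[0, 1]`, drawn one at a time. -/

namespace RealRAM

/-- Expressions with values in the natural numbers; `get a i j` is the entry `(i, j)` of the
array with name `a`, and `sub` is truncated. -/
inductive NExpr : Type
  | const (k : ℕ)
  | get (a : ℕ) (i j : NExpr)
  | add (x y : NExpr)
  | sub (x y : NExpr)

/-- Expressions with values in the real numbers. -/
inductive RExpr : Type
  | ofNat (x : NExpr)
  | get (a : ℕ) (i j : NExpr)
  | add (x y : RExpr)
  | sub (x y : RExpr)
  | mul (x y : RExpr)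
  | div (x y : RExpr)
  | exp (x : RExpr)
  | log (x : RExpr)

/-- Tests. -/
inductive BExpr : Type
  | nle (x y : NExpr)
  | rle (x y : RExpr)
  | not (b : BExpr)
  | and (b c : BExpr)

/-- Programs. `nset` and `rset` assign to an array entry, `sample` stores a fresh random number in
an entry of a real array, and `loop b s` is `while b do s`. -/
inductive Prog : Type
  | skip
  | nset (a : ℕ) (i j : NExpr) (x : NExpr)
  | rset (a : ℕ) (i j : NExpr) (x : RExpr)
  | sample (a : ℕ) (i j : NExpr)
  | seq (s t : Prog)
  | ite (b : BExpr) (s t : Prog)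
  | loop (b : BExpr) (s : Prog)

/-- The contents of the arrays, and how many random numbers have been drawn. -/
structure State where
  nat : ℕ → ℕ → ℕ → ℕ
  real : ℕ → ℕ → ℕ → ℝ
  drawn : ℕ

/-- Overwrite the entry `(i, j)` of array `a`. -/
def write {α : Type} (m : ℕ → ℕ → ℕ → α) (a i j : ℕ) (x : α) : ℕ → ℕ → ℕ → α :=
  fun b k l => if b = a ∧ k = i ∧ l = j then x else m b k l

def NExpr.eval (σ : State) : NExpr → ℕ
  | .const k => k
  | .get a i j => σ.nat a (i.eval σ) (j.eval σ)
  | .add x y => x.eval σ + y.eval σ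
  | .sub x y => x.eval σ - y.eval σ

/-- Number of operations in the evaluation of an expression. -/
def NExpr.cost : NExpr → ℕ
  | .const _ => 1
  | .get _ i j => i.cost + j.cost + 1
  | .add x y => x.cost + y.cost + 1
  | .sub x y => x.cost + y.cost + 1

/-- Division by zero, and `log` outside the positive reals, have the usual default values. -/
noncomputable def RExpr.eval (σ : State) : RExpr → ℝ
  | .ofNat x => (x.eval σ : ℝ)
  | .get a i j => σ.real a (i.eval σ) (j.eval σ)
  | .add x y => x.eval σ + y.eval σ
  | .sub x y => x.eval σ - y.eval σ
  | .mul x y => x.eval σ * y.eval σ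
  | .div x y => x.eval σ / y.eval σ
  | .exp x => Real.exp (x.eval σ)
  | .log x => Real.log (x.eval σ)

def RExpr.cost : RExpr → ℕ
  | .ofNat x => x.cost + 1
  | .get _ i j => i.cost + j.cost + 1
  | .add x y => x.cost + y.cost + 1
  | .sub x y => x.cost + y.cost + 1
  | .mul x y => x.cost + y.cost + 1
  | .div x y => x.cost + y.cost + 1
  | .exp x => x.cost + 1
  | .log x => x.cost + 1

def BExpr.eval (σ : State) : BExpr → Prop
  | .nle x y => x.eval σ ≤ y.eval σ
  | .rle x y => x.eval σ ≤ y.eval σ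
  | .not b => ¬ b.eval σ
  | .and b c => b.eval σ ∧ c.eval σ

def BExpr.cost : BExpr → ℕ
  | .nle x y => x.cost + y.cost + 1
  | .rle x y => x.cost + y.cost + 1
  | .not b => b.cost + 1
  | .and b c => b.cost + c.cost + 1

/-- `Exec ω p σ c τ`: started in state `σ`, and with `ω` as its sequence of random numbers, the
program `p` halts in state `τ` after exactly `c` steps. -/
inductive Exec (ω : ℕ → unitInterval) : Prog → State → ℕ → State → Prop
  | skip (σ : State) : Exec ω .skip σ 1 σ
  | nset (σ : State) (a : ℕ) (i j x : NExpr) :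
      Exec ω (.nset a i j x) σ (i.cost + j.cost + x.cost + 1)
        { σ with nat := write σ.nat a (i.eval σ) (j.eval σ) (x.eval σ) }
  | rset (σ : State) (a : ℕ) (i j : NExpr) (x : RExpr) :
      Exec ω (.rset a i j x) σ (i.cost + j.cost + x.cost + 1)
        { σ with real := write σ.real a (i.eval σ) (j.eval σ) (x.eval σ) }
  | sample (σ : State) (a : ℕ) (i j : NExpr) :
      Exec ω (.sample a i j) σ (i.cost + j.cost + 1)
        { σ with
          real := write σ.real a (i.eval σ) (j.eval σ) (ω σ.drawn : ℝ)
          drawn := σ.drawn + 1 }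
  | seq {s t : Prog} {σ₁ σ₂ σ₃ : State} {c d : ℕ} :
      Exec ω s σ₁ c σ₂ → Exec ω t σ₂ d σ₃ → Exec ω (.seq s t) σ₁ (c + d) σ₃
  | ite_true {b : BExpr} {s t : Prog} {σ τ : State} {c : ℕ} :
      b.eval σ → Exec ω s σ c τ → Exec ω (.ite b s t) σ (b.cost + c) τ
  | ite_false {b : BExpr} {s t : Prog} {σ τ : State} {c : ℕ} :
      ¬ b.eval σ → Exec ω t σ c τ → Exec ω (.ite b s t) σ (b.cost + c) τ
  | loop_true {b : BExpr} {s : Prog} {σ₁ σ₂ σ₃ : State} {c d : ℕ} :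
      b.eval σ₁ → Exec ω s σ₁ c σ₂ → Exec ω (.loop b s) σ₂ d σ₃ →
        Exec ω (.loop b s) σ₁ (b.cost + c + d) σ₃
  | loop_false {b : BExpr} {s : Prog} {σ : State} :
      ¬ b.eval σ → Exec ω (.loop b s) σ b.cost σ

/-- The law of an infinite sequence of independent uniform samples from `[0, 1]`. -/
noncomputable def coins : MeasureTheory.Measure (ℕ → unitInterval) :=
  MeasureTheory.Measure.infinitePi fun _ => MeasureTheory.volume

variable {V : Type u}

open Classical in
/-- The input to a decomposition algorithm, with the vertices numbered by `e`: array `0` of the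
natural numbers holds `n` at `(0, 0)` and an integer parameter `k` at `(0, 1)`, array `1` holds the
adjacency matrix; array `0` of the real numbers holds `Δ` at `(0, 0)`, array `1` holds the weights
of the edges. All other entries are `0`. -/
noncomputable def input {n : ℕ} (e : Fin n ≃ V) (G : SimpleGraph V) (w : Sym2 V → ℝ≥0)
    (Δ : ℝ) (k : ℕ) : State where
  nat := fun a i j =>
    if a = 0 ∧ i = 0 ∧ j = 0 then n
    else if a = 0 ∧ i = 0 ∧ j = 1 then k
    else if a = 1 ∧ ∃ (hi : i < n) (hj : j < n), G.Adj (e ⟨i, hi⟩) (e ⟨j, hj⟩) then 1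
    else 0
  real := fun a i j =>
    if a = 0 ∧ i = 0 ∧ j = 0 then Δ
    else if h : a = 1 ∧ ∃ (hi : i < n) (hj : j < n), G.Adj (e ⟨i, hi⟩) (e ⟨j, hj⟩) then
      (w s(e ⟨i, h.2.1⟩, e ⟨j, h.2.2.1⟩) : ℝ)
    else 0
  drawn := 0

/-- The partition of `V` that is read off from a final state: entry `(i, 0)` of array `2` of the
natural numbers is the label of the cluster of vertex number `i`. -/
def output {n : ℕ} (e : Fin n ≃ V) (τ : State) : Setoid V :=
  Setoid.ker fun v => τ.nat 2 (e.symm v) 0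

/-- Started in state `σ`, the program `p` always halts within `T` steps, and the partition that it
outputs has the distribution `D`. -/
def SamplesWithin (p : Prog) {n : ℕ} (e : Fin n ≃ V) (σ : State) (T : ℕ)
    (D : PMF (Setoid V)) : Prop :=
  ∃ out : (ℕ → unitInterval) → Setoid V,
    (∀ ω, ∃ c τ, Exec ω p σ c τ ∧ c ≤ T ∧ out ω = output e τ) ∧
    ∀ P : Setoid V, D P = coins {ω | out ω = P}

end RealRAM

/-! Write `D = Δ / 6`. Both algorithms end with the same clustering phase. Suppose that the vertices
are divided into label classes and that there is a set of centers such that, inside its own class,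
every vertex has a center within `2 * D` and at most `τ` centers within `3 * D`. Each center `c`
draws `Y c` uniformly from `[1 / (τ + 1), 1]`, and a vertex `x` joins the center that minimizes `Y c
* exp (lam * d c x)` with `lam = log (τ + 1) / D`. Equivalently, `d c x` is reduced by a truncated
exponential shift with values in `[0, D]`. If the minimizer is unique, it is within `3 * D` and a
shortest path from it to `x` stays in the cluster, so the strong diameter is at most `6 * D = Δ`
(`cluster_diam`). If an edge of weight `r` inside a class is cut, one endpoint has two centers whose
scaled distances agree up to a factor `exp (2 * lam * r)`. Memorylessness bounds the probability of
such a near tie by `4 * lam * r` (`volume_unif_window`, `coins_nearTie`); with `r = 0` this shows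
that exact ties are null events. The phase therefore separates with parameter `O(log τ)`.

For doubling dimension there is a single class and the centers are a greedy net at scale `D`.
Packing bounds `τ` by a function exponential in `ddim`. Below dimension one all distances vanish.

For an excluded minor on `k` vertices, the classes are supernodes, built one after another. An
unassigned vertex becomes the root of a new supernode. Its skeleton consists of shortest paths,
within the component of the root among the unassigned vertices, from the root to each adjacent
supernode. The supernode consists of all vertices of the component within a random radius of the
skeleton; the radius is a truncated exponential variable with values in `[0, D]` and rate `3 * k /
D`. Supernodes adjacent to a common unassigned component are pairwise adjacent, because each new
skeleton touches all older neighbors. They form a clique minor, so there are at most `k` of them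
(`CopInv.card_adj`). Net points spaced by more than `D` along the shortest paths serve as centers,
and the path structure gives `τ ≤ 7 * k + 1` (`CopInv.skel`).

It remains to see that supernodes cut an edge `u v` with probability `O(k * w u v / D)`, although
many of them may come close to it. Let `b l` be the exponential of `-lam` times the distance from
`u` to supernode `l`, with `lam = 3 * k / D`. The cost of an edge with both ends unassigned is `12 *
η / k * (3 * k - ∑ b l ^ (1 + q))`, where `η = lam * w u v`; afterwards it is `1` or `0` according
to whether the edge is cut. A new supernode that fails to capture `u` is itself near `u` and raises
the sum. In expectation this gain, together with the drop to `0` upon capture, pays for the risk of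
a cut and for the old supernodes that get shielded from `u` (`potential_drift`, `cost_step`). So the
expected cost never increases, and it starts at most at `36 * η`.

The algorithms are programs whose loops all have `n` passes, so that polynomial running time is read
off the syntax (`exec_den`). Distances come from Bellman–Ford tables, in which a number `B` larger
than the weight of any simple walk plays the role of infinity. -/

namespace RealRAM

/-! ### Loop programs: semantics, frame rules, running time. -/

/-- Loop programs: every loop runs its counter through `0, …, n - 1`, where `n` is the entry
`(0, 0)` of the natural array `0`. -/
inductive Code : Type
  | skip
  | nset (a : ℕ) (i j : NExpr) (x : NExpr)
  | rset (a : ℕ) (i j : NExpr) (x : RExpr)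
  | sample (a : ℕ) (i j : NExpr)
  | seq (s t : Code)
  | cond (b : BExpr) (s t : Code)
  | rep (v : ℕ) (s : Code)

namespace State

/-- Overwrite an entry of a natural array. -/
def setN (σ : State) (a i j x : ℕ) : State := { σ with nat := write σ.nat a i j x }

/-- Overwrite an entry of a real array. -/
def setR (σ : State) (a i j : ℕ) (x : ℝ) : State := { σ with real := write σ.real a i j x }

/-- Store a random number. -/
def draw (σ : State) (a i j : ℕ) (x : ℝ) : State :=
  { σ with real := write σ.real a i j x, drawn := σ.drawn + 1 }

variable (σ : State) (a i j b k l : ℕ)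

@[simp] theorem setN_nat (x : ℕ) : (σ.setN a i j x).nat b k l =
    if b = a ∧ k = i ∧ l = j then x else σ.nat b k l := rfl
@[simp] theorem setN_real (x : ℕ) : (σ.setN a i j x).real = σ.real := rfl
@[simp] theorem setN_drawn (x : ℕ) : (σ.setN a i j x).drawn = σ.drawn := rfl
@[simp] theorem setR_real (x : ℝ) : (σ.setR a i j x).real b k l =
    if b = a ∧ k = i ∧ l = j then x else σ.real b k l := rfl
@[simp] theorem setR_nat (x : ℝ) : (σ.setR a i j x).nat = σ.nat := rfl
@[simp] theorem setR_drawn (x : ℝ) : (σ.setR a i j x).drawn = σ.drawn := rfl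
@[simp] theorem draw_real (x : ℝ) : (σ.draw a i j x).real b k l =
    if b = a ∧ k = i ∧ l = j then x else σ.real b k l := rfl
@[simp] theorem draw_nat (x : ℝ) : (σ.draw a i j x).nat = σ.nat := rfl
@[simp] theorem draw_drawn (x : ℝ) : (σ.draw a i j x).drawn = σ.drawn + 1 := rfl

theorem setN_nat_ne {b : ℕ} (x : ℕ) (h : b ≠ a) : (σ.setN a i j x).nat b = σ.nat b := by
  funext k l; simp [h]

theorem setR_real_ne {b : ℕ} (x : ℝ) (h : b ≠ a) : (σ.setR a i j x).real b = σ.real b := by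
  funext k l; simp [h]

theorem draw_real_ne {b : ℕ} (x : ℝ) (h : b ≠ a) : (σ.draw a i j x).real b = σ.real b := by
  funext k l; simp [h]

end State

namespace Code

/-- Iterate a state transformer that depends on the step. -/
def iter (f : ℕ → State → State) (σ : State) : ℕ → State
  | 0 => σ
  | k + 1 => f k (iter f σ k)

open Classical in
/-- The final state of a loop program. -/
noncomputable def den (ω : ℕ → unitInterval) : Code → State → State
  | skip, σ => σ
  | nset a i j x, σ => σ.setN a (i.eval σ) (j.eval σ) (x.eval σ)
  | rset a i j x, σ => σ.setR a (i.eval σ) (j.eval σ) (x.eval σ)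
  | sample a i j, σ => σ.draw a (i.eval σ) (j.eval σ) (ω σ.drawn)
  | seq s t, σ => den ω t (den ω s σ)
  | cond b s t, σ => if b.eval σ then den ω s σ else den ω t σ
  | rep v s, σ =>
      (iter (fun k τ => den ω s (τ.setN v 0 0 k)) σ (σ.nat 0 0 0)).setN v 0 0 (σ.nat 0 0 0)

/-- The natural arrays that are written to. -/
def nwrites : Code → List ℕ
  | nset a _ _ _ => [a]
  | seq s t => s.nwrites ++ t.nwrites
  | cond _ s t => s.nwrites ++ t.nwrites
  | rep v s => v :: s.nwrites
  | _ => []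

/-- The real arrays that are written to. -/
def rwrites : Code → List ℕ
  | rset a _ _ _ => [a]
  | sample a _ _ => [a]
  | seq s t => s.rwrites ++ t.rwrites
  | cond _ s t => s.rwrites ++ t.rwrites
  | rep _ s => s.rwrites
  | _ => []

/-- Array `0` is never written to, and loop bodies do not write to their counter. -/
def WF : Code → Prop
  | nset a _ _ _ => a ≠ 0
  | seq s t => s.WF ∧ t.WF
  | cond _ s t => s.WF ∧ t.WF
  | rep v s => v ≠ 0 ∧ v ∉ s.nwrites ∧ s.WF
  | _ => True

/-- No random numbers are drawn. -/
def Det : Code → Prop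
  | sample _ _ _ => False
  | seq s t => s.Det ∧ t.Det
  | cond _ s t => s.Det ∧ t.Det
  | rep _ s => s.Det
  | _ => True

/-- Frame rule. The list of written arrays is computed from the syntax, so later instances are
mostly closed by `decide`. -/
theorem den_nat {ω : ℕ → unitInterval} (c : Code) : ∀ (σ : State) {a : ℕ}, a ∉ c.nwrites →
    (den ω c σ).nat a = σ.nat a := by
  induction c with
  | skip => intros; rfl
  | nset b i j x =>
    intro σ a h
    simp only [nwrites, List.mem_singleton] at h
    exact State.setN_nat_ne _ _ _ _ _ h
  | rset b i j x => intros; rfl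
  | sample b i j => intros; rfl
  | seq s t hs ht =>
    intro σ a h
    simp only [nwrites, List.mem_append, not_or] at h
    simp only [den]
    rw [ht _ h.2, hs _ h.1]
  | cond b s t hs ht =>
    intro σ a h
    simp only [nwrites, List.mem_append, not_or] at h
    simp only [den]
    split_ifs
    · exact hs _ h.1
    · exact ht _ h.2
  | rep v s hs =>
    intro σ a h
    simp only [nwrites, List.mem_cons, not_or] at h
    simp only [den]
    rw [State.setN_nat_ne _ _ _ _ _ h.1]
    generalize σ.nat 0 0 0 = n
    induction n with
    | zero => rfl
    | succ k ih =>
      simp only [iter]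
      rw [hs _ h.2, State.setN_nat_ne _ _ _ _ _ h.1, ih]

theorem den_real {ω : ℕ → unitInterval} (c : Code) : ∀ (σ : State) {a : ℕ}, a ∉ c.rwrites →
    (den ω c σ).real a = σ.real a := by
  induction c with
  | skip => intros; rfl
  | nset b i j x => intros; rfl
  | rset b i j x =>
    intro σ a h
    simp only [rwrites, List.mem_singleton] at h
    exact State.setR_real_ne _ _ _ _ _ h
  | sample b i j =>
    intro σ a h
    simp only [rwrites, List.mem_singleton] at h
    exact State.draw_real_ne _ _ _ _ _ h
  | seq s t hs ht =>
    intro σ a h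
    simp only [rwrites, List.mem_append, not_or] at h
    simp only [den]
    rw [ht _ h.2, hs _ h.1]
  | cond b s t hs ht =>
    intro σ a h
    simp only [rwrites, List.mem_append, not_or] at h
    simp only [den]
    split_ifs
    · exact hs _ h.1
    · exact ht _ h.2
  | rep v s hs =>
    intro σ a h
    simp only [rwrites] at h
    simp only [den, State.setN_real]
    generalize σ.nat 0 0 0 = n
    induction n with
    | zero => rfl
    | succ k ih =>
      simp only [iter]
      rw [hs _ h, State.setN_real, ih]

/-- Array `0` holds `n`. As it never changes, the bound that `toProg` reads again at every test
agrees with the one that `den` reads once on entry to a loop. -/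
theorem WF.zero_notMem (c : Code) (h : c.WF) : 0 ∉ c.nwrites := by
  induction c with
  | nset b i j x => simpa [nwrites] using Ne.symm h
  | seq s t hs ht => simp [nwrites, hs h.1, ht h.2]
  | cond b s t hs ht => simp [nwrites, hs h.1, ht h.2]
  | rep v s hs => simp [nwrites, hs h.2.2, Ne.symm h.1]
  | _ => simp [nwrites]

theorem den_drawn {ω : ℕ → unitInterval} (c : Code) (h : c.Det) : ∀ σ : State,
    (den ω c σ).drawn = σ.drawn := by
  induction c with
  | sample b i j => exact h.elim
  | seq s t hs ht => intro σ; simp only [den]; rw [ht h.2, hs h.1]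
  | cond b s t hs ht =>
    intro σ; simp only [den]; split_ifs
    · exact hs h.1 _
    · exact ht h.2 _
  | rep v s hs =>
    intro σ
    simp only [den, State.setN_drawn]
    generalize σ.nat 0 0 0 = n
    induction n with
    | zero => rfl
    | succ k ih => simp only [iter]; rw [hs h, State.setN_drawn, ih]
  | _ => intros; rfl

/-- Lets a deterministic piece of code be analyzed with one fixed coin sequence, so that the objects
it computes do not depend on `ω`. -/
theorem den_det {ω ω' : ℕ → unitInterval} (c : Code) (h : c.Det) : ∀ σ : State,
    den ω c σ = den ω' c σ := by
  induction c with
  | sample b i j => exact h.elim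
  | seq s t hs ht => intro σ; simp only [den]; rw [hs h.1, ht h.2]
  | cond b s t hs ht =>
    intro σ; simp only [den]; rw [hs h.1, ht h.2]
  | rep v s hs =>
    intro σ
    simp only [den]
    congr 2
    funext k τ
    exact hs h _
  | _ => intros; rfl

/-- Invariant rule for loops; the invariant may use that arrays the body does not write to are
unchanged. -/
theorem rep_rule {ω : ℕ → unitInterval} (v : ℕ) (s : Code) (σ : State) (n : ℕ)
    (hn : σ.nat 0 0 0 = n) (I : ℕ → State → Prop) (h0 : I 0 σ)
    (hs : ∀ k < n, ∀ τ : State, (∀ a, a ≠ v → a ∉ s.nwrites → τ.nat a = σ.nat a) →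
      (∀ a, a ∉ s.rwrites → τ.real a = σ.real a) → I k τ →
      I (k + 1) (den ω s (τ.setN v 0 0 k))) :
    ∃ τ, I n τ ∧ den ω (rep v s) σ = τ.setN v 0 0 n := by
  refine ⟨iter (fun k τ => den ω s (τ.setN v 0 0 k)) σ n, ?_, by simp only [den, hn]⟩
  have key : ∀ k ≤ n, I k (iter (fun k τ => den ω s (τ.setN v 0 0 k)) σ k) ∧
      (∀ a, a ≠ v → a ∉ s.nwrites →
        (iter (fun k τ => den ω s (τ.setN v 0 0 k)) σ k).nat a = σ.nat a) ∧
      (∀ a, a ∉ s.rwrites →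
        (iter (fun k τ => den ω s (τ.setN v 0 0 k)) σ k).real a = σ.real a) := by
    intro k hk
    induction k with
    | zero => exact ⟨h0, fun _ _ _ => rfl, fun _ _ => rfl⟩
    | succ k ih =>
      obtain ⟨i1, i2, i3⟩ := ih (by omega)
      refine ⟨hs k (by omega) _ i2 i3 i1, fun a ha ha' => ?_, fun a ha => ?_⟩
      · simp only [iter]
        rw [den_nat _ _ ha', State.setN_nat_ne _ _ _ _ _ ha, i2 a ha ha']
      · simp only [iter]
        rw [den_real _ _ ha, State.setN_real, i3 a ha]
  exact (key n le_rfl).1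

/-- Translation to programs. -/
def toProg : Code → Prog
  | skip => .skip
  | nset a i j x => .nset a i j x
  | rset a i j x => .rset a i j x
  | sample a i j => .sample a i j
  | seq s t => .seq s.toProg t.toProg
  | cond b s t => .ite b s.toProg t.toProg
  | rep v s => .seq (.nset v (.const 0) (.const 0) (.const 0))
      (.loop (.not (.nle (.get 0 (.const 0) (.const 0)) (.get v (.const 0) (.const 0))))
        (.seq s.toProg (.nset v (.const 0) (.const 0)
          (.add (.get v (.const 0) (.const 0)) (.const 1)))))

/-- A bound on the running time. -/
noncomputable def time : Code → Polynomial ℕ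
  | skip => 1
  | nset _ i j x => Polynomial.C (i.cost + j.cost + x.cost + 1)
  | rset _ i j x => Polynomial.C (i.cost + j.cost + x.cost + 1)
  | sample _ i j => Polynomial.C (i.cost + j.cost + 1)
  | seq s t => s.time + t.time
  | cond b s t => Polynomial.C b.cost + s.time + t.time
  | rep _ s => Polynomial.C 12 + Polynomial.X * (s.time + Polynomial.C 16)

theorem exec_den {ω : ℕ → unitInterval} (c : Code) (h : c.WF) : ∀ σ : State,
    ∃ k ≤ c.time.eval (σ.nat 0 0 0), Exec ω c.toProg σ k (den ω c σ) := by
  induction c with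
  | skip => intro σ; exact ⟨1, by simp [time], .skip σ⟩
  | nset a i j x => intro σ; exact ⟨_, by simp [time], .nset σ a i j x⟩
  | rset a i j x => intro σ; exact ⟨_, by simp [time], .rset σ a i j x⟩
  | sample a i j => intro σ; exact ⟨_, by simp [time], .sample σ a i j⟩
  | seq s t hs ht =>
    intro σ
    obtain ⟨k, hk, e⟩ := hs h.1 σ
    obtain ⟨l, hl, f⟩ := ht h.2 (den ω s σ)
    rw [den_nat _ _ (WF.zero_notMem _ h.1)] at hl
    exact ⟨k + l, by simp only [time, Polynomial.eval_add]; omega, .seq e f⟩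
  | cond b s t hs ht =>
    intro σ
    obtain ⟨k, hk, e⟩ := hs h.1 σ
    obtain ⟨l, hl, f⟩ := ht h.2 σ
    simp only [den, toProg, time, Polynomial.eval_add, Polynomial.eval_C]
    split_ifs with hb
    · exact ⟨_, by omega, .ite_true hb e⟩
    · exact ⟨_, by omega, .ite_false hb f⟩
  | rep v s hs =>
    intro σ
    obtain ⟨hv, hvs, hw⟩ := h
    set n := σ.nat 0 0 0 with hn
    have h0 : ∀ k, (iter (fun k τ => den ω s (τ.setN v 0 0 k)) σ k).nat 0 0 0 = n := by
      intro k
      induction k with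
      | zero => rfl
      | succ k ih =>
        simp only [iter]
        rw [den_nat _ _ (WF.zero_notMem _ hw), State.setN_nat_ne _ _ _ _ _ (Ne.symm hv), ih]
    -- `m` is the number of passes left. The `8` is the cost of the failing last test; the `16` per
    -- pass is a test plus the increment of the counter, `8` each. The initialization adds `4`,
    -- whence the `12` in `time`.
    have key : ∀ m k, k + m = n → ∃ c ≤ 8 + m * (s.time.eval n + 16),
        Exec ω (.loop (.not (.nle (.get 0 (.const 0) (.const 0)) (.get v (.const 0) (.const 0))))
        (.seq s.toProg (.nset v (.const 0) (.const 0)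
          (.add (.get v (.const 0) (.const 0)) (.const 1)))))
          ((iter (fun k τ => den ω s (τ.setN v 0 0 k)) σ k).setN v 0 0 k) c
          ((iter (fun k τ => den ω s (τ.setN v 0 0 k)) σ n).setN v 0 0 n) := by
      intro m
      induction m with
      | zero =>
        intro k hk
        obtain rfl : k = n := by omega
        refine ⟨_, ?_, .loop_false ?_⟩
        · simp [BExpr.cost, NExpr.cost]
        · simp [BExpr.eval, NExpr.eval, h0, Ne.symm hv]
      | succ m ih =>
        intro k hk
        obtain ⟨c, hc, e⟩ := ih (k + 1) (by omega)
        obtain ⟨d, hd, f⟩ := hs hw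
          ((iter (fun k τ => den ω s (τ.setN v 0 0 k)) σ k).setN v 0 0 k)
        have e1 : (den ω s ((iter (fun k τ => den ω s (τ.setN v 0 0 k)) σ k).setN v 0 0 k)).nat v 0 0
            = k := by rw [den_nat _ _ hvs]; simp
        have g := Exec.nset (ω := ω)
          (den ω s ((iter (fun k τ => den ω s (τ.setN v 0 0 k)) σ k).setN v 0 0 k)) v
          (.const 0) (.const 0) (.add (.get v (.const 0) (.const 0)) (.const 1))
        simp only [NExpr.eval, e1] at g
        refine ⟨_, ?_, .loop_true ?_ (.seq f g) e⟩
        · rw [State.setN_nat_ne _ _ _ _ _ (Ne.symm hv), h0] at hd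
          have : (m + 1) * (s.time.eval n + 16) = m * (s.time.eval n + 16) + (s.time.eval n + 16) := by
            ring
          simp only [BExpr.cost, NExpr.cost]
          omega
        · simp [BExpr.eval, NExpr.eval, h0, Ne.symm hv]; omega
    obtain ⟨c, hc, e⟩ := key n 0 (by omega)
    refine ⟨_, ?_, .seq (.nset σ v (.const 0) (.const 0) (.const 0)) e⟩
    simp only [time, NExpr.cost, Polynomial.eval_add, Polynomial.eval_mul, Polynomial.eval_C,
      Polynomial.eval_X]
    omega

/-! ### Measurability of the final state in the coins. -/

/-- All entries of a state that depends on a parameter are measurable. -/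
structure MeasState {X : Type*} [MeasurableSpace X] (f : X → State) : Prop where
  nat : ∀ a i j, Measurable fun x => (f x).nat a i j
  real : ∀ a i j, Measurable fun x => (f x).real a i j
  drawn : Measurable fun x => (f x).drawn

/-- Indirect addressing preserves measurability because the index takes only countably many values.
-/
theorem measurable_index {X Y : Type*} [MeasurableSpace X] [MeasurableSpace Y]
    {g : ℕ → X → Y} {i : X → ℕ} (hg : ∀ k, Measurable (g k)) (hi : Measurable i) :
    Measurable fun x => g (i x) x := by
  have h := measurable_from_prod_countable_right (f := fun p : ℕ × X => g p.1 p.2) hg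
  exact h.comp (hi.prodMk measurable_id)

theorem measurable_index₂ {X Y : Type*} [MeasurableSpace X] [MeasurableSpace Y]
    {g : ℕ → ℕ → X → Y} {i j : X → ℕ} (hg : ∀ k l, Measurable (g k l)) (hi : Measurable i)
    (hj : Measurable j) : Measurable fun x => g (i x) (j x) x :=
  measurable_index (g := fun k x => g k (j x) x) (fun k => measurable_index (hg k) hj) hi

variable {X : Type*} [MeasurableSpace X] {f : X → State}

theorem measurable_nexpr (hf : MeasState f) (e : NExpr) : Measurable fun x => e.eval (f x) := by
  induction e with
  | const k => exact measurable_const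
  | get a i j hi hj => exact measurable_index₂ (hf.nat a) hi hj
  | add x y hx hy => exact hx.add hy
  | sub x y hx hy => exact hx.sub hy

theorem measurable_rexpr (hf : MeasState f) (e : RExpr) : Measurable fun x => e.eval (f x) := by
  induction e with
  | ofNat x => exact measurable_from_top.comp (measurable_nexpr hf x)
  | get a i j =>
    exact measurable_index₂ (hf.real a) (measurable_nexpr hf i) (measurable_nexpr hf j)
  | add x y hx hy => exact hx.add hy
  | sub x y hx hy => exact hx.sub hy
  | mul x y hx hy => exact hx.mul hy
  | div x y hx hy => exact hx.div hy
  | exp x hx => exact Real.measurable_exp.comp hx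
  | log x hx => exact Real.measurable_log.comp hx

theorem measurable_bexpr (hf : MeasState f) (b : BExpr) : MeasurableSet {x | b.eval (f x)} := by
  induction b with
  | nle x y => exact measurableSet_le (measurable_nexpr hf x) (measurable_nexpr hf y)
  | rle x y => exact measurableSet_le (measurable_rexpr hf x) (measurable_rexpr hf y)
  | not b hb => exact hb.compl
  | and b c hb hc => exact hb.inter hc

theorem MeasState.setN (hf : MeasState f) (a : ℕ) {i j v : X → ℕ} (hi : Measurable i)
    (hj : Measurable j) (hv : Measurable v) :
    MeasState fun x => (f x).setN a (i x) (j x) (v x) where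
  nat b k l := by
    simp only [State.setN_nat]
    refine Measurable.ite ?_ hv (hf.nat b k l)
    exact (MeasurableSet.const _).inter ((measurableSet_eq_fun measurable_const hi).inter
      (measurableSet_eq_fun measurable_const hj))
  real := hf.real
  drawn := hf.drawn

theorem MeasState.setR (hf : MeasState f) (a : ℕ) {i j : X → ℕ} {v : X → ℝ} (hi : Measurable i)
    (hj : Measurable j) (hv : Measurable v) :
    MeasState fun x => (f x).setR a (i x) (j x) (v x) where
  real b k l := by
    simp only [State.setR_real]
    refine Measurable.ite ?_ hv (hf.real b k l)
    exact (MeasurableSet.const _).inter ((measurableSet_eq_fun measurable_const hi).inter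
      (measurableSet_eq_fun measurable_const hj))
  nat := hf.nat
  drawn := hf.drawn

theorem MeasState.draw (hf : MeasState f) (a : ℕ) {i j : X → ℕ} {v : X → ℝ} (hi : Measurable i)
    (hj : Measurable j) (hv : Measurable v) :
    MeasState fun x => (f x).draw a (i x) (j x) (v x) where
  real := (hf.setR a hi hj hv).real
  nat := hf.nat
  drawn := hf.drawn.add_const 1

open Classical in
theorem MeasState.ite {g : X → State} (hf : MeasState f) (hg : MeasState g) {p : X → Prop}
    (hp : MeasurableSet {x | p x}) :
    MeasState fun x => if p x then f x else g x where
  nat a i j := by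
    simp only [apply_ite State.nat, ite_apply]
    exact Measurable.ite hp (hf.nat a i j) (hg.nat a i j)
  real a i j := by
    simp only [apply_ite State.real, ite_apply]
    exact Measurable.ite hp (hf.real a i j) (hg.real a i j)
  drawn := by
    simp only [apply_ite State.drawn]
    exact Measurable.ite hp hf.drawn hg.drawn

theorem MeasState.den {W : X → ℕ → unitInterval} (hW : Measurable W) (c : Code) :
    ∀ {f : X → State}, MeasState f → MeasState fun x => Code.den (W x) c (f x) := by
  induction c with
  | skip => exact fun hf => hf
  | nset a i j x =>
    intro f hf
    exact hf.setN a (measurable_nexpr hf i) (measurable_nexpr hf j) (measurable_nexpr hf x)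
  | rset a i j x =>
    intro f hf
    exact hf.setR a (measurable_nexpr hf i) (measurable_nexpr hf j) (measurable_rexpr hf x)
  | sample a i j =>
    intro f hf
    refine hf.draw a (measurable_nexpr hf i) (measurable_nexpr hf j) ?_
    exact measurable_index (g := fun k x => (W x k : ℝ))
      (fun k => measurable_subtype_coe.comp ((measurable_pi_apply k).comp hW)) hf.drawn
  | seq s t hs ht => exact fun hf => ht (hs hf)
  | cond b s t hs ht => exact fun hf => MeasState.ite (hs hf) (ht hf) (measurable_bexpr hf b)
  | rep v s hs =>
    intro f hf
    have key : ∀ k, MeasState fun x => iter (fun k τ => Code.den (W x) s (τ.setN v 0 0 k)) (f x) k := by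
      intro k
      induction k with
      | zero => exact hf
      | succ k ih =>
        exact hs (ih.setN v measurable_const measurable_const measurable_const)
    -- The number of passes is itself a measurable function of the point, so the iterates are glued
    -- by `measurable_index`.
    have hn := hf.nat 0 0 0
    refine MeasState.setN (f := fun x =>
      iter (fun k τ => Code.den (W x) s (τ.setN v 0 0 k)) (f x) ((f x).nat 0 0 0)) ⟨?_, ?_, ?_⟩
      v measurable_const measurable_const hn
    · exact fun a i j => measurable_index (fun k => (key k).nat a i j) hn
    · exact fun a i j => measurable_index (fun k => (key k).real a i j) hn
    · exact measurable_index (fun k => (key k).drawn) hn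

end Code

end RealRAM

/-! ### Weighted walks and the correctness of Bellman–Ford tables. -/

namespace LDD

/-- `WPath A w x y r`: there is a walk from `x` to `y` along `A` of total weight `r`. -/
inductive WPath (A : ℕ → ℕ → Prop) (w : ℕ → ℕ → ℝ) : ℕ → ℕ → ℝ → Prop
  | nil (x : ℕ) : WPath A w x x 0
  | cons {x y z : ℕ} {r : ℝ} : A x y → WPath A w y z r → WPath A w x z (w x y + r)

/-- Walks with a given number of edges. -/
inductive HPath (A : ℕ → ℕ → Prop) (w : ℕ → ℕ → ℝ) : ℕ → ℕ → ℕ → ℝ → Prop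
  | nil (x : ℕ) : HPath A w 0 x x 0
  | cons {t x y z : ℕ} {r : ℝ} : A x y → HPath A w t y z r → HPath A w (t + 1) x z (w x y + r)

/-- A weighted graph on the vertices below `n`. -/
structure WG (n : ℕ) (A : ℕ → ℕ → Prop) (w : ℕ → ℕ → ℝ) : Prop where
  lt : ∀ {x y}, A x y → x < n ∧ y < n
  symm : ∀ {x y}, A x y → A y x
  w_symm : ∀ {x y}, A x y → w x y = w y x
  nonneg : ∀ {x y}, A x y → 0 ≤ w x y

/-- The restriction of a relation to a set. -/
def restr (A : ℕ → ℕ → Prop) (S : ℕ → Prop) (x y : ℕ) : Prop := A x y ∧ S x ∧ S y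

/-- The restriction of a relation to pairs with the same label. -/
def same (A : ℕ → ℕ → Prop) (s : ℕ → ℕ) (x y : ℕ) : Prop := A x y ∧ s x = s y

variable {n : ℕ} {A A' : ℕ → ℕ → Prop} {w : ℕ → ℕ → ℝ}

theorem WG.mono (h : WG n A w) (hA : ∀ x y, A' x y → A x y) (hs : ∀ x y, A' x y → A' y x) :
    WG n A' w where
  lt h' := h.lt (hA _ _ h')
  symm h' := hs _ _ h'
  w_symm h' := h.w_symm (hA _ _ h')
  nonneg h' := h.nonneg (hA _ _ h')

theorem WG.restr (h : WG n A w) (S : ℕ → Prop) : WG n (restr A S) w :=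
  h.mono (fun _ _ h => h.1) (fun _ _ h' => ⟨h.symm h'.1, h'.2.2, h'.2.1⟩)

theorem WG.same (h : WG n A w) (s : ℕ → ℕ) : WG n (same A s) w :=
  h.mono (fun _ _ h => h.1) (fun _ _ h' => ⟨h.symm h'.1, h'.2.symm⟩)

namespace WPath

theorem single {x y : ℕ} (h : A x y) : WPath A w x y (w x y) := by
  simpa using WPath.cons h (WPath.nil (A := A) (w := w) y)

theorem trans {x y z : ℕ} {r r' : ℝ} (h : WPath A w x y r) (h' : WPath A w y z r') :
    WPath A w x z (r + r') := by
  induction h with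
  | nil => simpa using h'
  | cons a _ ih => rw [add_assoc]; exact .cons a (ih h')

theorem mono (hA : ∀ x y, A x y → A' x y) {x y : ℕ} {r : ℝ} (h : WPath A w x y r) :
    WPath A' w x y r := by
  induction h with
  | nil => exact .nil _
  | cons a _ ih => exact .cons (hA _ _ a) ih

theorem symm (hG : WG n A w) {x y : ℕ} {r : ℝ} (h : WPath A w x y r) : WPath A w y x r := by
  induction h with
  | nil => exact .nil _
  | cons a _ ih =>
    rw [hG.w_symm a, add_comm]
    exact ih.trans (single (hG.symm a))

theorem nonneg (hG : WG n A w) {x y : ℕ} {r : ℝ} (h : WPath A w x y r) : 0 ≤ r := by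
  induction h with
  | nil => exact le_rfl
  | cons a _ ih => exact add_nonneg (hG.nonneg a) ih

theorem lt_of_lt (hG : WG n A w) {x y : ℕ} {r : ℝ} (h : WPath A w x y r) : x < n → y < n := by
  induction h with
  | nil => exact id
  | cons a _ ih => exact fun _ => ih (hG.lt a).2

theorem same_label {s : ℕ → ℕ} {x y : ℕ} {r : ℝ} (h : WPath (same A s) w x y r) : s x = s y := by
  induction h with
  | nil => rfl
  | cons a _ ih => exact a.2.trans ih

/-- A walk within `S` either avoids `x`, or ends at `x`, or can be shortened to begin at its last
visit to `x`. -/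
theorem avoid (hG : WG n A w) {S : ℕ → Prop} (x : ℕ) {a y : ℕ} {r : ℝ}
    (h : WPath (restr A S) w a y r) (ha : S a) :
    (a ≠ x ∧ WPath (restr A fun z => S z ∧ z ≠ x) w a y r) ∨ y = x ∨
      ∃ z r', A x z ∧ (S z ∧ z ≠ x) ∧ WPath (restr A fun z => S z ∧ z ≠ x) w z y r' ∧
        w x z + r' ≤ r := by
  induction h with
  | nil a =>
    by_cases hx : a = x
    · exact .inr (.inl hx)
    · exact .inl ⟨hx, .nil _⟩
  | @cons a b c r hab hbc ih =>
    rcases ih hab.2.2 with ⟨h1, h2⟩ | h | ⟨z, r', h1, h2, h3, h4⟩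
    · by_cases hx : a = x
      · subst hx
        exact .inr (.inr ⟨b, r, hab.1, ⟨hab.2.2, h1⟩, h2, le_rfl⟩)
      · exact .inl ⟨hx, .cons ⟨hab.1, ⟨hab.2.1, hx⟩, hab.2.2, h1⟩ h2⟩
    · exact .inr (.inl h)
    · exact .inr (.inr ⟨z, r', h1, h2, h3, by linarith [hG.nonneg hab.1]⟩)

/-- Cut off everything before the last visit to the start `a`. The rest lives in `S` without `a`, so
induction on the size of `S` applies. -/
theorem shorten_aux (hG : WG n A w) (m : ℕ) : ∀ (S : Finset ℕ), S.card ≤ m → ∀ {a y : ℕ} {r : ℝ},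
    WPath (restr A (· ∈ S)) w a y r → a ∈ S → ∃ t r', t + 1 ≤ S.card ∧ r' ≤ r ∧ HPath A w t a y r' := by
  induction m with
  | zero => intro S hS a y r _ ha; simp only [Nat.le_zero, Finset.card_eq_zero] at hS; simp [hS] at ha
  | succ m ih =>
    intro S hS a y r h ha
    have hpos := Finset.card_pos.2 ⟨a, ha⟩
    rcases avoid hG a h ha with ⟨h1, _⟩ | h1 | ⟨z, r', h1, h2, h3, h4⟩
    · exact (h1 rfl).elim
    · subst h1
      exact ⟨0, 0, by omega, h.nonneg (hG.restr _), .nil _⟩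
    · have hc := Finset.card_erase_of_mem ha
      obtain ⟨t, r'', g1, g2, g3⟩ := ih (S.erase a) (by omega) (a := z) (y := y) (r := r')
        (h3.mono fun x y hxy => by simpa [LDD.restr, and_comm] using hxy)
        (by simp [h2.1, h2.2])
      exact ⟨t + 1, w a z + r'', by omega, by linarith, .cons h1 g3⟩

/-- Every walk can be shortened to one with fewer than `n` edges. -/
theorem shorten (hG : WG n A w) {x y : ℕ} {r : ℝ} (h : WPath A w x y r) (hx : x < n) :
    ∃ t r', t < n ∧ r' ≤ r ∧ HPath A w t x y r' := by
  obtain ⟨t, r', h1, h2, h3⟩ := shorten_aux hG n (Finset.range n) (by simp) (a := x) (y := y) (r := r)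
    (h.mono fun a b hab => ⟨hab, by simpa using (hG.lt hab).1, by simpa using (hG.lt hab).2⟩)
    (by simpa using hx)
  exact ⟨t, r', by simpa using h1, h2, h3⟩

end WPath

theorem HPath.weight_le {W : ℝ} (hW : ∀ x y, A x y → w x y ≤ W) {t x y : ℕ} {r : ℝ}
    (h : HPath A w t x y r) : r ≤ t * W := by
  induction h with
  | nil => simp
  | cons a _ ih => push_cast; linarith [hW _ _ a]

/-- The table computed by the algorithm of Bellman and Ford, with sources `S`, the value `B` for
infinity, and predecessors `pr`. -/
structure BF (n : ℕ) (A : ℕ → ℕ → Prop) (w : ℕ → ℕ → ℝ) (S : ℕ → Prop) (B : ℝ) (P : ℕ → ℕ → ℝ)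
    (pr : ℕ → ℕ → ℕ) : Prop where
  source : ∀ y < n, S y → P 0 y = 0
  nonsource : ∀ y < n, ¬ S y → P 0 y = B
  mono : ∀ t < n, ∀ y < n, P (t + 1) y ≤ P t y
  relax : ∀ t < n, ∀ x < n, ∀ y < n, A x y → P (t + 1) y ≤ P t x + w x y
  pred : ∀ t < n, ∀ y < n, (pr (t + 1) y = y ∧ P (t + 1) y = P t y) ∨
    (A (pr (t + 1) y) y ∧ P (t + 1) y = P t (pr (t + 1) y) + w (pr (t + 1) y) y)

/-- `B` exceeds the weight of every simple walk. -/
def Huge (n : ℕ) (A : ℕ → ℕ → Prop) (w : ℕ → ℕ → ℝ) (B : ℝ) : Prop :=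
  ∃ W : ℝ, 0 ≤ W ∧ (∀ x y, A x y → w x y ≤ W) ∧ n * W < B

theorem Huge.mono {B : ℝ} (h : Huge n A w B) (hA : ∀ x y, A' x y → A x y) : Huge n A' w B := by
  obtain ⟨W, h0, h1, h2⟩ := h
  exact ⟨W, h0, fun x y h => h1 x y (hA x y h), h2⟩

theorem Huge.pos {B : ℝ} (h : Huge n A w B) : 0 < B := by
  obtain ⟨W, h0, -, h2⟩ := h
  have : (0 : ℝ) ≤ n * W := by positivity
  linarith

namespace BF

variable {S : ℕ → Prop} {B : ℝ} {P : ℕ → ℕ → ℝ} {pr : ℕ → ℕ → ℕ}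

theorem antitone (h : BF n A w S B P pr) {t t' y : ℕ} (htt : t ≤ t') (ht : t' ≤ n) (hy : y < n) :
    P t' y ≤ P t y := by
  induction t', htt using Nat.le_induction with
  | base => exact le_rfl
  | succ t' _ ih => exact (h.mono t' (by omega) y hy).trans (ih (by omega))

theorem le_B (h : BF n A w S B P pr) (hB : 0 < B) {t y : ℕ} (ht : t ≤ n) (hy : y < n) :
    P t y ≤ B := by
  refine (h.antitone (Nat.zero_le t) ht hy).trans ?_
  by_cases hS : S y
  · rw [h.source y hy hS]; exact hB.le
  · rw [h.nonsource y hy hS]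

/-- Following predecessors, a value below `B` is seen to come from a source: weights are
nonnegative, so the value at the predecessor is below `B` as well. -/
theorem path (h : BF n A w S B P pr) (hG : WG n A w) {t : ℕ} (ht : t ≤ n) : ∀ {y : ℕ}, y < n →
    P t y < B → ∃ x < n, S x ∧ WPath A w x y (P t y) := by
  induction t with
  | zero =>
    intro y hy hP
    by_cases hS : S y
    · exact ⟨y, hy, hS, by rw [h.source y hy hS]; exact .nil _⟩
    · rw [h.nonsource y hy hS] at hP; exact (lt_irrefl _ hP).elim
  | succ t ih =>
    intro y hy hP
    rcases h.pred t (by omega) y hy with ⟨_, e⟩ | ⟨a, e⟩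
    · rw [e] at hP ⊢; exact ih (by omega) hy hP
    · have := hG.nonneg a
      obtain ⟨x, hx, hS, p⟩ := ih (by omega) (hG.lt a).1 (by linarith)
      exact ⟨x, hx, hS, by rw [e]; exact p.trans (.single a)⟩

theorem nonneg (h : BF n A w S B P pr) (hG : WG n A w) (hB : 0 < B) {t y : ℕ} (ht : t ≤ n)
    (hy : y < n) : 0 ≤ P t y := by
  rcases lt_or_ge (P t y) B with hP | hP
  · obtain ⟨x, _, _, p⟩ := h.path hG ht hy hP
    exact p.nonneg hG
  · linarith

theorem hpath_le (h : BF n A w S B P pr) (hG : WG n A w) {t x y : ℕ} {r : ℝ}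
    (p : HPath A w t x y r) : ∀ {t₀ : ℕ}, t₀ + t ≤ n → P (t₀ + t) y ≤ P t₀ x + r := by
  induction p with
  | nil => intros; simp
  | @cons t x y z r a p ih =>
    intro t₀ ht
    have h1 := h.relax t₀ (by omega) x (hG.lt a).1 y (hG.lt a).2 a
    have h2 := ih (t₀ := t₀ + 1) (by omega)
    rw [show t₀ + (t + 1) = t₀ + 1 + t by ring]
    linarith

/-- Shortened to fewer than `n` edges, the walk is fully relaxed after `n` rounds, and its weight is
then less than `B` by `Huge`. -/
theorem le_path (h : BF n A w S B P pr) (hG : WG n A w) (hB : Huge n A w B) {x y : ℕ} {r : ℝ}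
    (hx : x < n) (hS : S x) (p : WPath A w x y r) : P n y ≤ r ∧ P n y < B := by
  obtain ⟨t, r', ht, hr, q⟩ := p.shorten hG hx
  have h1 := h.hpath_le hG q (t₀ := 0) (by omega)
  rw [h.source x hx hS, zero_add, zero_add] at h1
  have h2 := h.antitone ht.le le_rfl (p.lt_of_lt hG hx)
  obtain ⟨W, h0, hW, hWB⟩ := hB
  have h3 := q.weight_le hW
  have h4 : (t : ℝ) * W ≤ n * W := by gcongr
  exact ⟨by linarith, by linarith⟩

theorem le_add (h : BF n A w S B P pr) (hG : WG n A w) (hB : Huge n A w B) {x y : ℕ} {r : ℝ}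
    (hx : x < n) (p : WPath A w x y r) : P n y ≤ P n x + r := by
  have hr := p.nonneg hG
  rcases lt_or_ge (P n x) B with hP | hP
  · obtain ⟨z, hz, hS, q⟩ := h.path hG le_rfl hx hP
    exact (h.le_path hG hB hz hS (q.trans p)).1
  · have := h.le_B hB.pos le_rfl (p.lt_of_lt hG hx)
    linarith

theorem lt_iff (h : BF n A w S B P pr) (hG : WG n A w) (hB : Huge n A w B) {x y : ℕ} {r : ℝ}
    (hx : x < n) (p : WPath A w x y r) : P n x < B ↔ P n y < B := by
  have hy := p.lt_of_lt hG hx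
  constructor
  · intro hP
    obtain ⟨z, hz, hS, q⟩ := h.path hG le_rfl hx hP
    exact (h.le_path hG hB hz hS (q.trans p)).2
  · intro hP
    obtain ⟨z, hz, hS, q⟩ := h.path hG le_rfl hy hP
    exact (h.le_path hG hB hz hS (q.trans (p.symm hG))).2

theorem eq_zero (h : BF n A w S B P pr) (hG : WG n A w) (hB : Huge n A w B) {x : ℕ}
    (hx : x < n) (hS : S x) : P n x = 0 :=
  le_antisymm (h.le_path hG hB hx hS (.nil x)).1 (h.nonneg hG hB.pos le_rfl hx)

end BF

end LDD

/-! ### Supernodes: invariants of one construction step. -/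

namespace LDD

variable {n : ℕ} {A : ℕ → ℕ → Prop} {w : ℕ → ℕ → ℝ}

/-- The label `l` is adjacent to the component of `u` in its label class. -/
def AdjLabel (A : ℕ → ℕ → Prop) (w : ℕ → ℕ → ℝ) (s : ℕ → ℕ) (u l : ℕ) : Prop :=
  l ≠ 0 ∧ ∃ y r z, WPath (same A s) w u y r ∧ A y z ∧ s z = l

/-- There is no clique minor on `k` branch sets. -/
def NoMinor (n : ℕ) (A : ℕ → ℕ → Prop) (w : ℕ → ℕ → ℝ) (k : ℕ) : Prop :=
  ∀ S : Fin k → ℕ → Prop, (∀ i, ∃ x, S i x) → (∀ i x, S i x → x < n) →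
    (∀ i x y, S i x → S i y → ∃ r, WPath (restr A (S i)) w x y r) →
    (∀ i j x, S i x → S j x → i = j) →
    (∀ i j, i ≠ j → ∃ x y, S i x ∧ S j y ∧ A x y) → False

/-- Invariants of the construction of supernodes. Vertices with label `0` are unassigned, the
classes of the other labels are the supernodes, and `N` is the set of net points. -/
structure CopInv (n : ℕ) (A : ℕ → ℕ → Prop) (w : ℕ → ℕ → ℝ) (D : ℝ) (k t : ℕ) (s : ℕ → ℕ)
    (N : ℕ → Prop) : Prop where
  zero : ∀ x, n ≤ x → s x = 0
  le : ∀ x, s x ≤ t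
  done : ∀ x < t, x < n → s x ≠ 0
  conn : ∀ x y, s x = s y → s x ≠ 0 → ∃ r, WPath (same A s) w x y r
  adj : ∀ u < n, s u = 0 → ∀ l l', l ≠ l' → AdjLabel A w s u l → AdjLabel A w s u l' →
    ∃ x z, A x z ∧ s x = l ∧ s z = l'
  net : ∀ c, N c → s c ≠ 0
  cover : ∀ u, s u ≠ 0 → ∃ c r, N c ∧ r ≤ 2 * D ∧ WPath (same A s) w u c r
  count : ∀ u, s u ≠ 0 → ∀ F : Finset ℕ,
    (∀ c ∈ F, N c ∧ ∃ r ≤ 3 * D, WPath (same A s) w u c r) → F.card ≤ 7 * k + 1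

/-- The skeleton `T` of a new supernode with root `v`, and the enlarged net `N'`. -/
structure Skel (n : ℕ) (A : ℕ → ℕ → Prop) (w : ℕ → ℕ → ℝ) (D : ℝ) (k : ℕ) (s : ℕ → ℕ) (v : ℕ)
    (T N N' : ℕ → Prop) : Prop where
  root : T v
  unassigned : ∀ x, T x → x < n ∧ s x = 0
  conn : ∀ x, T x → ∃ r, WPath (restr (same A s) T) w x v r
  touch : ∀ l, AdjLabel A w s v l → ∃ x z, T x ∧ A x z ∧ s z = l
  old : ∀ c, N c → N' c
  new : ∀ c, N' c → N c ∨ T c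
  cover : ∀ x, T x → ∃ c r, N' c ∧ T c ∧ r ≤ D ∧ WPath (restr (same A s) T) w x c r
  count : ∀ u, ∀ F : Finset ℕ,
    (∀ c ∈ F, N' c ∧ T c ∧ ∃ r ≤ 3 * D, WPath (same A s) w u c r) → F.card ≤ 7 * k + 1

/-- The vertices that the new supernode consists of. -/
def Cap (n : ℕ) (s : ℕ → ℕ) (d : ℕ → ℝ) (lam Y : ℝ) (x : ℕ) : Prop :=
  x < n ∧ s x = 0 ∧ Y ≤ Real.exp (-(lam * d x))

open Classical in
/-- The labels after the construction of a new supernode. -/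
noncomputable def relabel (n : ℕ) (s : ℕ → ℕ) (d : ℕ → ℝ) (lam Y : ℝ) (t x : ℕ) : ℕ :=
  if Cap n s d lam Y x then t + 1 else s x

theorem WPath.lift {s s' : ℕ → ℕ} {x y c : ℕ} {r : ℝ} (h : WPath (same A s) w x y r)
    (hc : ∀ z, s z = s x → s' z = c) : WPath (same A s') w x y r := by
  induction h with
  | nil => exact .nil _
  | @cons x y z r a _ ih =>
    exact .cons ⟨a.1, (hc _ rfl).trans (hc _ a.2.symm).symm⟩ (ih fun z hz => hc z (hz.trans a.2.symm))

namespace CopInv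

variable {D : ℝ} {k t : ℕ} {s : ℕ → ℕ} {N : ℕ → Prop}

theorem lt_of_ne (h : CopInv n A w D k t s N) {x : ℕ} (hx : s x ≠ 0) : x < n := by
  by_contra h'
  exact hx (h.zero x (by omega))

/-- A component has fewer than `k` adjacent labels. -/
theorem card_adj (h : CopInv n A w D k t s N) (hm : NoMinor n A w k) {u : ℕ}
    (hu : u < n) (hs : s u = 0) (F : Finset ℕ) (hF : ∀ l ∈ F, AdjLabel A w s u l) : F.card ≤ k := by
  by_contra hk
  push Not at hk
  obtain ⟨F', hF', hc⟩ := Finset.exists_subset_card_eq hk.le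
  let g := F'.equivFinOfCardEq hc
  have hg : ∀ i, AdjLabel A w s u (g.symm i) := fun i => hF _ (hF' (g.symm i).2)
  -- The branch sets of the forbidden clique minor are label classes: connected by `conn`, and
  -- pairwise joined by an edge by `adj`, since they all border the component of `u`.
  refine hm (fun i x => s x = g.symm i) (fun i => ?_) (fun i x hx => ?_) (fun i x y hx hy => ?_)
    (fun i j x hi hj => ?_) (fun i j hij => ?_)
  · obtain ⟨-, y, r, z, -, -, hz⟩ := hg i
    exact ⟨z, hz⟩
  · exact h.lt_of_ne (by rw [hx]; exact (hg i).1)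
  · obtain ⟨r, p⟩ := h.conn x y (hx.trans hy.symm) (by rw [hx]; exact (hg i).1)
    refine ⟨r, ?_⟩
    clear hy
    induction p with
    | nil => exact .nil _
    | @cons x y z r a _ ih =>
      exact .cons ⟨a.1, hx, a.2.symm.trans hx⟩ (ih (a.2.symm.trans hx))
  · exact g.symm.injective (Subtype.ext (hi.symm.trans hj))
  · have hne : (g.symm i : ℕ) ≠ g.symm j := fun e => hij (g.symm.injective (Subtype.ext e))
    obtain ⟨x, z, h1, h2, h3⟩ := h.adj u hu hs _ _ hne (hg i) (hg j)
    exact ⟨x, z, h2, h3, h1⟩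

theorem skip (h : CopInv n A w D k t s N) (ht : s t ≠ 0) : CopInv n A w D k (t + 1) s N :=
  { h with
    le := fun x => (h.le x).trans (Nat.le_succ t)
    done := fun x hx hn => by
      rcases Nat.lt_succ_iff_lt_or_eq.1 hx with h' | rfl
      · exact h.done x h' hn
      · exact ht }

section Step

variable {lam Y B : ℝ} {T N' : ℕ → Prop} {P : ℕ → ℕ → ℝ} {pr : ℕ → ℕ → ℕ}

theorem relabel_cap {d : ℕ → ℝ} {x : ℕ} (h : Cap n s d lam Y x) : relabel n s d lam Y t x = t + 1 :=
  if_pos h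

theorem relabel_not_cap {d : ℕ → ℝ} {x : ℕ} (h : ¬ Cap n s d lam Y x) :
    relabel n s d lam Y t x = s x := if_neg h

theorem relabel_of_ne {d : ℕ → ℝ} {x : ℕ} (h : s x ≠ 0) : relabel n s d lam Y t x = s x :=
  if_neg fun h' => h h'.2.1

theorem relabel_eq_succ (h : CopInv n A w D k t s N) {d : ℕ → ℝ} {x : ℕ} :
    relabel n s d lam Y t x = t + 1 ↔ Cap n s d lam Y x := by
  refine ⟨fun h' => ?_, relabel_cap⟩
  by_contra hc
  rw [relabel_not_cap hc] at h'
  have := h.le x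
  omega

theorem relabel_refine (h : CopInv n A w D k t s N) {d : ℕ → ℝ} {x y : ℕ}
    (e : relabel n s d lam Y t x = relabel n s d lam Y t y) : s x = s y := by
  by_cases hx : Cap n s d lam Y x
  · have hy := h.relabel_eq_succ.1 (e.symm.trans (relabel_cap hx))
    rw [hx.2.1, hy.2.1]
  · by_cases hy : Cap n s d lam Y y
    · exact (hx (h.relabel_eq_succ.1 (e.trans (relabel_cap hy)))).elim
    · rwa [relabel_not_cap hx, relabel_not_cap hy] at e

theorem path_refine (h : CopInv n A w D k t s N) {d : ℕ → ℝ} {x y : ℕ} {r : ℝ}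
    (p : WPath (same A (relabel n s d lam Y t)) w x y r) : WPath (same A s) w x y r :=
  p.mono fun _ _ a => ⟨a.1, h.relabel_refine a.2⟩

theorem path_old {d : ℕ → ℝ} {x y : ℕ} {r : ℝ} (hx : s x ≠ 0) (p : WPath (same A s) w x y r) :
    WPath (same A (relabel n s d lam Y t)) w x y r :=
  p.lift (c := s x) fun z hz => by rw [relabel_of_ne (hz ▸ hx), hz]

/-- Every tail of a walk to the skeleton is shorter than the walk, so if the walk is short enough
for its start to be captured, all its vertices are. This connects the new supernode to its skeleton.
-/
theorem path_cap (hG : WG n A w) (hlam : 0 < lam) (hB : Huge n A w B)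
    (hP : BF n (same A s) w T B P pr) {x y : ℕ} {r : ℝ} (p : WPath (same A s) w x y r) (hT : T y)
    (hyn : y < n) (hs : s y = 0) (hY : Y ≤ Real.exp (-(lam * r))) :
    WPath (same A (relabel n s (P n) lam Y t)) w x y r ∧ Cap n s (P n) lam Y x := by
  have hG' := hG.same s
  have hB' := hB.mono (A' := same A s) (fun _ _ h => h.1)
  have key : ∀ {x r}, WPath (same A s) w x y r → Y ≤ Real.exp (-(lam * r)) →
      Cap n s (P n) lam Y x := by
    intro x r p hY
    have q := p.symm hG'
    refine ⟨q.lt_of_lt hG' hyn, p.same_label.trans hs, hY.trans (Real.exp_le_exp.2 ?_)⟩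
    have := (hP.le_path hG' hB' hyn hT q).1
    nlinarith
  refine ⟨?_, key p hY⟩
  induction p with
  | nil => exact .nil _
  | @cons x z y r a p ih =>
    have hY' : Y ≤ Real.exp (-(lam * r)) := hY.trans (Real.exp_le_exp.2 (by
      have := mul_nonneg hlam.le (hG'.nonneg a); linarith))
    have c1 := key (.cons a p) hY
    have c2 := key p hY'
    exact .cons ⟨a.1, (relabel_cap c1).trans (relabel_cap c2).symm⟩ (ih hT hyn hs hY' key)

/-- The lower bound on `Y` truncates the radius at `D`. As `D < B`, the table entry is the weight of
a genuine walk. -/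
theorem cap_path (hG : WG n A w) (hlam : 0 < lam) (hDB : D < B) (hP : BF n (same A s) w T B P pr)
    (hY : Real.exp (-(lam * D)) ≤ Y) {x : ℕ} (hx : Cap n s (P n) lam Y x) :
    ∃ y < n, T y ∧ P n x ≤ D ∧ WPath (same A s) w x y (P n x) := by
  have h1 : P n x ≤ D := by
    have := Real.exp_le_exp.1 (hY.trans hx.2.2)
    nlinarith
  obtain ⟨y, hy, hT, p⟩ := hP.path (hG.same s) le_rfl hx.1 (h1.trans_lt hDB)
  exact ⟨y, hy, hT, h1, p.symm (hG.same s)⟩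

/-- Capturing only splits the class of unassigned vertices and leaves the older supernodes as they
are, so statements about old labels persist and only the new supernode needs an argument. The count
of net points splits likewise: old net points lie in old supernodes, and new ones lie on the
skeleton. -/
theorem step (h : CopInv n A w D k t s N) (hG : WG n A w) (ht : t < n)
    (hk : Skel n A w D k s t T N N') (hB : Huge n A w B) (hDB : D < B)
    (hP : BF n (same A s) w T B P pr) (hlam : 0 < lam) (hY : Real.exp (-(lam * D)) ≤ Y)
    (hY1 : Y ≤ 1) : CopInv n A w D k (t + 1) (relabel n s (P n) lam Y t) N' := by
  have hG' := hG.same s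
  have hB' := hB.mono (A' := same A s) (fun _ _ h => h.1)
  have capT : ∀ x, T x → Cap n s (P n) lam Y x := fun x hx => by
    obtain ⟨h1, h2⟩ := hk.unassigned x hx
    exact ⟨h1, h2, by rw [hP.eq_zero hG' hB' h1 hx]; simpa using hY1⟩
  have pathT : ∀ {x y r}, WPath (restr (same A s) T) w x y r → WPath (same A (relabel n s (P n) lam Y t)) w x y r :=
    fun p => p.mono fun x y a =>
      ⟨a.1.1, (relabel_cap (capT x a.2.1)).trans (relabel_cap (capT y a.2.2)).symm⟩
  have toT : ∀ {x}, Cap n s (P n) lam Y x → ∃ y, T y ∧ P n x ≤ D ∧ WPath (same A (relabel n s (P n) lam Y t)) w x y (P n x) := by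
    intro x hx
    obtain ⟨y, hy, hT, h1, p⟩ := cap_path hG hlam hDB hP hY hx
    exact ⟨y, hT, h1, (path_cap hG hlam hB hP p hT hy (hk.unassigned y hT).2 hx.2.2).1⟩
  have toRoot : ∀ {x}, Cap n s (P n) lam Y x → ∃ r, WPath (same A (relabel n s (P n) lam Y t)) w x t r := by
    intro x hx
    obtain ⟨y, hT, -, p⟩ := toT hx
    obtain ⟨r, q⟩ := hk.conn y hT
    exact ⟨_, p.trans (pathT q)⟩
  have hne : ∀ {x l}, l ≠ t + 1 → relabel n s (P n) lam Y t x = l → s x = l := by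
    intro x l hl e
    by_cases hx : Cap n s (P n) lam Y x
    · exact (hl (e.symm.trans (relabel_cap hx))).elim
    · rwa [relabel_not_cap hx] at e
  have adjOld : ∀ {u l}, l ≠ t + 1 → AdjLabel A w (relabel n s (P n) lam Y t) u l → AdjLabel A w s u l := by
    rintro u l hl ⟨h0, y, r, z, p, a, e⟩
    exact ⟨h0, y, r, z, h.path_refine p, a, hne hl e⟩
  -- If the component of `u` still borders both the new supernode and `l`, then before the step `u`
  -- was in the component of the root. So `l` was adjacent to the root, and the skeleton touches
  -- `l`.
  have adjNew : ∀ {u l}, relabel n s (P n) lam Y t u = 0 → l ≠ t + 1 → AdjLabel A w (relabel n s (P n) lam Y t) u l → AdjLabel A w (relabel n s (P n) lam Y t) u (t + 1) →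
      ∃ x z, A x z ∧ relabel n s (P n) lam Y t x = t + 1 ∧ relabel n s (P n) lam Y t z = l := by
    rintro u l hu hl hul ⟨-, y, r, z, p, a, e⟩
    have hz := h.relabel_eq_succ.1 e
    obtain ⟨r', q⟩ := toRoot hz
    have hu0 : s u = 0 := hne (by omega) hu
    have hsy : s y = 0 := (h.path_refine p).same_label.symm.trans hu0
    have p1 : WPath (same A s) w u t _ := (h.path_refine p).trans
      (.cons ⟨a, hsy.trans hz.2.1.symm⟩ (h.path_refine q))
    obtain ⟨h0, y', r'', z', p', a', e'⟩ := adjOld hl hul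
    obtain ⟨x, z, h1, h2, h3⟩ := hk.touch l ⟨h0, y', _, z', (p1.symm hG').trans p', a', e'⟩
    exact ⟨x, z, h2, relabel_cap (capT x h1), by rw [relabel_of_ne (by omega), h3]⟩
  refine ⟨?_, ?_, ?_, ?_, ?_, ?_, ?_, ?_⟩
  · intro x hx
    rw [relabel_not_cap fun h' => by have := h'.1; omega]
    exact h.zero x hx
  · intro x
    unfold relabel
    split_ifs
    · exact le_rfl
    · exact (h.le x).trans (Nat.le_succ t)
  · intro x hx hn
    by_cases hc : Cap n s (P n) lam Y x
    · rw [relabel_cap hc]; omega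
    · rw [relabel_not_cap hc]
      rcases Nat.lt_succ_iff_lt_or_eq.1 hx with h' | rfl
      · exact h.done x h' hn
      · exact (hc (capT _ hk.root)).elim
  · intro x y hxy hx
    by_cases hc : Cap n s (P n) lam Y x
    · have hy := h.relabel_eq_succ.1 (hxy.symm.trans (relabel_cap hc))
      obtain ⟨r, p⟩ := toRoot hc
      obtain ⟨r', p'⟩ := toRoot hy
      exact ⟨_, p.trans (p'.symm (hG.same _))⟩
    · have e := h.relabel_refine hxy
      rw [relabel_not_cap hc] at hx
      obtain ⟨r, p⟩ := h.conn x y e hx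
      exact ⟨r, path_old hx p⟩
  · intro u hu hs l l' hll hl hl'
    by_cases h1 : l = t + 1
    · subst h1
      exact adjNew hs (Ne.symm hll) hl' hl
    · by_cases h2 : l' = t + 1
      · subst h2
        obtain ⟨x, z, a, e1, e2⟩ := adjNew hs hll hl hl'
        exact ⟨z, x, hG.symm a, e2, e1⟩
      · obtain ⟨x, z, a, e1, e2⟩ := h.adj u hu (hne (by omega) hs) l l' hll (adjOld h1 hl)
          (adjOld h2 hl')
        have := hl.1
        have := hl'.1
        exact ⟨x, z, a, by rw [relabel_of_ne (by omega), e1], by rw [relabel_of_ne (by omega), e2]⟩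
  · intro c hc
    rcases hk.new c hc with h' | h'
    · rw [relabel_of_ne (h.net c h')]; exact h.net c h'
    · rw [relabel_cap (capT c h')]; omega
  · intro u hu
    by_cases hc : Cap n s (P n) lam Y u
    · obtain ⟨y, hT, h1, p⟩ := toT hc
      obtain ⟨c, r, h2, -, h3, q⟩ := hk.cover y hT
      -- `2 * D` is `D` to reach the skeleton plus `D` along the skeleton to a net point.
      exact ⟨c, _, h2, by linarith, p.trans (pathT q)⟩
    · rw [relabel_not_cap hc] at hu
      obtain ⟨c, r, h1, h2, p⟩ := h.cover u hu
      exact ⟨c, r, hk.old c h1, h2, path_old hu p⟩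
  · intro u hu F hF
    by_cases hc : Cap n s (P n) lam Y u
    · refine hk.count u F fun c hcF => ?_
      obtain ⟨h1, r, h2, p⟩ := hF c hcF
      have h3 := (h.relabel_eq_succ.1 (p.same_label.symm.trans (relabel_cap hc))).2.1
      refine ⟨h1, (hk.new c h1).resolve_left fun h' => h.net c h' h3, r, h2, h.path_refine p⟩
    · rw [relabel_not_cap hc] at hu
      refine h.count u hu F fun c hcF => ?_
      obtain ⟨h1, r, h2, p⟩ := hF c hcF
      have h3 := (h.path_refine p).same_label
      refine ⟨(hk.new c h1).resolve_right fun h' => hu ?_, r, h2, h.path_refine p⟩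
      rw [h3, (hk.unassigned c h').2]

end Step

end CopInv

end LDD

/-! ### Resampling one coin. -/

namespace RealRAM

open MeasureTheory

instance : IsProbabilityMeasure coins := by
  unfold coins; infer_instance

theorem measurable_resample (i : ℕ) :
    Measurable fun p : (ℕ → unitInterval) × unitInterval => Function.update p.1 i p.2 := by
  refine measurable_pi_iff.2 fun j => ?_
  by_cases h : j = i
  · subst h; simpa using measurable_snd
  · simp only [Function.update_of_ne h]
    exact (measurable_pi_apply j).comp measurable_fst

/-- Resampling a coordinate does not change the law of the coins. -/
theorem map_update_coins (i : ℕ) :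
    (coins.prod (volume : Measure unitInterval)).map (fun p => Function.update p.1 i p.2) = coins := by
  have hm := measurable_resample i
  refine Measure.eq_infinitePi _ fun s t ht => ?_
  rw [Measure.map_apply hm (MeasurableSet.pi s.countable_toSet fun i _ => ht i)]
  have e : (fun p : (ℕ → unitInterval) × unitInterval => Function.update p.1 i p.2) ⁻¹'
      Set.pi s t = (Set.pi (s.erase i) t) ×ˢ (if i ∈ s then t i else Set.univ) := by
    ext ⟨ω, x⟩
    simp only [Set.mem_preimage, Set.mem_pi, Finset.mem_coe, Set.mem_prod, Finset.mem_erase]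
    constructor
    · intro h
      refine ⟨fun j hj => by simpa [Function.update_of_ne hj.1] using h j hj.2, ?_⟩
      split_ifs with hi
      · simpa using h i hi
      · trivial
    · rintro ⟨h1, h2⟩ j hj
      by_cases hji : j = i
      · subst hji; simpa [hj] using h2
      · simpa [Function.update_of_ne hji] using h1 j ⟨hji, hj⟩
  rw [e, Measure.prod_prod]
  unfold coins
  rw [Measure.infinitePi_pi _ fun i _ => ht i]
  split_ifs with hi
  · rw [mul_comm, Finset.mul_prod_erase s (fun i => volume (t i)) hi]
  · rw [Finset.erase_eq_of_notMem hi]; simp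

/-- Integration over coin `i` with all other coins fixed. This replaces conditional expectations
throughout. -/
theorem lintegral_resample (i : ℕ) {f : (ℕ → unitInterval) → ℝ≥0∞} (hf : Measurable f) :
    ∫⁻ ω, f ω ∂coins = ∫⁻ ω, (∫⁻ x : unitInterval, f (Function.update ω i x)) ∂coins := by
  have hm := measurable_resample i
  conv_lhs => rw [← map_update_coins i]
  rw [lintegral_map hf hm]
  exact lintegral_prod _ (hf.comp hm).aemeasurable

end RealRAM

/-! ### Truncated exponential variables, in the form of uniform variables on `[E, 1]`. -/

namespace LDD

open MeasureTheory

/-- The point of `[E, 1]` that corresponds to `x` in `[0, 1]`. -/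
def unif (E : ℝ) (x : unitInterval) : ℝ := E + (1 - E) * x

theorem measurable_unif (E : ℝ) : Measurable (unif E) :=
  measurable_const.add (measurable_const.mul measurable_subtype_coe)

theorem le_unif {E : ℝ} (hE : E ≤ 1) (x : unitInterval) : E ≤ unif E x := by
  have := mul_nonneg (sub_nonneg.2 hE) x.2.1
  unfold unif; linarith

theorem unif_le {E : ℝ} (hE : E ≤ 1) (x : unitInterval) : unif E x ≤ 1 := by
  have := mul_le_mul_of_nonneg_left x.2.2 (sub_nonneg.2 hE)
  unfold unif; linarith

theorem lintegral_unif {E : ℝ} (hE : E < 1) {f : ℝ → ℝ≥0∞} (hf : Measurable f) :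
    ∫⁻ x, f (unif E x) = ENNReal.ofReal (1 - E)⁻¹ * ∫⁻ y in Set.Icc E 1, f y := by
  have h1 : 0 < 1 - E := by linarith
  have e1 : ∫⁻ x, f (unif E x) = ∫⁻ x in Set.Icc (0 : ℝ) 1, f (E + (1 - E) * x) :=
    lintegral_subtype_comap (μ := volume) measurableSet_Icc (fun x : ℝ => f (E + (1 - E) * x))
  have e2 : ∀ x : ℝ, (Set.Icc (0 : ℝ) 1).indicator (fun x => f (E + (1 - E) * x)) x
      = (Set.Icc E 1).indicator f (E + (1 - E) * x) := by
    intro x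
    have : x ∈ Set.Icc (0 : ℝ) 1 ↔ E + (1 - E) * x ∈ Set.Icc E 1 := by
      simp only [Set.mem_Icc]
      constructor
      · rintro ⟨a, b⟩; constructor <;> nlinarith
      · rintro ⟨a, b⟩; constructor <;> nlinarith
    simp only [Set.indicator_apply, this]
  rw [e1, ← lintegral_indicator measurableSet_Icc, ← lintegral_indicator measurableSet_Icc]
  simp_rw [e2]
  have hF : Measurable ((Set.Icc E 1).indicator f) := hf.indicator measurableSet_Icc
  have m1 : Measurable fun x : ℝ => E + x := measurable_const.add measurable_id
  have m2 : Measurable fun x : ℝ => (1 - E) * x := measurable_const.mul measurable_id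
  have e3 := lintegral_map (μ := (volume : Measure ℝ)) (hF.comp m1) m2
  rw [Real.map_volume_mul_left h1.ne', lintegral_smul_measure, abs_of_pos (inv_pos.2 h1)] at e3
  simp only [Function.comp_def] at e3
  rw [← e3, lintegral_add_left_eq_self (μ := (volume : Measure ℝ)) ((Set.Icc E 1).indicator f) E]
  simp

theorem volume_unif {E : ℝ} (hE : E < 1) {S : Set ℝ} (hS : MeasurableSet S) :
    volume {x | unif E x ∈ S} = ENNReal.ofReal (1 - E)⁻¹ * volume (S ∩ Set.Icc E 1) := by
  have h := lintegral_unif hE (f := S.indicator 1) (measurable_const.indicator hS)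
  rw [lintegral_indicator_one hS, Measure.restrict_apply hS] at h
  rw [← h]
  exact (lintegral_indicator_one ((measurable_unif E) hS)).symm

/-- A truncated exponential variable that exceeds `log t⁻¹` rarely exceeds it by little only. -/
theorem volume_unif_window {E s t : ℝ} (hE0 : 0 < E) (hE : E < 1) (hs : 0 ≤ s) (hs1 : s ≤ 1) :
    volume {x | unif E x ∈ Set.Icc (t * s) t} ≤
      ENNReal.ofReal (1 - s) * (volume {x | unif E x < t} + ENNReal.ofReal (E / (1 - E))) := by
  have h1 : 0 < 1 - E := by linarith
  have e1 := volume_unif hE (S := Set.Iio t) measurableSet_Iio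
  simp only [Set.mem_Iio] at e1
  rw [volume_unif hE measurableSet_Icc, e1]
  have key : volume (Set.Icc (t * s) t ∩ Set.Icc E 1) ≤
      ENNReal.ofReal (1 - s) * (volume (Set.Iio t ∩ Set.Icc E 1) + ENNReal.ofReal E) := by
    rcases lt_or_ge t E with ht | ht
    · have : Set.Icc (t * s) t ∩ Set.Icc E 1 = ∅ := by
        ext y; simp only [Set.mem_inter_iff, Set.mem_Icc, Set.mem_empty_iff_false, iff_false]
        rintro ⟨⟨_, a⟩, b, _⟩; linarith
      rw [this]; simp
    · have hsub : Set.Ico E (min t 1) ⊆ Set.Iio t ∩ Set.Icc E 1 := fun y hy =>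
        ⟨hy.2.trans_le (min_le_left _ _), hy.1, (hy.2.trans_le (min_le_right _ _)).le⟩
      have hsub' : Set.Icc (t * s) t ∩ Set.Icc E 1 ⊆ Set.Icc (min t 1 * s) (min t 1) := fun y hy =>
        ⟨(mul_le_mul_of_nonneg_right (min_le_left _ _) hs).trans hy.1.1, le_min hy.1.2 hy.2.2⟩
      have hm : E ≤ min t 1 := le_min ht hE.le
      -- The window has length `(1 - s) * m` with `m = min t 1 = (m - E) + E`. The first summand is
      -- the length of the event that the variable is below `t`; the second is the price of
      -- truncation.
      calc _ ≤ volume (Set.Icc (min t 1 * s) (min t 1)) := measure_mono hsub'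
        _ = ENNReal.ofReal ((1 - s) * ((min t 1 - E) + E)) := by
            rw [Real.volume_Icc]; congr 1; ring
        _ = ENNReal.ofReal (1 - s) * (volume (Set.Ico E (min t 1)) + ENNReal.ofReal E) := by
            rw [ENNReal.ofReal_mul (by linarith), ENNReal.ofReal_add (by linarith) hE0.le,
              Real.volume_Ico]
        _ ≤ _ := by gcongr
  calc _ ≤ ENNReal.ofReal (1 - E)⁻¹ *
        (ENNReal.ofReal (1 - s) * (volume (Set.Iio t ∩ Set.Icc E 1) + ENNReal.ofReal E)) := by gcongr
    _ = _ := by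
      rw [div_eq_inv_mul, ENNReal.ofReal_mul (inv_nonneg.2 h1.le)]
      ring

end LDD

/-! ### The drift of the potential: arithmetic. -/

namespace LDD

open MeasureTheory Real

theorem exp_sub_exp_neg_le {η : ℝ} (h0 : 0 ≤ η) (h1 : η ≤ 1) : exp η - exp (-η) ≤ 3 * η := by
  have e1 : exp η ≤ 1 + η + η ^ 2 := by
    have := Real.abs_exp_sub_one_sub_id_le (x := η) (by rw [abs_of_nonneg h0]; exact h1)
    have := (abs_le.1 this).2
    linarith
  have e2 := Real.add_one_le_exp (-η)
  nlinarith

/-- With `E = exp (-(3 * k))` and `q = 1 / (2 * k)` the left side is `E ^ q`; both parameters are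
matched so that it does not depend on `k`. -/
theorem exp_neg_three_halves_le : exp (-(3 / 2)) ≤ 1 / 4 := by
  have h : (4 : ℝ) ≤ exp (3 / 2) := by
    have e1 : exp (3 / 2) ^ 2 = exp 1 ^ 3 := by
      rw [← Real.exp_nat_mul, ← Real.exp_nat_mul]; norm_num
    have e2 := Real.exp_one_gt_d9
    have e3 : (2.7 : ℝ) ^ 3 ≤ exp 1 ^ 3 := pow_le_pow_left₀ (by norm_num) (by linarith) 3
    have := Real.exp_pos (3 / 2)
    nlinarith
  rw [Real.exp_neg, one_div]
  exact inv_anti₀ (by norm_num) h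

section

variable {k : ℕ} {E X η q : ℝ}

/-- The arithmetic behind the drift of the potential. -/
theorem drift_arith (hk : 1 ≤ k) (hq : q = 1 / (2 * k)) (hE : E = exp (-(3 * k))) (hX : 0 < X)
    (hX1 : X ≤ 1) (h0 : 0 ≤ η) (h1 : η ≤ 1) (J : Finset ℕ) (hJ : J.card ≤ k) (b : ℕ → ℝ)
    (hb : ∀ l ∈ J, 0 < b l ∧ b l ≤ 1) {I₁ : ℝ} (hI : I₁ ≤ X * exp η - X * exp (-η))
    (hI' : X * exp η < E → I₁ ≤ 0) :
    I₁ + 12 * η / k * ∑ l ∈ J, b l ^ (1 + q) * max 0 (X / b l - E) ≤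
      12 * η / k * (3 * k * max 0 (X - E) + X * (2 * k) * ((X / max X E) ^ q - X ^ q)) := by
  have hk' : (1 : ℝ) ≤ k := by exact_mod_cast hk
  have hkp : (0 : ℝ) < k := by linarith
  have hq0 : 0 < q := by rw [hq]; positivity
  have hq1 : q ≤ 1 / 2 := by
    rw [hq]; apply one_div_le_one_div_of_le <;> linarith
  have hE0 : 0 < E := by rw [hE]; exact exp_pos _
  have hEq : E ^ q ≤ 1 / 4 := by
    rw [hE, ← Real.exp_mul]
    refine le_trans (le_of_eq ?_) exp_neg_three_halves_le
    congr 1; rw [hq]; field_simp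
  have hI3 : I₁ ≤ 3 * η * X := by
    have := mul_le_mul_of_nonneg_left (exp_sub_exp_neg_le h0 h1) hX.le
    linarith
  have hK : 0 ≤ 12 * η / k := by positivity
  -- The proximity `b l` is lost only for `y ≤ X / b l`. On `[E, 1]` this has positive measure only
  -- if `b l ≤ X / E`, and the expected loss is then at most `X * b l ^ q`.
  have hsplit : ∀ l ∈ J, ∀ c : ℝ, 0 ≤ c → (b l ≤ X / E → b l ^ q ≤ c) →
      b l ^ (1 + q) * max 0 (X / b l - E) ≤ X * c := by
    intro l hl c hc hbc
    obtain ⟨b0, b1⟩ := hb l hl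
    rcases le_or_gt (X / b l - E) 0 with h | h
    · rw [max_eq_left h]; simp; positivity
    · rw [max_eq_right h.le, Real.rpow_add b0, Real.rpow_one]
      have hbx : b l ≤ X / E := by
        rw [le_div_iff₀ hE0]
        have : E < X / b l := by linarith
        rw [lt_div_iff₀ b0] at this
        linarith
      have hbq := hbc hbx
      have hb0 : 0 ≤ b l ^ q := Real.rpow_nonneg b0.le q
      have : b l * b l ^ q * (X / b l - E) = b l ^ q * (X - E * b l) := by field_simp
      rw [this]
      have : 0 ≤ E * b l := by positivity
      nlinarith
  have hsum : ∀ c : ℝ, 0 ≤ c → (∀ l ∈ J, b l ≤ X / E → b l ^ q ≤ c) →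
      ∑ l ∈ J, b l ^ (1 + q) * max 0 (X / b l - E) ≤ k * (X * c) := by
    intro c hc h
    refine (Finset.sum_le_card_nsmul J _ (X * c) fun l hl => hsplit l hl c hc (h l hl)).trans ?_
    rw [nsmul_eq_mul]
    have : (J.card : ℝ) ≤ k := by exact_mod_cast hJ
    gcongr
  -- If `X ≤ E`, the vertex is beyond the maximal radius, up to a null event. With `x = X / E`, the
  -- new label gains at least `3 / 2 * k * X * x ^ q` because `E ^ q ≤ 1 / 4`; the old labels lose
  -- at most `k * X * x ^ q`, and the difference pays for the cut.
  rcases le_or_gt X E with hXE | hXE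
  · rw [max_eq_left (by linarith : X - E ≤ 0), max_eq_right hXE]
    set x := X / E with hx
    have hx0 : 0 < x := by positivity
    have hxq : 0 ≤ x ^ q := Real.rpow_nonneg hx0.le q
    have hs := hsum (x ^ q) hxq fun l hl h => Real.rpow_le_rpow (hb l hl).1.le h hq0.le
    have hXq : X ^ q = x ^ q * E ^ q := by
      rw [← Real.mul_rpow hx0.le hE0.le, hx]; congr 1; field_simp
    -- The cut window meets `[E, 1]` only if `x ≥ exp (-η) ≥ exp (-1)`, and then `x ^ q ≥ 1 / 2`.
    have hI4 : I₁ ≤ 6 * η * (X * x ^ q) := by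
      rcases lt_or_ge (X * exp η) E with h | h
      · have := hI' h
        have : 0 ≤ 6 * η * (X * x ^ q) := by positivity
        linarith
      · have hx1 : exp (-1) ≤ x := by
          rw [hx, le_div_iff₀ hE0, Real.exp_neg, inv_mul_le_iff₀ (exp_pos _)]
          have := Real.exp_le_exp.2 h1
          nlinarith
        have : (1 : ℝ) / 2 ≤ x ^ q := by
          calc (1 : ℝ) / 2 ≤ exp (-(1 / 2)) := by
                have := Real.add_one_le_exp (-(1 / 2) : ℝ); linarith
            _ ≤ exp (-q) := Real.exp_le_exp.2 (by linarith)
            _ = exp (-1) ^ q := by rw [← Real.exp_mul]; ring_nf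
            _ ≤ x ^ q := Real.rpow_le_rpow (exp_pos _).le hx1 hq0.le
        have : 0 ≤ η * X := by positivity
        nlinarith
    have hgoal : 12 * η / k * (3 * k * 0 + X * (2 * k) * (x ^ q - X ^ q)) ≥
        12 * η / k * (X * (2 * k) * (x ^ q * (3 / 4))) := by
      apply mul_le_mul_of_nonneg_left _ hK
      rw [hXq]
      have : 0 ≤ X * (2 * k) := by positivity
      have : x ^ q * (3 / 4) ≤ x ^ q - x ^ q * E ^ q := by nlinarith
      nlinarith
    have e1 : 12 * η / k * (X * (2 * k) * (x ^ q * (3 / 4))) = 18 * η * (X * x ^ q) := by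
      field_simp; ring
    have e2 : 12 * η / k * (k * (X * x ^ q)) = 12 * η * (X * x ^ q) := by field_simp
    have := mul_le_mul_of_nonneg_left hs hK
    linarith
  · rw [max_eq_right (by linarith : 0 ≤ X - E), max_eq_left hXE.le, div_self hX.ne', Real.one_rpow]
    have hs := hsum 1 zero_le_one fun l hl _ => Real.rpow_le_one (hb l hl).1.le (hb l hl).2 hq0.le
    have hXq0 : 0 ≤ X ^ q := Real.rpow_nonneg hX.le q
    have hXq1 : X ^ q ≤ 1 := Real.rpow_le_one hX.le hX1 hq0.le
    -- In units of `12 * η`, the losses amount to at most `X` and the cut to at most `X / 4`. If `X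
    -- ^ q ≤ 3 / 8`, the new label pays for both. Otherwise `E / X ≤ 4 / 9`, and the probability of
    -- capture pays.
    have key : 5 / 4 * X ≤ 3 * (X - E) + 2 * X * (1 - X ^ q) := by
      rcases le_or_gt (X ^ q) (3 / 8) with h | h
      · nlinarith
      · have hu : (E / X) ^ q ≤ 2 / 3 := by
          rw [Real.div_rpow hE0.le hX.le, div_le_iff₀ (by linarith)]; linarith
        have hu0 : 0 ≤ (E / X) ^ q := by positivity
        have he : E / X = ((E / X) ^ q) ^ (2 * k) := by
          rw [← Real.rpow_natCast, ← Real.rpow_mul (by positivity), hq]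
          push_cast
          rw [one_div, inv_mul_cancel₀ (by positivity), Real.rpow_one]
        have h2 : E / X ≤ 4 / 9 := by
          rw [he, pow_mul]
          have h3 : ((E / X) ^ q) ^ 2 ≤ 4 / 9 := by nlinarith
          calc (((E / X) ^ q) ^ 2) ^ k ≤ (4 / 9 : ℝ) ^ k := pow_le_pow_left₀ (by positivity) h3 k
            _ ≤ (4 / 9 : ℝ) ^ 1 := pow_le_pow_of_le_one (by norm_num) (by norm_num) hk
            _ = _ := by norm_num
        rw [div_le_iff₀ hX] at h2
        nlinarith
    have e1 : 12 * η / k * (3 * k * (X - E) + X * (2 * k) * (1 - X ^ q)) =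
        12 * η * (3 * (X - E) + 2 * X * (1 - X ^ q)) := by field_simp
    have e2 : 12 * η / k * (k * (X * 1)) = 12 * η * X := by field_simp
    have h1 := mul_le_mul_of_nonneg_left hs hK
    have h2 := mul_le_mul_of_nonneg_left key (by positivity : 0 ≤ 12 * η)
    rw [e1]
    rw [e2] at h1
    linarith

end

end LDD

/-! ### The drift of the potential: integration over the random radius. -/

namespace LDD

open MeasureTheory Real

theorem integral_Icc_indicator {E : ℝ} {S : Set ℝ} (hS : MeasurableSet S) :
    ∫ y in Set.Icc E 1, S.indicator (fun _ => (1 : ℝ)) y = volume.real (S ∩ Set.Icc E 1) := by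
  rw [integral_indicator hS]
  simp [measureReal_restrict_apply hS]

theorem integrableOn_Icc_indicator {E : ℝ} {S : Set ℝ} (hS : MeasurableSet S) :
    IntegrableOn (S.indicator (fun _ => (1 : ℝ))) (Set.Icc E 1) :=
  (integrable_const (1 : ℝ)).indicator hS

/-- Up to the normalization `1 - E`, this is the expected contribution of the new label to the
potential, over the radii that do not capture the vertex. -/
theorem integral_rpow_div {E X q : ℝ} (hE1 : E < 1) (hX : 0 < X) (hX1 : X ≤ 1)
    (hq : 0 < q) :
    ∫ y in Set.Icc E 1, (Set.Ioi X).indicator (fun y => (X / y) ^ (1 + q)) y =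
      X * (1 / q) * ((X / max X E) ^ q - X ^ q) := by
  set a := max X E with ha
  have ha0 : 0 < a := lt_of_lt_of_le hX (le_max_left _ _)
  have ha1 : a ≤ 1 := max_le hX1 hE1.le
  have e0 : ∫ y in Set.Icc E 1, (Set.Ioi X).indicator (fun y => (X / y) ^ (1 + q)) y =
      ∫ y in Set.Ioc a 1, (X / y) ^ (1 + q) := by
    rw [setIntegral_indicator measurableSet_Ioi]
    refine setIntegral_congr_set ?_
    rcases le_or_gt E X with h | h
    · have : Set.Icc E 1 ∩ Set.Ioi X = Set.Ioc a 1 := by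
        ext y; simp only [Set.mem_inter_iff, Set.mem_Icc, Set.mem_Ioi, Set.mem_Ioc, ha, max_eq_left h]
        constructor
        · rintro ⟨⟨_, h1⟩, h2⟩; exact ⟨h2, h1⟩
        · rintro ⟨h1, h2⟩; exact ⟨⟨by linarith, h2⟩, h1⟩
      exact Filter.EventuallyEq.of_eq this
    · have : Set.Icc E 1 ∩ Set.Ioi X = Set.Icc a 1 := by
        ext y; simp only [Set.mem_inter_iff, Set.mem_Icc, Set.mem_Ioi, ha, max_eq_right h.le]
        constructor
        · rintro ⟨h1, h2⟩; exact h1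
        · rintro ⟨h1, h2⟩; exact ⟨⟨h1, h2⟩, by linarith⟩
      rw [this]
      exact Ioc_ae_eq_Icc.symm
  have e1 : ∀ y ∈ Set.Ioc a 1, (X / y) ^ (1 + q) = X ^ (1 + q) * y ^ (-(1 + q)) := by
    intro y hy
    have hy0 : 0 < y := ha0.trans hy.1
    rw [Real.div_rpow hX.le hy0.le, Real.rpow_neg hy0.le, div_eq_mul_inv]
  rw [e0, setIntegral_congr_fun measurableSet_Ioc e1, integral_const_mul,
    ← intervalIntegral.integral_of_le ha1, integral_rpow (Or.inr ⟨by linarith, by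
      rw [Set.uIcc_of_le ha1]; exact fun h => by linarith [h.1]⟩)]
  rw [show -(1 + q) + 1 = -q by ring, Real.one_rpow, Real.rpow_neg ha0.le,
    Real.div_rpow hX.le ha0.le, Real.rpow_add hX, Real.rpow_one]
  have : 0 < a ^ q := Real.rpow_pos_of_pos ha0 q
  field_simp
  ring

section

variable {k : ℕ} {E X η q : ℝ}

open Classical in
/-- The bound on the cost after a step as a function of the random radius. -/
noncomputable def stepCost (k : ℕ) (η q X : ℝ) (J : Finset ℕ) (b : ℕ → ℝ) (y : ℝ) : ℝ :=
  (Set.Ioc (X * exp (-η)) (X * exp η)).indicator (fun _ => 1) y +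
    12 * η / k * (if X < y then
      3 * k - ∑ l ∈ J, (if X < y * b l then b l ^ (1 + q) else 0) - (X / y) ^ (1 + q) else 0)

/-- At most `k` old labels and one new label contribute at most `1` each, and `k + 1 ≤ 3 * k`. So
the remaining cost is nonnegative. -/
theorem indicator_le_stepCost (hk : 1 ≤ k) (hη : 0 ≤ η) (hq : 0 < q) (hX : 0 ≤ X) {J : Finset ℕ}
    (hJ : J.card ≤ k) {b : ℕ → ℝ} (hb : ∀ l ∈ J, 0 < b l ∧ b l ≤ 1) (y : ℝ) :
    (Set.Ioc (X * exp (-η)) (X * exp η)).indicator (fun _ => (1 : ℝ)) y ≤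
      stepCost k η q X J b y := by
  have hk' : (1 : ℝ) ≤ k := by exact_mod_cast hk
  unfold stepCost
  refine le_add_of_nonneg_right (mul_nonneg (by positivity) ?_)
  split_ifs with h
  · have h1 : (X / y) ^ (1 + q) ≤ 1 := by
      have hy : 0 < y := lt_of_le_of_lt hX h
      refine Real.rpow_le_one (by positivity) ?_ (by linarith)
      rw [div_le_one hy]; exact h.le
    have h2 : ∑ l ∈ J, (if X < y * b l then b l ^ (1 + q) else 0) ≤ k := by
      refine (Finset.sum_le_card_nsmul J _ 1 fun l hl => ?_).trans ?_
      · split_ifs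
        · exact Real.rpow_le_one (hb l hl).1.le (hb l hl).2 (by linarith)
        · exact zero_le_one
      · simpa using hJ
    linarith
  · exact le_rfl

theorem stepCost_nonneg (hk : 1 ≤ k) (hη : 0 ≤ η) (hq : 0 < q) (hX : 0 ≤ X) {J : Finset ℕ}
    (hJ : J.card ≤ k) {b : ℕ → ℝ} (hb : ∀ l ∈ J, 0 < b l ∧ b l ≤ 1) (y : ℝ) :
    0 ≤ stepCost k η q X J b y :=
  (Set.indicator_nonneg (fun _ _ => zero_le_one) y).trans (indicator_le_stepCost hk hη hq hX hJ hb y)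

theorem measurable_stepCost (J : Finset ℕ) (b : ℕ → ℝ) : Measurable (stepCost k η q X J b) := by
  unfold stepCost
  refine (measurable_const.indicator measurableSet_Ioc).add (measurable_const.mul ?_)
  refine Measurable.ite measurableSet_Ioi (((measurable_const).sub ?_).sub ?_) measurable_const
  · refine Finset.measurable_sum _ fun l _ => ?_
    exact Measurable.ite (measurableSet_lt measurable_const (measurable_id.mul_const _))
      measurable_const measurable_const
  · exact (measurable_const.div measurable_id).pow_const _

/-- The expected cost does not increase in a step. -/
theorem potential_drift (hk : 1 ≤ k) (hq : q = 1 / (2 * k)) (hE : E = exp (-(3 * k))) (hX : 0 ≤ X)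
    (hX1 : X ≤ 1) (h0 : 0 ≤ η) (h1 : η ≤ 1) (J : Finset ℕ) (hJ : J.card ≤ k) (b : ℕ → ℝ)
    (hb : ∀ l ∈ J, 0 < b l ∧ b l ≤ 1) :
    ∫⁻ x, ENNReal.ofReal (stepCost k η q X J b (unif E x)) ≤
      ENNReal.ofReal (12 * η / k * (3 * k - ∑ l ∈ J, b l ^ (1 + q))) := by
  have hk' : (1 : ℝ) ≤ k := by exact_mod_cast hk
  have hkp : (0 : ℝ) < k := by linarith
  have hq0 : 0 < q := by rw [hq]; positivity
  have hE0 : 0 < E := by rw [hE]; exact exp_pos _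
  have hE1 : E < 1 := by rw [hE, ← Real.exp_zero]; exact Real.exp_lt_exp.2 (by linarith)
  set K : ℝ := 12 * η / k with hKdef
  have hK : 0 ≤ K := by positivity
  set c : ℝ := K * (3 * k - ∑ l ∈ J, b l ^ (1 + q)) with hc
  set I : Set ℝ := Set.Ioc (X * exp (-η)) (X * exp η) with hIdef
  let one : Set ℝ → ℝ → ℝ := fun S => S.indicator fun _ => 1
  let S : ℕ → Set ℝ := fun l => {y | y * b l ≤ X}
  have hS : ∀ l, MeasurableSet (S l) := fun l =>
    measurableSet_le (measurable_id.mul_const _) measurable_const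
  let R : ℝ → ℝ := (Set.Ioi X).indicator fun y => (X / y) ^ (1 + q)
  -- Balance sheet: old cost `c`, plus the cut, plus the lost labels, minus the full `3 * k` upon
  -- capture, minus the gain `R` from the new label. Upon capture all labels count as lost, which
  -- cancels the sum in `c`.
  have heq : ∀ y ∈ Set.Icc E 1, stepCost k η q X J b y =
      c + one I y + K * (∑ l ∈ J, b l ^ (1 + q) * one (S l) y) - K * (3 * k * one (Set.Iic X) y)
        - K * R y := by
    intro y hy
    have hy0 : 0 < y := hE0.trans_le hy.1
    simp only [stepCost, one, R, hc]
    rcases lt_or_ge X y with h | h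
    · rw [if_pos h, Set.indicator_of_notMem (s := Set.Iic X) (by simpa using h),
        Set.indicator_of_mem (s := Set.Ioi X) (by simpa using h)]
      have : ∑ l ∈ J, (if X < y * b l then b l ^ (1 + q) else 0) = ∑ l ∈ J, b l ^ (1 + q) -
          ∑ l ∈ J, b l ^ (1 + q) * (S l).indicator (fun _ => 1) y := by
        rw [← Finset.sum_sub_distrib]
        refine Finset.sum_congr rfl fun l _ => ?_
        by_cases hl : X < y * b l
        · rw [if_pos hl, Set.indicator_of_notMem (by simpa [S] using hl)]; ring
        · rw [if_neg hl, Set.indicator_of_mem (by simpa [S] using hl)]; ring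
      rw [this]; ring
    · rw [if_neg (not_lt.2 h), Set.indicator_of_mem (s := Set.Iic X) (by simpa using h),
        Set.indicator_of_notMem (s := Set.Ioi X) (by simpa using h)]
      have : ∑ l ∈ J, b l ^ (1 + q) * (S l).indicator (fun _ => 1) y = ∑ l ∈ J, b l ^ (1 + q) := by
        refine Finset.sum_congr rfl fun l hl => ?_
        rw [Set.indicator_of_mem, mul_one]
        show y * b l ≤ X
        nlinarith [(hb l hl).2]
      rw [this]; ring
  have i1 : ∀ {S : Set ℝ}, MeasurableSet S → IntegrableOn (one S) (Set.Icc E 1) :=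
    fun h => integrableOn_Icc_indicator h
  have iR : IntegrableOn R (Set.Icc E 1) := by
    refine Measure.integrableOn_of_bounded (M := 1) (by simp) ?_ ?_
    · exact (((measurable_const.div measurable_id).pow_const _).indicator
        measurableSet_Ioi).aestronglyMeasurable
    · refine (ae_restrict_iff' measurableSet_Icc).2 (Filter.Eventually.of_forall fun y hy => ?_)
      have hy0 : 0 < y := hE0.trans_le hy.1
      simp only [R, Set.indicator_apply]
      split_ifs with h
      · rw [Real.norm_of_nonneg (by positivity)]
        refine Real.rpow_le_one (by positivity) ?_ (by linarith)
        rw [div_le_one hy0]; exact (Set.mem_Ioi.1 h).le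
      · simp
  have iS : IntegrableOn (fun y => K * ∑ l ∈ J, b l ^ (1 + q) * one (S l) y) (Set.Icc E 1) :=
    Integrable.const_mul (integrable_finsetSum _ fun l _ => (i1 (hS l)).const_mul _) _
  have iT : IntegrableOn (fun y => K * (3 * k * one (Set.Iic X) y)) (Set.Icc E 1) :=
    Integrable.const_mul ((i1 measurableSet_Iic).const_mul _) _
  have i2 : IntegrableOn (fun y => c + one I y) (Set.Icc E 1) :=
    Integrable.add (integrable_const c) (i1 measurableSet_Ioc)
  have i3 : IntegrableOn (fun y => c + one I y + K * ∑ l ∈ J, b l ^ (1 + q) * one (S l) y)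
      (Set.Icc E 1) := Integrable.add i2 iS
  have i4 : IntegrableOn (fun y => c + one I y + K * (∑ l ∈ J, b l ^ (1 + q) * one (S l) y) -
      K * (3 * k * one (Set.Iic X) y)) (Set.Icc E 1) := Integrable.sub i3 iT
  have i5 : IntegrableOn (fun y => c + one I y + K * (∑ l ∈ J, b l ^ (1 + q) * one (S l) y) -
      K * (3 * k * one (Set.Iic X) y) - K * R y) (Set.Icc E 1) :=
    Integrable.sub i4 (Integrable.const_mul iR K)
  have hint : ∫ y in Set.Icc E 1, stepCost k η q X J b y =
      c * (1 - E) + volume.real (I ∩ Set.Icc E 1) +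
        K * (∑ l ∈ J, b l ^ (1 + q) * volume.real (S l ∩ Set.Icc E 1)) -
        K * (3 * k * volume.real (Set.Iic X ∩ Set.Icc E 1)) - K * ∫ y in Set.Icc E 1, R y := by
    rw [setIntegral_congr_fun measurableSet_Icc heq]
    rw [integral_sub i4 (Integrable.const_mul iR K), integral_sub i3 iT, integral_add i2 iS,
      integral_add (integrable_const c) (i1 measurableSet_Ioc), integral_const_mul, integral_const_mul,
      integral_const_mul, integral_const_mul, integral_finsetSum _ fun l _ => (i1 (hS l)).const_mul _]
    simp only [integral_const_mul, one, integral_Icc_indicator (hS _),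
      integral_Icc_indicator measurableSet_Iic, integral_Icc_indicator measurableSet_Ioc, hIdef]
    simp [hE1.le, mul_comm]
    rw [hc]; ring
  have hbound : ∫ y in Set.Icc E 1, stepCost k η q X J b y ≤ c * (1 - E) := by
    have v0 : ∀ S : Set ℝ, volume (S ∩ Set.Icc E 1) ≠ ⊤ := fun S =>
      measure_ne_top_of_subset Set.inter_subset_right (by simp)
    have vS : ∀ l ∈ J, volume.real (S l ∩ Set.Icc E 1) ≤ max 0 (X / b l - E) := by
      intro l hl
      have : S l ∩ Set.Icc E 1 ⊆ Set.Icc E (X / b l) := fun y hy =>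
        ⟨hy.2.1, by rw [le_div_iff₀ (hb l hl).1]; exact hy.1⟩
      refine (measureReal_mono this (by simp)).trans ?_
      rw [Real.volume_real_Icc]
      exact (max_comm _ _).le
    have vI : volume.real (I ∩ Set.Icc E 1) ≤ X * exp η - X * exp (-η) := by
      refine (measureReal_mono Set.inter_subset_left (by simp [hIdef])).trans ?_
      rw [hIdef, Real.volume_real_Ioc]
      refine max_le le_rfl ?_
      have := Real.exp_le_exp.2 (by linarith : -η ≤ η)
      nlinarith
    -- `X = 0` stands for a vertex that the skeleton cannot reach, for which the step changes
    -- nothing.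
    rcases hX.eq_or_lt with rfl | hXp
    · have e1 : volume.real (I ∩ Set.Icc E 1) ≤ 0 := by simpa using vI
      have e2 : ∑ l ∈ J, b l ^ (1 + q) * volume.real (S l ∩ Set.Icc E 1) ≤ 0 := by
        refine Finset.sum_nonpos fun l hl => ?_
        have := vS l hl
        rw [zero_div, max_eq_left (by linarith)] at this
        have h2 : 0 ≤ b l ^ (1 + q) := Real.rpow_nonneg (hb l hl).1.le _
        nlinarith
      have e3 : 0 ≤ ∫ y in Set.Icc E 1, R y := by
        refine setIntegral_nonneg measurableSet_Icc fun y hy => Set.indicator_nonneg (fun z _ => ?_) y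
        rw [zero_div, Real.zero_rpow (by linarith)]
      have e4 : 0 ≤ volume.real (Set.Iic (0 : ℝ) ∩ Set.Icc E 1) := measureReal_nonneg
      have e5 : 0 ≤ K * (3 * k * volume.real (Set.Iic (0 : ℝ) ∩ Set.Icc E 1)) := by positivity
      have e6 := mul_nonneg hK e3
      have e7 := mul_nonneg hK (neg_nonneg.2 e2)
      rw [hint]
      linarith
    · have vI' : X * exp η < E → volume.real (I ∩ Set.Icc E 1) ≤ 0 := by
        intro h
        have : I ∩ Set.Icc E 1 = ∅ := by
          ext y; simp only [hIdef, Set.mem_inter_iff, Set.mem_Ioc, Set.mem_Icc,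
            Set.mem_empty_iff_false, iff_false]
          rintro ⟨⟨_, a⟩, b, _⟩; linarith
        rw [this]; simp
      have key := drift_arith hk hq hE hXp hX1 h0 h1 J hJ b hb vI vI'
      have v3 : max 0 (X - E) ≤ volume.real (Set.Iic X ∩ Set.Icc E 1) := by
        refine max_le measureReal_nonneg ?_
        have : Set.Icc E X ⊆ Set.Iic X ∩ Set.Icc E 1 := fun y hy => ⟨hy.2, hy.1, hy.2.trans hX1⟩
        refine le_trans ?_ (measureReal_mono this (v0 _))
        rw [Real.volume_real_Icc]; exact le_max_left _ _
      have v4 : ∫ y in Set.Icc E 1, R y = X * (2 * k) * ((X / max X E) ^ q - X ^ q) := by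
        rw [integral_rpow_div hE1 hXp hX1 hq0, hq]; simp
      have v5 : ∑ l ∈ J, b l ^ (1 + q) * volume.real (S l ∩ Set.Icc E 1) ≤
          ∑ l ∈ J, b l ^ (1 + q) * max 0 (X / b l - E) :=
        Finset.sum_le_sum fun l hl =>
          mul_le_mul_of_nonneg_left (vS l hl) (Real.rpow_nonneg (hb l hl).1.le _)
      have w1 := mul_le_mul_of_nonneg_left v5 hK
      have w2 : K * (3 * k * max 0 (X - E)) ≤ K * (3 * k * volume.real (Set.Iic X ∩ Set.Icc E 1)) := by
        gcongr
      rw [hint, v4]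
      rw [mul_add] at key
      linarith
  have hnn := stepCost_nonneg (X := X) hk h0 hq0 hX hJ hb
  have iF : IntegrableOn (stepCost k η q X J b) (Set.Icc E 1) :=
    IntegrableOn.congr_fun i5 (fun y hy => (heq y hy).symm) measurableSet_Icc
  rw [lintegral_unif hE1 (f := fun y => ENNReal.ofReal (stepCost k η q X J b y))
    (measurable_stepCost J b).ennreal_ofReal, ← ofReal_integral_eq_lintegral_ofReal iF
    (Filter.Eventually.of_forall hnn), ← ENNReal.ofReal_mul (by simpa using hE1.le)]
  refine ENNReal.ofReal_le_ofReal ?_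
  rw [inv_mul_le_iff₀ (by linarith)]
  linarith

end

end LDD

/-! ### The potential of a vertex and the cost of an edge. -/

namespace LDD

open MeasureTheory Real

variable {n : ℕ} {A : ℕ → ℕ → Prop} {w : ℕ → ℕ → ℝ}

/-- The proximity, on an exponential scale, of `u` to the supernode with label `l`. -/
noncomputable def prox (A : ℕ → ℕ → Prop) (w : ℕ → ℕ → ℝ) (lam : ℝ) (s : ℕ → ℕ) (u l : ℕ) : ℝ :=
  sSup (insert 0 {c | l ≠ 0 ∧ ∃ y r z, WPath (same A s) w u y r ∧ A y z ∧ s z = l ∧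
    c = exp (-(lam * r))})

/-- The potential of a vertex. -/
noncomputable def pot (n : ℕ) (A : ℕ → ℕ → Prop) (w : ℕ → ℕ → ℝ) (lam q : ℝ) (s : ℕ → ℕ) (u : ℕ) : ℝ :=
  ∑ l ∈ Finset.range (n + 1), prox A w lam s u l ^ (1 + q)

/-- An upper bound on the probability that `u` and `v` will be separated. -/
noncomputable def cost (n : ℕ) (A : ℕ → ℕ → Prop) (w : ℕ → ℕ → ℝ) (lam q : ℝ) (k : ℕ) (u v : ℕ)
    (s : ℕ → ℕ) : ℝ :=
  if s u = 0 ∧ s v = 0 then 12 * (lam * w u v) / k * (3 * k - pot n A w lam q s u)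
  else if s u = s v then 0 else 1

section

variable {lam : ℝ} {s : ℕ → ℕ} {u l : ℕ}

/-- Boundedness makes `sSup` a genuine supremum. The inserted `0` is the value for labels out of
reach. The last edge, which enters the supernode, does not count towards the distance. -/
theorem bddAbove_prox (hG : WG n A w) (hlam : 0 < lam) :
    BddAbove (insert 0 {c | l ≠ 0 ∧ ∃ y r z, WPath (same A s) w u y r ∧ A y z ∧ s z = l ∧
    c = exp (-(lam * r))}) := by
  refine ⟨1, ?_⟩
  rintro c (rfl | ⟨-, y, r, z, p, -, -, rfl⟩)
  · exact zero_le_one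
  · rw [Real.exp_le_one_iff]
    have := mul_nonneg hlam.le (p.nonneg (hG.same s))
    linarith

theorem prox_nonneg (hG : WG n A w) (hlam : 0 < lam) : 0 ≤ prox A w lam s u l :=
  le_csSup (bddAbove_prox hG hlam) (Set.mem_insert _ _)

theorem prox_le_one (hG : WG n A w) (hlam : 0 < lam) : prox A w lam s u l ≤ 1 := by
  refine csSup_le (Set.insert_nonempty _ _) ?_
  rintro c (rfl | ⟨-, y, r, z, p, -, -, rfl⟩)
  · exact zero_le_one
  · rw [Real.exp_le_one_iff]
    have := mul_nonneg hlam.le (p.nonneg (hG.same s))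
    linarith

theorem le_prox (hG : WG n A w) (hlam : 0 < lam) (hl : l ≠ 0) {y z : ℕ} {r : ℝ}
    (p : WPath (same A s) w u y r) (a : A y z) (e : s z = l) :
    exp (-(lam * r)) ≤ prox A w lam s u l :=
  le_csSup (bddAbove_prox hG hlam) (.inr ⟨hl, y, r, z, p, a, e, rfl⟩)

theorem exists_of_lt_prox {c : ℝ} (hc : 0 ≤ c) (h : c < prox A w lam s u l) :
    l ≠ 0 ∧ ∃ y r z, WPath (same A s) w u y r ∧ A y z ∧ s z = l ∧ c < exp (-(lam * r)) := by
  obtain ⟨a, ha, hca⟩ := exists_lt_of_lt_csSup (Set.insert_nonempty _ _) h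
  rcases ha with rfl | ⟨hl, y, r, z, p, a, e, rfl⟩
  · exact (hc.not_gt hca).elim
  · exact ⟨hl, y, r, z, p, a, e, hca⟩

theorem adjLabel_of_prox_pos (h : 0 < prox A w lam s u l) : AdjLabel A w s u l := by
  obtain ⟨hl, y, r, z, p, a, e, -⟩ := exists_of_lt_prox le_rfl h
  exact ⟨hl, y, r, z, p, a, e⟩

theorem pot_nonneg (hG : WG n A w) (hlam : 0 < lam) {q : ℝ} : 0 ≤ pot n A w lam q s u :=
  Finset.sum_nonneg fun _ _ => Real.rpow_nonneg (prox_nonneg hG hlam) _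

end

namespace CopInv

variable {D : ℝ} {k t : ℕ} {s : ℕ → ℕ} {N : ℕ → Prop} {lam Y B : ℝ} {T : ℕ → Prop} {P : ℕ → ℕ → ℝ}
  {pr : ℕ → ℕ → ℕ}

/-- Along the walk the distance to the skeleton drops by at most the weight already used, so the
hypothesis passes to every tail, and it forbids capture. This preserves the proximity to an old
label. -/
theorem path_uncap (hG : WG n A w) (hlam : 0 < lam) (hB : Huge n A w B) (hDB : D < B)
    (hP : BF n (same A s) w T B P pr) (hY : exp (-(lam * D)) ≤ Y) {x y : ℕ} {r : ℝ}
    (hs : s x = 0) (hx : P n x < B → exp (-(lam * P n x)) < Y * exp (-(lam * r)))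
    (p : WPath (same A s) w x y r) : WPath (same A (relabel n s (P n) lam Y t)) w x y r := by
  have hG' := hG.same s
  have hB' := hB.mono (A' := same A s) (fun _ _ h => h.1)
  have hY0 : 0 < Y := (exp_pos _).trans_le hY
  have key : ∀ {x y r}, WPath (same A s) w x y r →
      (P n x < B → exp (-(lam * P n x)) < Y * exp (-(lam * r))) → ¬ Cap n s (P n) lam Y x := by
    intro x y r p hx hc
    obtain ⟨_, _, _, h1, _⟩ := cap_path hG hlam hDB hP hY hc
    have h2 := hx (h1.trans_lt hDB)
    have h3 : exp (-(lam * r)) ≤ 1 := by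
      rw [Real.exp_le_one_iff]
      have := mul_nonneg hlam.le (p.nonneg hG')
      linarith
    have := hc.2.2
    nlinarith
  induction p with
  | nil => exact .nil _
  | @cons x z y r a p ih =>
    have hz : P n z < B → exp (-(lam * P n z)) < Y * exp (-(lam * r)) := by
      intro hz
      have hx' := hx ((hP.lt_iff hG' hB' (hG'.lt a).1 (.single a)).2 hz)
      have h1 := hP.le_add hG' hB' (hG'.lt a).2 (.single (hG'.symm a))
      rw [← hG'.w_symm a] at h1
      have e1 : exp (-(lam * (w x z + r))) = exp (-(lam * w x z)) * exp (-(lam * r)) := by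
        rw [← Real.exp_add]; ring_nf
      have e2 : exp (-(lam * P n z)) * exp (-(lam * w x z)) ≤ exp (-(lam * P n x)) := by
        rw [← Real.exp_add]; refine Real.exp_le_exp.2 ?_; nlinarith
      have e3 := exp_pos (-(lam * w x z))
      rw [e1] at hx'
      by_contra hcon
      push Not at hcon
      nlinarith
    refine .cons ⟨a.1, ?_⟩ (ih (a.2.symm.trans hs) hz)
    rw [relabel_not_cap (key (.cons a p) hx), relabel_not_cap (key p hz)]
    exact a.2

/-- Stop just before the first captured vertex. The last vertex `y'` is not captured, so its
distance to the skeleton contributes a factor less than `Y`. For a shortest walk this gives the new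
label proximity at least `X / Y`. -/
theorem path_first_cap (hG : WG n A w) (hlam : 0 < lam) (hB : Huge n A w B)
    (hP : BF n (same A s) w T B P pr) (hY1 : Y ≤ 1) {x y : ℕ} {r : ℝ} (hs : s x = 0) (hy : y < n)
    (hT : T y) (p : WPath (same A s) w x y r) (hx : ¬ Cap n s (P n) lam Y x) :
    ∃ y' r' z, WPath (same A (relabel n s (P n) lam Y t)) w x y' r' ∧ A y' z ∧
      Cap n s (P n) lam Y z ∧ exp (-(lam * r)) ≤ exp (-(lam * r')) * Y := by
  have hG' := hG.same s
  have hB' := hB.mono (A' := same A s) (fun _ _ h => h.1)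
  induction p with
  | nil x => exact (hx ⟨hy, hs, by rw [hP.eq_zero hG' hB' hy hT]; simpa using hY1⟩).elim
  | @cons x z y r a p ih =>
    by_cases hz : Cap n s (P n) lam Y z
    · refine ⟨x, 0, z, .nil _, a.1, hz, ?_⟩
      have q := WPath.symm hG' (.cons a p)
      have h1 := (hP.le_path hG' hB' hy hT q).1
      have h2 : exp (-(lam * P n x)) < Y := by
        by_contra hcon
        exact hx ⟨(hG'.lt a).1, hs, not_lt.1 hcon⟩
      have h3 : exp (-(lam * (w x z + r))) ≤ exp (-(lam * P n x)) :=
        Real.exp_le_exp.2 (by nlinarith)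
      simp only [mul_zero, neg_zero, Real.exp_zero, one_mul]
      exact h3.trans h2.le
    · obtain ⟨y', r', z', p', a', hc, hr⟩ := ih (a.2.symm.trans hs) hy hT hz
      refine ⟨y', w x z + r', z', .cons ⟨a.1, ?_⟩ p', a', hc, ?_⟩
      · rw [relabel_not_cap hx, relabel_not_cap hz]; exact a.2
      · have e : ∀ r, exp (-(lam * (w x z + r))) = exp (-(lam * w x z)) * exp (-(lam * r)) := by
          intro r; rw [← Real.exp_add]; ring_nf
        rw [e, e, mul_assoc]
        exact mul_le_mul_of_nonneg_left hr (exp_pos _).le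

end CopInv

/-- The expected cost does not increase when a new supernode is constructed. -/
theorem cost_step {D : ℝ} {k t : ℕ} {s : ℕ → ℕ} {N : ℕ → Prop} {lam B : ℝ} {T : ℕ → Prop}
    {P : ℕ → ℕ → ℝ} {pr : ℕ → ℕ → ℕ} {E q : ℝ} {u v : ℕ}
    (h : CopInv n A w D k t s N) (hG : WG n A w) (ht : t < n) (hm : NoMinor n A w k)
    (hB : Huge n A w B) (hDB : D < B) (hP : BF n (same A s) w T B P pr)
    (hk : 1 ≤ k) (hlam : 0 < lam) (hlD : lam * D = 3 * k) (hE : E = exp (-(3 * k)))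
    (hq : q = 1 / (2 * k)) (huv : A u v) (hη : lam * w u v ≤ 1) :
    ∫⁻ x, ENNReal.ofReal (cost n A w lam q k u v (relabel n s (P n) lam (unif E x) t)) ≤
      ENNReal.ofReal (cost n A w lam q k u v s) := by
  have hk' : (1 : ℝ) ≤ k := by exact_mod_cast hk
  have hq0 : 0 < q := by rw [hq]; positivity
  have hE0 : 0 < E := by rw [hE]; exact exp_pos _
  have hE1 : E < 1 := by rw [hE, ← Real.exp_zero]; exact Real.exp_lt_exp.2 (by linarith)
  have hEY : ∀ x, exp (-(lam * D)) ≤ unif E x := fun x => by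
    rw [hlD, ← hE]; exact le_unif hE1.le x
  by_cases h00 : s u = 0 ∧ s v = 0
  · have hG' := hG.same s
    have hB' := hB.mono (A' := same A s) (fun _ _ h => h.1)
    have hu := (hG.lt huv).1
    have hv := (hG.lt huv).2
    have huv' : same A s u v := ⟨huv, h00.1.trans h00.2.symm⟩
    set η := lam * w u v with hηdef
    have hη0 : 0 ≤ η := mul_nonneg hlam.le (hG.nonneg huv)
    set b := prox A w lam s u with hb
    set J := (Finset.range (n + 1)).filter (fun l => 0 < b l) with hJ
    have hJk : J.card ≤ k := h.card_adj hm hu h00.1 J fun l hl =>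
      adjLabel_of_prox_pos (Finset.mem_filter.1 hl).2
    have hbJ : ∀ l ∈ J, 0 < b l ∧ b l ≤ 1 := fun l hl =>
      ⟨(Finset.mem_filter.1 hl).2, prox_le_one hG hlam⟩
    -- `X` is the proximity of `u` to the skeleton, with `0` for infinite distance; `u` is captured
    -- exactly when `Y ≤ X`.
    set X := if P n u < B then exp (-(lam * P n u)) else 0 with hX
    have hX0 : 0 ≤ X := by rw [hX]; split_ifs <;> positivity
    have hX1 : X ≤ 1 := by
      rw [hX]; split_ifs
      · rw [Real.exp_le_one_iff]
        have := mul_nonneg hlam.le (hP.nonneg hG' hB.pos le_rfl hu)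
        linarith
      · exact zero_le_one
    have hpot : pot n A w lam q s u = ∑ l ∈ J, b l ^ (1 + q) := by
      rw [pot, hJ, Finset.sum_filter]
      refine Finset.sum_congr rfl fun l _ => ?_
      split_ifs with hl
      · rfl
      · have hl0 : prox A w lam s u l = 0 := le_antisymm (not_lt.1 hl) (prox_nonneg hG hlam)
        rw [hl0, Real.zero_rpow (by linarith)]
    have hcost : cost n A w lam q k u v s = 12 * η / k * (3 * k - ∑ l ∈ J, b l ^ (1 + q)) := by
      rw [cost, if_pos h00, hpot]
    rw [hcost]
    refine le_trans (lintegral_mono fun x => ENNReal.ofReal_le_ofReal ?_)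
      (potential_drift hk hq hE hX0 hX1 hη0 hη J hJk b hbJ)
    set Y := unif E x with hYdef
    have hY := hEY x
    have hY1 : Y ≤ 1 := unif_le hE1.le x
    have hY0 : 0 < Y := (exp_pos _).trans_le hY
    have capB : ∀ {x}, Cap n s (P n) lam Y x → P n x < B := fun hc => by
      obtain ⟨_, _, _, h1, _⟩ := CopInv.cap_path hG hlam hDB hP hY hc
      exact h1.trans_lt hDB
    have hnn := stepCost_nonneg hk hη0 hq0 hX0 hJk hbJ Y
    have hind := indicator_le_stepCost hk hη0 hq0 hX0 hJk hbJ Y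
    have hPB := hP.lt_iff hG' hB' hu (.single huv')
    have hv1 : P n v ≤ P n u + w u v := hP.le_add hG' hB' hu (.single huv')
    have hv2 : P n u ≤ P n v + w u v := by
      have := hP.le_add hG' hB' hv (.single (hG'.symm huv'))
      rwa [← hG'.w_symm huv'] at this
    -- The distances of `u` and `v` differ by at most `w u v`. So a cut forces `Y` to lie between
    -- the proximities of `u` and `v`, hence in the window `X * exp (±η)`.
    have hcut : (P n u < B) → ((Y ≤ X ∧ exp (-(lam * P n v)) < Y) ∨ (X < Y ∧ Y ≤ exp (-(lam * P n v)))) →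
        1 ≤ stepCost k η q X J b Y := by
      intro huB hY'
      refine le_trans (le_of_eq ?_) hind
      rw [Set.indicator_of_mem]
      have e1 : X * exp (-η) ≤ exp (-(lam * P n v)) := by
        rw [hX, if_pos huB, ← Real.exp_add]; exact Real.exp_le_exp.2 (by nlinarith)
      have e2 : exp (-(lam * P n v)) ≤ X * exp η := by
        rw [hX, if_pos huB, ← Real.exp_add]; exact Real.exp_le_exp.2 (by nlinarith)
      have e3 : X * exp (-η) ≤ X := mul_le_of_le_one_right hX0 (by rw [Real.exp_le_one_iff]; linarith)
      have e4 : X ≤ X * exp η := le_mul_of_one_le_right hX0 (Real.one_le_exp hη0)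
      rcases hY' with ⟨a, b⟩ | ⟨a, b⟩
      · exact ⟨by linarith, by linarith⟩
      · exact ⟨by linarith, by linarith⟩
    by_cases cu : Cap n s (P n) lam Y u
    · have huB := capB cu
      have hYX : Y ≤ X := by rw [hX, if_pos huB]; exact cu.2.2
      by_cases cv : Cap n s (P n) lam Y v
      · rw [cost, CopInv.relabel_cap cu, CopInv.relabel_cap cv, if_neg (by omega), if_pos rfl]
        exact hnn
      · rw [cost, CopInv.relabel_cap cu, CopInv.relabel_not_cap cv, h00.2, if_neg (by omega),
          if_neg (by omega)]
        refine hcut huB (.inl ⟨hYX, ?_⟩)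
        by_contra hcon
        exact cv ⟨hv, h00.2, not_lt.1 hcon⟩
    · have hXY : X < Y := by
        rw [hX]; split_ifs
        · by_contra hcon
          exact cu ⟨hu, h00.1, not_lt.1 hcon⟩
        · exact hY0
      by_cases cv : Cap n s (P n) lam Y v
      · rw [cost, CopInv.relabel_not_cap cu, CopInv.relabel_cap cv, h00.1, if_neg (by omega),
          if_neg (by omega)]
        exact hcut (hPB.2 (capB cv)) (.inr ⟨hXY, cv.2.2⟩)
      · have e0 : relabel n s (P n) lam Y t u = 0 := by rw [CopInv.relabel_not_cap cu, h00.1]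
        rw [cost, e0, CopInv.relabel_not_cap cv, h00.2, if_pos ⟨rfl, rfl⟩, stepCost, if_pos hXY]
        refine le_add_of_nonneg_of_le (Set.indicator_nonneg (fun _ _ => zero_le_one) _) ?_
        refine mul_le_mul_of_nonneg_left ?_ (by positivity)
        set b' := prox A w lam (relabel n s (P n) lam Y t) u with hb'
        -- An approximating walk to `l` survives the step if its exponential weight exceeds `X / Y`,
        -- which is no restriction near `b l > X / Y`.
        have hold : ∀ l ∈ J, X < Y * b l → b l ≤ b' l := by
          intro l hl hlX
          refine le_of_forall_lt fun c hc => ?_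
          have hc' : max c (X / Y) < b l := max_lt hc (by rw [div_lt_iff₀ hY0]; linarith)
          obtain ⟨hl0, y, r, z, p, a, e, hlt⟩ :=
            exists_of_lt_prox (le_max_of_le_right (div_nonneg hX0 hY0.le)) hc'
          have hr : X / Y < exp (-(lam * r)) := (le_max_right _ _).trans_lt hlt
          rw [div_lt_iff₀ hY0] at hr
          have p' := CopInv.path_uncap (t := t) hG hlam hB hDB hP hY h00.1 (fun huB => by
            rw [hX, if_pos huB] at hr; linarith) p
          exact ((le_max_left _ _).trans_lt hlt).trans_le (le_prox hG hlam hl0 p' a (by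
            rw [CopInv.relabel_of_ne (by rw [e]; exact hl0), e]))
        have hnew : X / Y ≤ b' (t + 1) := by
          rw [hX]; split_ifs with huB
          · obtain ⟨y, hy, hT, p⟩ := hP.path hG' le_rfl hu huB
            obtain ⟨y', r', z, p', a, hc, hle⟩ := CopInv.path_first_cap (t := t) hG hlam hB hP hY1
              h00.1 hy hT (p.symm hG') cu
            refine le_trans ?_ (le_prox hG hlam (by omega) p' a (CopInv.relabel_cap hc))
            rw [div_le_iff₀ hY0]; exact hle
          · rw [zero_div]; exact prox_nonneg hG hlam
        have htJ : t + 1 ∉ J := by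
          intro hmem
          obtain ⟨-, y, r, z, -, -, e⟩ := adjLabel_of_prox_pos (Finset.mem_filter.1 hmem).2
          have := h.le z
          omega
        have hsum : ∑ l ∈ J, (if X < Y * b l then b l ^ (1 + q) else 0) + (X / Y) ^ (1 + q) ≤
            pot n A w lam q (relabel n s (P n) lam Y t) u := by
          have hsub : insert (t + 1) J ⊆ Finset.range (n + 1) := by
            refine Finset.insert_subset (by simp; omega) (Finset.filter_subset _ _)
          refine le_trans ?_ (Finset.sum_le_sum_of_subset_of_nonneg hsub fun l _ _ =>
            Real.rpow_nonneg (prox_nonneg hG hlam) _)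
          rw [Finset.sum_insert htJ, add_comm]
          refine add_le_add (Real.rpow_le_rpow (div_nonneg hX0 hY0.le) hnew (by linarith))
            (Finset.sum_le_sum fun l hl => ?_)
          split_ifs with hlX
          · exact Real.rpow_le_rpow (hbJ l hl).1.le (hold l hl hlX) (by linarith)
          · exact Real.rpow_nonneg (prox_nonneg hG hlam) _
        linarith
  -- Once an endpoint is assigned, the cost is already decided: it is `1` if only one is, and
  -- otherwise both labels are final.
  · have hle : ∀ x, cost n A w lam q k u v (relabel n s (P n) lam (unif E x) t) ≤
        cost n A w lam q k u v s := by
      intro x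
      by_cases hu : s u = 0
      · have hv : s v ≠ 0 := fun hv => h00 ⟨hu, hv⟩
        have h1 : cost n A w lam q k u v s = 1 := by
          rw [cost, if_neg h00, if_neg (by omega)]
        rw [h1, cost, if_neg (fun h' => hv (by rw [← CopInv.relabel_of_ne hv]; exact h'.2))]
        split_ifs <;> norm_num
      · by_cases hv : s v = 0
        · have h1 : cost n A w lam q k u v s = 1 := by
            rw [cost, if_neg h00, if_neg (by omega)]
          rw [h1, cost, if_neg (fun h' => hu (by rw [← CopInv.relabel_of_ne hu]; exact h'.1))]
          split_ifs <;> norm_num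
        · rw [cost, cost, CopInv.relabel_of_ne hu, CopInv.relabel_of_ne hv, if_neg h00, if_neg h00]
    calc _ ≤ ∫⁻ _ : unitInterval, ENNReal.ofReal (cost n A w lam q k u v s) :=
          lintegral_mono fun x => ENNReal.ofReal_le_ofReal (hle x)
      _ = _ := by simp

end LDD

/-! ### Clustering around centers by scaled distance. -/

namespace LDD

open MeasureTheory Real

/-- `d c x` is the distance from `c` to `x`, or at least `B` if there is no walk. -/
structure APSP (n : ℕ) (A : ℕ → ℕ → Prop) (w : ℕ → ℕ → ℝ) (B : ℝ) (d : ℕ → ℕ → ℝ) : Prop where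
  path : ∀ c < n, ∀ x < n, d c x < B → WPath A w c x (d c x)
  le : ∀ c < n, ∀ x r, WPath A w c x r → d c x ≤ r ∧ d c x < B
  le_B : ∀ c < n, ∀ x < n, d c x ≤ B
  nonneg : ∀ c < n, ∀ x < n, 0 ≤ d c x
  le_add : ∀ c < n, ∀ x < n, ∀ y r, WPath A w x y r → d c y ≤ d c x + r

/-- `c` minimizes the scaled distance `Y c * exp (lam * d c)` among the centers `N`. -/
def Top (n : ℕ) (N : ℕ → Prop) (lam : ℝ) (Y d : ℕ → ℝ) (c : ℕ) : Prop :=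
  c < n ∧ N c ∧ ∀ c' < n, N c' → Y c * exp (lam * d c) ≤ Y c' * exp (lam * d c')

/-- `c` is the only minimizer of the scaled distance. -/
def StrictTop (n : ℕ) (N : ℕ → Prop) (lam : ℝ) (Y d : ℕ → ℝ) (c : ℕ) : Prop :=
  c < n ∧ N c ∧ ∀ c' < n, N c' → c' ≠ c → Y c * exp (lam * d c) < Y c' * exp (lam * d c')

/-- `c` minimizes the scaled distance, but exceeds that of another center by a factor of at most
`g`. -/
def NearTie (n : ℕ) (N : ℕ → Prop) (lam : ℝ) (Y d : ℕ → ℝ) (g : ℝ) (c : ℕ) : Prop :=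
  Top n N lam Y d c ∧ ∃ c' < n, N c' ∧ c' ≠ c ∧ Y c' * exp (lam * d c') ≤ g * (Y c * exp (lam * d c))

section Deterministic

variable {n : ℕ} {A : ℕ → ℕ → Prop} {w : ℕ → ℕ → ℝ} {B D lam : ℝ} {d : ℕ → ℕ → ℝ} {N : ℕ → Prop}
  {Y : ℕ → ℝ}

/-- The values of `Y` differ by a factor of at most `exp (lam * D)`, so the winner is at most `D`
farther away than a center within `2 * D`. -/
theorem Top.le_three {dx : ℕ → ℝ} {c : ℕ} (h : Top n N lam Y dx c) (hlam : 0 < lam)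
    (hY : ∀ c, exp (-(lam * D)) ≤ Y c) (hY1 : ∀ c, Y c ≤ 1) {c₀ : ℕ} (hc₀ : c₀ < n) (hN : N c₀)
    (hd : dx c₀ ≤ 2 * D) : dx c ≤ 3 * D := by
  have h1 := h.2.2 c₀ hc₀ hN
  have h2 : exp (-(lam * D)) * exp (lam * dx c) ≤ 1 * exp (lam * (2 * D)) := by
    calc _ ≤ Y c * exp (lam * dx c) := by gcongr; exact hY c
      _ ≤ Y c₀ * exp (lam * dx c₀) := h1
      _ ≤ 1 * exp (lam * (2 * D)) := by gcongr; exact hY1 _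
  rw [one_mul, ← Real.exp_add, Real.exp_le_exp] at h2
  nlinarith

variable {out : ℕ → ℕ}

/-- `y` lies on a shortest walk from the center of `x` to `x`. By the triangle inequality, a rival
that is at least as good at `y` would be at least as good at `x`, contradicting strictness. -/
theorem out_eq_of_path (hd : APSP n A w B d) (hlam : 0 < lam) (hY0 : ∀ c, 0 < Y c)
    (hout : ∀ x < n, Top n N lam Y (d · x) (out x)) {x y : ℕ} {r : ℝ} (hy : y < n)
    (hu : StrictTop n N lam Y (d · x) (out x)) (p : WPath A w y x r)
    (hr : d (out x) y + r ≤ d (out x) x) : out y = out x := by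
  by_contra hne
  obtain ⟨h1, h2, h3⟩ := hout y hy
  have h4 := hu.2.2 (out y) h1 h2 hne
  have h5 := h3 (out x) hu.1 hu.2.1
  have h6 := hd.le_add (out y) h1 y hy x r p
  have e1 : Y (out y) * exp (lam * d (out y) x) ≤
      Y (out y) * exp (lam * d (out y) y) * exp (lam * r) := by
    rw [mul_assoc, ← Real.exp_add]
    exact mul_le_mul_of_nonneg_left (Real.exp_le_exp.2 (by nlinarith)) (hY0 _).le
  have e2 : Y (out x) * exp (lam * d (out x) y) * exp (lam * r) ≤
      Y (out x) * exp (lam * d (out x) x) := by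
    rw [mul_assoc, ← Real.exp_add]
    exact mul_le_mul_of_nonneg_left (Real.exp_le_exp.2 (by nlinarith)) (hY0 _).le
  have e3 := mul_le_mul_of_nonneg_right h5 (exp_pos (lam * r)).le
  linarith

theorem path_in_cluster (hG : WG n A w) (hd : APSP n A w B d) (hlam : 0 < lam) (hY0 : ∀ c, 0 < Y c)
    (hout : ∀ x < n, Top n N lam Y (d · x) (out x)) {x : ℕ} (hx : x < n)
    (hu : StrictTop n N lam Y (d · x) (out x)) {y : ℕ} {r : ℝ} (p : WPath A w y x r) (hy : y < n)
    (hr : d (out x) y + r ≤ d (out x) x) : WPath (restr A fun z => out z = out x) w y x r := by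
  induction p with
  | nil => exact .nil _
  | @cons y z x r a p ih =>
    have hz := (hG.lt a).2
    have h1 := hd.le_add (out x) hu.1 y hy z _ (.single a)
    refine .cons ⟨a, ?_, ?_⟩ (ih hx hu hz (by linarith))
    · exact out_eq_of_path hd hlam hY0 hout hy hu (.cons a p) hr
    · exact out_eq_of_path hd hlam hY0 hout hz hu p (by linarith)

/-- Without ties, clusters have small strong diameter. -/
theorem cluster_diam (hG : WG n A w) (hd : APSP n A w B d) (hDB : 3 * D < B) (hlam : 0 < lam)
    (hY : ∀ c, exp (-(lam * D)) ≤ Y c) (hY1 : ∀ c, Y c ≤ 1)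
    (hcov : ∀ x < n, ∃ c < n, N c ∧ d c x ≤ 2 * D)
    (hout : ∀ x < n, StrictTop n N lam Y (d · x) (out x)) {x y : ℕ} (hx : x < n) (hy : y < n)
    (hxy : out x = out y) : ∃ r ≤ 6 * D, WPath (restr A fun z => out z = out x) w x y r := by
  have hout' : ∀ x < n, Top n N lam Y (d · x) (out x) := fun x hx =>
    ⟨(hout x hx).1, (hout x hx).2.1, fun c hc hN => by
      by_cases h : c = out x
      · rw [h]
      · exact ((hout x hx).2.2 c hc hN h).le⟩
  have hY0 : ∀ c, 0 < Y c := fun c => (exp_pos _).trans_le (hY c)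
  have key : ∀ x < n, ∃ r ≤ 3 * D, WPath (restr A fun z => out z = out x) w (out x) x r := by
    intro x hx
    obtain ⟨c₀, h1, h2, h3⟩ := hcov x hx
    have h4 := (hout' x hx).le_three hlam hY hY1 h1 h2 h3
    have hc := (hout x hx).1
    refine ⟨_, h4, path_in_cluster hG hd hlam hY0 hout' hx (hout x hx)
      (hd.path _ hc x hx (by linarith)) hc ?_⟩
    have := (hd.le _ hc _ _ (.nil (out x))).1
    linarith
  obtain ⟨r, hr, p⟩ := key x hx
  obtain ⟨r', hr', p'⟩ := key y hy
  rw [← hxy] at p'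
  exact ⟨r + r', by linarith, (p.symm (hG.restr _)).trans p'⟩

/-- If the endpoints of an edge lie in different clusters, then there is nearly a tie. -/
theorem nearTie_of_cut (hG : WG n A w) (hd : APSP n A w B d) (hlam : 0 < lam) (hY0 : ∀ c, 0 < Y c)
    (hout : ∀ x < n, Top n N lam Y (d · x) (out x)) {u v : ℕ} (a : A u v) (h : out u ≠ out v) :
    ∃ c, NearTie n N lam Y (d · u) (exp (2 * (lam * w u v))) c := by
  obtain ⟨hu, hv⟩ := hG.lt a
  refine ⟨out u, hout u hu, out v, (hout v hv).1, (hout v hv).2.1, h.symm, ?_⟩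
  have h1 := hd.le_add (out v) (hout v hv).1 v hv u _ (.single (hG.symm a))
  rw [← hG.w_symm a] at h1
  have h2 := hd.le_add (out u) (hout u hu).1 u hu v _ (.single a)
  have h3 := (hout v hv).2.2 (out u) (hout u hu).1 (hout u hu).2.1
  have h4 := (hout u hu).2.2 (out v) (hout v hv).1 (hout v hv).2.1
  -- The edge is crossed twice: once with the center of `v`, once with that of `u`. Hence the factor
  -- `2` in the exponent.
  have e1 : Y (out v) * exp (lam * d (out v) u) ≤
      Y (out v) * exp (lam * d (out v) v) * exp (lam * w u v) := by
    rw [mul_assoc, ← Real.exp_add]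
    exact mul_le_mul_of_nonneg_left (Real.exp_le_exp.2 (by nlinarith)) (hY0 _).le
  have e2 : Y (out u) * exp (lam * d (out u) v) ≤
      Y (out u) * exp (lam * d (out u) u) * exp (lam * w u v) := by
    rw [mul_assoc, ← Real.exp_add]
    exact mul_le_mul_of_nonneg_left (Real.exp_le_exp.2 (by nlinarith)) (hY0 _).le
  have e3 : exp (2 * (lam * w u v)) = exp (lam * w u v) * exp (lam * w u v) := by
    rw [← Real.exp_add]; ring_nf
  rw [e3]
  have hp := exp_pos (lam * w u v)
  calc _ ≤ _ := e1
    _ ≤ Y (out u) * exp (lam * d (out u) v) * exp (lam * w u v) := by gcongr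
    _ ≤ Y (out u) * exp (lam * d (out u) u) * exp (lam * w u v) * exp (lam * w u v) := by gcongr
    _ = _ := by ring

end Deterministic

section Random

open RealRAM

variable {n : ℕ} {N : ℕ → Prop} {D lam : ℝ} {d : ℕ → ℝ} {τ : ℕ}

-- All variables but that of `c` are fixed. The best rival sets a threshold `t`: `c` wins strictly
-- if its variable is below `t`, and a near tie puts it in a short window ending at `t`. The
-- truncation term `E / (1 - E) = 1 / τ` is charged only to centers within `3 * D`, as no others can
-- win.
open Classical in
theorem volume_nearTie (hτ : 1 ≤ τ) (hlam : 0 < lam) (hlD : lam * D = log (τ + 1))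
    (hcov : ∃ c < n, N c ∧ d c ≤ 2 * D) (y : ℕ → unitInterval) {g : ℝ} (hg : 0 ≤ g) (c : ℕ) :
    volume {x | NearTie n N lam (fun i => unif (1 / (τ + 1)) (Function.update y c x i)) d (exp g) c} ≤
      ENNReal.ofReal g * (volume {x | StrictTop n N lam
        (fun i => unif (1 / (τ + 1)) (Function.update y c x i)) d c} +
        if c < n ∧ N c ∧ d c ≤ 3 * D then ENNReal.ofReal (1 / τ) else 0) := by
  have hτ' : (1 : ℝ) ≤ τ := by exact_mod_cast hτ
  set E : ℝ := 1 / (τ + 1) with hE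
  have hE0 : 0 < E := by positivity
  have hE1 : E < 1 := by rw [hE, div_lt_one] <;> linarith
  have hEe : exp (-(lam * D)) = E := by
    rw [hlD, Real.exp_neg, Real.exp_log (by positivity), hE, one_div]
  have hEt : E / (1 - E) = 1 / τ := by
    have h0 : (τ : ℝ) ≠ 0 := by linarith
    rw [hE]; field_simp; ring_nf; exact mul_inv_cancel₀ h0
  by_cases hrel : c < n ∧ N c ∧ d c ≤ 3 * D
  swap
  · have : {x | NearTie n N lam (fun i => unif E (Function.update y c x i)) d (exp g) c} = ∅ := by
      refine Set.eq_empty_of_forall_notMem ?_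
      intro x (hx : NearTie n N lam _ d (exp g) c)
      obtain ⟨c₀, h1, h2, h3⟩ := hcov
      exact hrel ⟨hx.1.1, hx.1.2.1, hx.1.le_three hlam (fun c => by rw [hEe]; exact le_unif hE1.le _)
        (fun c => unif_le hE1.le _) h1 h2 h3⟩
    rw [this]; simp
  rw [if_pos hrel]
  set F := (Finset.range n).filter (fun c' => N c' ∧ c' ≠ c) with hF
  have hFm : ∀ c', c' ∈ F ↔ c' < n ∧ N c' ∧ c' ≠ c := fun c' => by simp [hF]
  let val : ℕ → ℝ := fun c' => unif E (y c') * exp (lam * d c')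
  rcases F.eq_empty_or_nonempty with hFe | hFn
  · have : {x | NearTie n N lam (fun i => unif E (Function.update y c x i)) d (exp g) c} = ∅ := by
      refine Set.eq_empty_of_forall_notMem ?_
      intro x hx
      obtain ⟨c', h1, h2, h3, -⟩ := hx.2
      have := (hFm c').2 ⟨h1, h2, h3⟩
      rw [hFe] at this; simp at this
    rw [this]; simp
  · obtain ⟨c₁, hc₁, hmin⟩ := F.exists_min_image val hFn
    set t := val c₁ * exp (-(lam * d c)) with ht
    have ht' : t * exp (lam * d c) = val c₁ := by
      rw [ht, mul_assoc, ← Real.exp_add]; simp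
    have hp := exp_pos (lam * d c)
    have hother : ∀ (x : unitInterval) c', c' ≠ c → unif E (Function.update y c x c') = unif E (y c') :=
      fun x c' h => by rw [Function.update_of_ne h]
    have sub1 : {x | NearTie n N lam (fun i => unif E (Function.update y c x i)) d (exp g) c} ⊆
        {x | unif E x ∈ Set.Icc (t * exp (-g)) t} := by
      intro x (hx : NearTie n N lam _ d (exp g) c)
      obtain ⟨h1, c', h2, h3, h4, h5⟩ := hx
      have h6 := h1.2.2 c₁ ((hFm _).1 hc₁).1 ((hFm _).1 hc₁).2.1
      have h7 := hmin c' ((hFm _).2 ⟨h2, h3, h4⟩)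
      simp only [Function.update_self, hother x c' h4, hother x c₁ ((hFm _).1 hc₁).2.2] at h5 h6
      change val c' ≤ _ at h5
      change _ ≤ val c₁ at h6
      rw [← ht'] at h6 h7
      refine ⟨?_, le_of_mul_le_mul_right h6 hp⟩
      rw [Real.exp_neg, mul_inv_le_iff₀ (exp_pos g)]
      refine le_of_mul_le_mul_right ?_ hp
      calc _ ≤ val c' := h7
        _ ≤ _ := h5
        _ = _ := by ring
    have sub2 : {x | unif E x < t} ⊆
        {x | StrictTop n N lam (fun i => unif E (Function.update y c x i)) d c} := by
      intro x (hx : unif E x < t)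
      refine ⟨hrel.1, hrel.2.1, fun c' h2 h3 h4 => ?_⟩
      have h7 := hmin c' ((hFm _).2 ⟨h2, h3, h4⟩)
      simp only [Function.update_self, hother x c' h4]
      calc _ < t * exp (lam * d c) := by gcongr
        _ = val c₁ := ht'
        _ ≤ _ := h7
    have h1 := volume_unif_window (t := t) hE0 hE1 (exp_pos (-g)).le
      (by rw [Real.exp_le_one_iff]; linarith)
    rw [hEt] at h1
    calc _ ≤ _ := measure_mono sub1
      _ ≤ _ := h1
      _ ≤ _ := by
        gcongr
        have := Real.add_one_le_exp (-g)
        linarith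

open Classical in
/-- The probability of a near tie, when the random numbers from index `m` on are used for the
centers, and the centers and distances depend on earlier random numbers only. -/
theorem coins_nearTie {n m τm : ℕ} {D a : ℝ} (hD : 0 < D) (ha : 0 ≤ a)
    {N : (ℕ → unitInterval) → ℕ → Prop} {d : (ℕ → unitInterval) → ℕ → ℝ}
    {τ : (ℕ → unitInterval) → ℕ} (mN : ∀ c, MeasurableSet {ω | N ω c})
    (md : ∀ c, Measurable fun ω => d ω c) (mτ : Measurable τ)
    (iN : ∀ ω i x, m ≤ i → N (Function.update ω i x) = N ω)
    (id : ∀ ω i x, m ≤ i → d (Function.update ω i x) = d ω)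
    (iτ : ∀ ω i x, m ≤ i → τ (Function.update ω i x) = τ ω)
    (hτ1 : ∀ ω, 1 ≤ τ ω) (hτm : ∀ ω, τ ω ≤ τm)
    (hcard : ∀ ω, ((Finset.range n).filter fun c => N ω c ∧ d ω c ≤ 3 * D).card ≤ τ ω)
    (hcov : ∀ ω, ∃ c < n, N ω c ∧ d ω c ≤ 2 * D) :
    coins {ω | ∃ c, NearTie n (N ω) (log (τ ω + 1) / D)
      (fun i => unif (1 / (τ ω + 1)) (ω (m + i))) (d ω) (exp (2 * (log (τ ω + 1) / D * a))) c} ≤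
      ENNReal.ofReal (4 * (log (τm + 1) / D * a)) := by
  set lam : (ℕ → unitInterval) → ℝ := fun ω => log (τ ω + 1) / D with hlam
  set Y : (ℕ → unitInterval) → ℕ → ℝ := fun ω i => unif (1 / (τ ω + 1)) (ω (m + i)) with hY
  set g : ℝ := 2 * (log (τm + 1) / D * a) with hg
  have hτr : ∀ ω, (1 : ℝ) ≤ τ ω := fun ω => by exact_mod_cast hτ1 ω
  have hlam0 : ∀ ω, 0 < lam ω := fun ω => div_pos (Real.log_pos (by linarith [hτr ω])) hD
  have hlamle : ∀ ω, 2 * (lam ω * a) ≤ g := fun ω => by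
    have h2 : (τ ω : ℝ) ≤ τm := by exact_mod_cast hτm ω
    have : lam ω ≤ log (τm + 1) / D := by
      simp only [hlam]
      gcongr
    rw [hg]; gcongr
  have mτ' : Measurable fun ω => (τ ω : ℝ) := measurable_from_top.comp mτ
  have mlam : Measurable lam := (Real.measurable_log.comp (mτ'.add_const 1)).div_const D
  have mY : ∀ i, Measurable fun ω => Y ω i := fun i => by
    have h1 : Measurable fun ω : ℕ → unitInterval => ((ω (m + i) : unitInterval) : ℝ) :=
      measurable_subtype_coe.comp (measurable_pi_apply _)
    have h2 : Measurable fun ω => (1 : ℝ) / (τ ω + 1) := measurable_const.div (mτ'.add_const 1)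
    exact h2.add ((measurable_const.sub h2).mul h1)
  have mval : ∀ c, Measurable fun ω => Y ω c * exp (lam ω * d ω c) := fun c =>
    (mY c).mul (Real.measurable_exp.comp (mlam.mul (md c)))
  have mTop : ∀ c, MeasurableSet {ω | Top n (N ω) (lam ω) (Y ω) (d ω) c} := by
    intro c
    refine (MeasurableSet.const _).inter ((mN c).inter ?_)
    refine MeasurableSet.congr (s := ⋂ c', ⋂ (_ : c' < n), {ω | N ω c'}ᶜ ∪
      {ω | Y ω c * exp (lam ω * d ω c) ≤ Y ω c' * exp (lam ω * d ω c')}) ?_ ?_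
    · exact MeasurableSet.iInter fun c' => MeasurableSet.iInter fun _ =>
        (mN c').compl.union (measurableSet_le (mval c) (mval c'))
    · ext ω; simp [imp_iff_not_or]; rfl
  have mStrict : ∀ c, MeasurableSet {ω | StrictTop n (N ω) (lam ω) (Y ω) (d ω) c} := by
    intro c
    refine (MeasurableSet.const _).inter ((mN c).inter ?_)
    refine MeasurableSet.congr (s := ⋂ c', ⋂ (_ : c' < n), {ω | N ω c'}ᶜ ∪ ({_ω | c' ≠ c}ᶜ ∪
      {ω | Y ω c * exp (lam ω * d ω c) < Y ω c' * exp (lam ω * d ω c')})) ?_ ?_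
    · exact MeasurableSet.iInter fun c' => MeasurableSet.iInter fun _ =>
        (mN c').compl.union ((MeasurableSet.const _).compl.union (measurableSet_lt (mval c) (mval c')))
    · ext ω; simp [imp_iff_not_or]; rfl
  have mTie : ∀ c, MeasurableSet
      {ω | NearTie n (N ω) (lam ω) (Y ω) (d ω) (exp (2 * (lam ω * a))) c} := by
    intro c
    refine (mTop c).inter ?_
    refine MeasurableSet.congr (s := ⋃ c', ⋃ (_ : c' < n ∧ c' ≠ c), {ω | N ω c'} ∩
      {ω | Y ω c' * exp (lam ω * d ω c') ≤ exp (2 * (lam ω * a)) * (Y ω c * exp (lam ω * d ω c))}) ?_ ?_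
    · refine MeasurableSet.iUnion fun c' => MeasurableSet.iUnion fun _ =>
        (mN c').inter (measurableSet_le (mval c') (Measurable.mul ?_ (mval c)))
      exact Real.measurable_exp.comp (measurable_const.mul (mlam.mul_const a))
    · ext ω; simp [and_assoc, and_left_comm]; rfl
  let rel : ℕ → (ℕ → unitInterval) → ℝ≥0∞ := fun c ω =>
    if c < n ∧ N ω c ∧ d ω c ≤ 3 * D then ENNReal.ofReal (1 / τ ω) else 0
  have mrel : ∀ c, Measurable (rel c) := fun c =>
    Measurable.ite ((MeasurableSet.const _).inter ((mN c).inter (measurableSet_le (md c) measurable_const)))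
      (measurable_const.div mτ').ennreal_ofReal measurable_const
  have hupd : ∀ ω c x, (fun i => unif (1 / (τ ω + 1)) (Function.update ω (m + c) x (m + i))) =
      fun i => unif (1 / (τ ω + 1)) (Function.update (fun i => ω (m + i)) c x i) := by
    intro ω c x
    funext i
    congr 1
    by_cases h : i = c
    · subst h; simp
    · rw [Function.update_of_ne h, Function.update_of_ne (by omega)]
  -- Fubini: integrate over the coin of `c` first. The centers, distances and `τ` do not see that
  -- coin.
  have hone : ∀ c, coins {ω | NearTie n (N ω) (lam ω) (Y ω) (d ω) (exp (2 * (lam ω * a))) c} ≤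
      ENNReal.ofReal g * (coins {ω | StrictTop n (N ω) (lam ω) (Y ω) (d ω) c} +
        ∫⁻ ω, rel c ω ∂coins) := by
    intro c
    rw [← lintegral_indicator_one (mTie c), ← lintegral_indicator_one (mStrict c),
      lintegral_resample (m + c) (measurable_one.indicator (mTie c)),
      lintegral_resample (m + c) (measurable_one.indicator (mStrict c)),
      ← lintegral_add_right _ (mrel c), ← lintegral_const_mul' _ _ ENNReal.ofReal_ne_top]
    refine lintegral_mono fun ω => ?_
    have e1 := fun x => iN ω (m + c) x (by omega)
    have e2 := fun x => id ω (m + c) x (by omega)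
    have e3 := fun x => iτ ω (m + c) x (by omega)
    have f1 : ∀ x : unitInterval, Set.indicator
        {ω | NearTie n (N ω) (lam ω) (Y ω) (d ω) (exp (2 * (lam ω * a))) c} 1
        (Function.update ω (m + c) x) = Set.indicator {x | NearTie n (N ω) (lam ω)
        (fun i => unif (1 / (τ ω + 1)) (Function.update (fun i => ω (m + i)) c x i)) (d ω)
        (exp (2 * (lam ω * a))) c} (1 : unitInterval → ℝ≥0∞) x := by
      intro x
      simp only [Set.indicator_apply, Set.mem_ofPred_eq, hlam, hY, e1, e2, e3, hupd, Pi.one_apply]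
    have f2 : ∀ x : unitInterval, Set.indicator
        {ω | StrictTop n (N ω) (lam ω) (Y ω) (d ω) c} 1
        (Function.update ω (m + c) x) = Set.indicator {x | StrictTop n (N ω) (lam ω)
        (fun i => unif (1 / (τ ω + 1)) (Function.update (fun i => ω (m + i)) c x i)) (d ω)
        c} (1 : unitInterval → ℝ≥0∞) x := by
      intro x
      simp only [Set.indicator_apply, Set.mem_ofPred_eq, hlam, hY, e1, e2, e3, hupd, Pi.one_apply]
    have mupd : Measurable fun x : unitInterval => Function.update ω (m + c) x :=
      (measurable_resample (m + c)).comp measurable_prodMk_left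
    have m1 : MeasurableSet {x : unitInterval | NearTie n (N ω) (lam ω)
        (fun i => unif (1 / (τ ω + 1)) (Function.update (fun i => ω (m + i)) c x i)) (d ω)
        (exp (2 * (lam ω * a))) c} := by
      have := mupd (mTie c)
      simpa only [Set.preimage_ofPred_eq, hlam, hY, e1, e2, e3, hupd] using this
    have m2 : MeasurableSet {x : unitInterval | StrictTop n (N ω) (lam ω)
        (fun i => unif (1 / (τ ω + 1)) (Function.update (fun i => ω (m + i)) c x i)) (d ω) c} := by
      have := mupd (mStrict c)
      simpa only [Set.preimage_ofPred_eq, hlam, hY, e1, e2, e3, hupd] using this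
    simp_rw [f1, f2]
    rw [lintegral_indicator_one m1, lintegral_indicator_one m2]
    have hv := volume_nearTie (n := n) (N := N ω) (D := D) (lam := lam ω) (d := d ω) (hτ1 ω) (hlam0 ω)
      (by simp only [hlam]; field_simp) (hcov ω) (fun i => ω (m + i)) (g := 2 * (lam ω * a))
      (by have := (hlam0 ω).le; positivity) c
    refine hv.trans ?_
    gcongr
    exact hlamle ω
  calc _ ≤ coins (⋃ c ∈ Finset.range n,
        {ω | NearTie n (N ω) (lam ω) (Y ω) (d ω) (exp (2 * (lam ω * a))) c}) := by
        refine measure_mono ?_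
        rintro ω ⟨c, hc⟩
        simp only [Set.mem_iUnion, Finset.mem_range]
        exact ⟨c, hc.1.1, hc⟩
    _ ≤ ∑ c ∈ Finset.range n, coins
        {ω | NearTie n (N ω) (lam ω) (Y ω) (d ω) (exp (2 * (lam ω * a))) c} :=
        measure_biUnion_finset_le _ _
    _ ≤ ∑ c ∈ Finset.range n, ENNReal.ofReal g *
        (coins {ω | StrictTop n (N ω) (lam ω) (Y ω) (d ω) c} + ∫⁻ ω, rel c ω ∂coins) :=
        Finset.sum_le_sum fun c _ => hone c
    _ = ENNReal.ofReal g * (∑ c ∈ Finset.range n,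
        coins {ω | StrictTop n (N ω) (lam ω) (Y ω) (d ω) c} +
          ∑ c ∈ Finset.range n, ∫⁻ ω, rel c ω ∂coins) := by
        rw [← Finset.mul_sum, Finset.sum_add_distrib]
    _ ≤ ENNReal.ofReal g * (1 + 1) := by
        -- One unit comes from the disjointness of the events of strict victory, the other from at
        -- most `τ` near centers with weight `1 / τ` each.
        gcongr
        · rw [← measure_biUnion_finset _ fun c _ => mStrict c]
          · exact prob_le_one
          · intro c hc c' hc' hne
            refine Set.disjoint_left.2 fun ω (h1 : StrictTop n _ _ _ _ c)
              (h2 : StrictTop n _ _ _ _ c') => ?_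
            have := h1.2.2 c' h2.1 h2.2.1 hne.symm
            have := h2.2.2 c h1.1 h1.2.1 hne
            linarith
        · rw [← lintegral_finsetSum _ fun c _ => mrel c]
          refine le_trans (lintegral_mono (g := fun _ => 1) fun ω => ?_) (by simp)
          have h1 : ∑ c ∈ Finset.range n, rel c ω =
              ((Finset.range n).filter fun c => N ω c ∧ d ω c ≤ 3 * D).card • ENNReal.ofReal (1 / τ ω) := by
            rw [← Finset.sum_const, Finset.sum_filter]
            refine Finset.sum_congr rfl fun c hc => ?_
            simp only [rel, Finset.mem_range.1 hc, true_and]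
          change ∑ c ∈ Finset.range n, rel c ω ≤ 1
          rw [h1, nsmul_eq_mul]
          calc _ ≤ ((τ ω : ℕ) : ℝ≥0∞) * ENNReal.ofReal (1 / τ ω) := by
                gcongr; exact hcard ω
            _ = 1 := by
                rw [← ENNReal.ofReal_natCast, ← ENNReal.ofReal_mul (by positivity),
                  mul_one_div_cancel (by linarith [hτr ω]), ENNReal.ofReal_one]
    _ = _ := by
        rw [one_add_one_eq_two, mul_comm, ← ENNReal.ofReal_ofNat 2, ← ENNReal.ofReal_mul (by norm_num)]
        congr 1; rw [hg]; ring

end Random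

end LDD

/-! ### Bellman–Ford as a loop program. -/

namespace RealRAM

namespace Code

/-- The natural variable `a`. -/
abbrev nv (a : ℕ) : NExpr := .get a (.const 0) (.const 0)

/-- The real variable `a`. -/
abbrev rv (a : ℕ) : RExpr := .get a (.const 0) (.const 0)

/-- Equality of natural numbers. -/
def natEq (x y : NExpr) : BExpr := .and (.nle x y) (.nle y x)

/-- Strict inequality of real numbers. -/
def rlt (x y : RExpr) : BExpr := .not (.rle y x)

@[simp] theorem natEq_eval (x y : NExpr) (σ : State) :
    (natEq x y).eval σ ↔ x.eval σ = y.eval σ := by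
  simp only [natEq, BExpr.eval]; omega

@[simp] theorem rlt_eval (x y : RExpr) (σ : State) :
    (rlt x y).eval σ ↔ x.eval σ < y.eval σ := by
  simp only [rlt, BExpr.eval, not_le]

attribute [simp] NExpr.eval RExpr.eval BExpr.eval

/-- Adjacency within label classes. -/
abbrev link (a s : ℕ → ℕ → ℕ) : ℕ → ℕ → Prop := LDD.same (fun x y => a x y = 1) fun x => s x 0

/-- Relax the edge from vertex `22` to vertex `21` in round `23`. -/
def relaxEdge : Code :=
  .cond (.and (natEq (.get 1 (nv 22) (nv 21)) (.const 1))
      (.and (natEq (.get 3 (nv 22) (.const 0)) (.get 3 (nv 21) (.const 0)))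
        (rlt (.add (.get 4 (nv 23) (nv 22)) (.get 1 (nv 22) (nv 21)))
          (.get 4 (.add (nv 23) (.const 1)) (nv 21)))))
    (.seq (.rset 4 (.add (nv 23) (.const 1)) (nv 21)
        (.add (.get 4 (nv 23) (nv 22)) (.get 1 (nv 22) (nv 21))))
      (.nset 6 (.add (nv 23) (.const 1)) (nv 21) (nv 22)))
    .skip

/-- Relax the edges to vertex `21` in round `23`. -/
def relaxAll : Code := .rep 22 relaxEdge

/-- Compute the entry for vertex `21` in round `23`. -/
def bfEntry : Code :=
  .seq (.rset 4 (.add (nv 23) (.const 1)) (nv 21) (.get 4 (nv 23) (nv 21)))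
    (.seq (.nset 6 (.add (nv 23) (.const 1)) (nv 21) (nv 21)) relaxAll)

/-- Initialize the entry for vertex `21`. -/
def bfInit : Code :=
  .cond (natEq (.get 5 (nv 21) (.const 0)) (.const 1))
    (.rset 4 (.const 0) (nv 21) (.ofNat (.const 0))) (.rset 4 (.const 0) (nv 21) (rv 2))

/-- The algorithm of Bellman and Ford. -/
def bellmanFord : Code := .seq (.rep 21 bfInit) (.rep 23 (.rep 21 bfEntry))

/-- The entry for `y` of a round of the algorithm of Bellman and Ford is correct. -/
def RowOK (n : ℕ) (A : ℕ → ℕ → Prop) (w : ℕ → ℕ → ℝ) (p q : ℕ → ℝ) (pr : ℕ → ℕ) (y : ℕ) : Prop :=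
  q y ≤ p y ∧ (∀ x < n, A x y → q y ≤ p x + w x y) ∧
    ((pr y = y ∧ q y = p y) ∨ (A (pr y) y ∧ q y = p (pr y) + w (pr y) y))

variable {ω : ℕ → unitInterval} {n : ℕ} {a s : ℕ → ℕ → ℕ} {w : ℕ → ℕ → ℝ} {B : ℝ}

/-- Round `t + 1` writes only to row `t + 1`, so the values of row `t` stay available. Conventions
for all programs: natural arrays `3` to `6` hold the labels, the net points or centers, the marks of
sources and skeleton, and the predecessors; `7` to `10` are scalars, and the counters start at `20`.
Real arrays `2` and `3` hold `B` and `D`, `4` the Bellman–Ford table, `5` the distance matrix, `6`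
the coin of a supernode and `8` those of the centers; `7` and `11` are scalars. -/
theorem relaxAll_spec {σ : State} {t y : ℕ} (hn : σ.nat 0 0 0 = n) (ha : σ.nat 1 = a)
    (hs : σ.nat 3 = s) (hw : σ.real 1 = w) (ht : σ.nat 23 0 0 = t) (hy : σ.nat 21 0 0 = y)
    (h1 : σ.real 4 (t + 1) y = σ.real 4 t y) (h2 : σ.nat 6 (t + 1) y = y) :
    (∀ i j, ¬ (i = t + 1 ∧ j = y) → (den ω relaxAll σ).real 4 i j = σ.real 4 i j) ∧
    (∀ i j, ¬ (i = t + 1 ∧ j = y) → (den ω relaxAll σ).nat 6 i j = σ.nat 6 i j) ∧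
    RowOK n (link a s) w (σ.real 4 t) ((den ω relaxAll σ).real 4 (t + 1))
      ((den ω relaxAll σ).nat 6 (t + 1)) y := by
  obtain ⟨τ, hI, e⟩ := rep_rule (ω := ω) 22 relaxEdge σ n hn
    (fun k τ => (∀ i j, ¬ (i = t + 1 ∧ j = y) → τ.real 4 i j = σ.real 4 i j) ∧
      (∀ i j, ¬ (i = t + 1 ∧ j = y) → τ.nat 6 i j = σ.nat 6 i j) ∧
      τ.real 4 (t + 1) y ≤ σ.real 4 t y ∧
      (∀ x < k, link a s x y → τ.real 4 (t + 1) y ≤ σ.real 4 t x + w x y) ∧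
      ((τ.nat 6 (t + 1) y = y ∧ τ.real 4 (t + 1) y = σ.real 4 t y) ∨
        (link a s (τ.nat 6 (t + 1) y) y ∧ τ.real 4 (t + 1) y =
          σ.real 4 t (τ.nat 6 (t + 1) y) + w (τ.nat 6 (t + 1) y) y)))
    ⟨fun _ _ _ => rfl, fun _ _ _ => rfl, h1.le, fun _ h => absurd h (by simp), .inl ⟨h2, h1⟩⟩
    (fun k hk τ fn fr ⟨i1, i2, i3, i4, i5⟩ => by
      have e1 : τ.nat 1 = a := (fn 1 (by decide) (by decide)).trans ha
      have e3 : τ.nat 3 = s := (fn 3 (by decide) (by decide)).trans hs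
      have e4 : τ.real 1 = w := (fr 1 (by decide)).trans hw
      have e5 : τ.nat 23 0 0 = t := by rw [fn 23 (by decide) (by decide), ht]
      have e6 : τ.nat 21 0 0 = y := by rw [fn 21 (by decide) (by decide), hy]
      have e7 : τ.real 4 t k = σ.real 4 t k := i1 _ _ (by omega)
      simp only [relaxEdge, den]
      split_ifs with hb
      · simp [e1, e3, e4, e5, e6, e7] at hb
        obtain ⟨b1, b2, b3⟩ := hb
        simp only [State.setN_nat, State.setR_real, State.setN_real, State.setR_nat]
        simp [e4, e5, e6, e7]
        refine ⟨?_, ?_, ?_, ?_, ?_⟩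
        · intro i j hij; rw [if_neg (by tauto)]; exact i1 i j (by tauto)
        · intro i j hij; rw [if_neg (by tauto)]; exact i2 i j (by tauto)
        · linarith
        · intro x hx hl
          rcases Nat.lt_or_eq_of_le hx with h | rfl
          · have := i4 x h hl; linarith
          · exact le_rfl
        · exact .inr ⟨b1, b2⟩
      · simp [e1, e3, e4, e5, e6, e7] at hb
        simp only [State.setN_real, State.setN_nat]
        simp
        refine ⟨fun i j h => i1 i j (by tauto), fun i j h => i2 i j (by tauto), i3, ?_, i5⟩
        intro x hx hl
        rcases Nat.lt_or_eq_of_le hx with h | rfl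
        · exact i4 x h hl
        · exact hb hl.1 hl.2)
  rw [relaxAll, e]
  obtain ⟨i1, i2, i3, i4, i5⟩ := hI
  refine ⟨?_, ?_, ?_⟩
  · simpa using i1
  · simpa using i2
  · unfold RowOK
    simpa using ⟨i3, i4, i5⟩

theorem bfEntry_spec {σ : State} {t y : ℕ} (hn : σ.nat 0 0 0 = n) (ha : σ.nat 1 = a)
    (hs : σ.nat 3 = s) (hw : σ.real 1 = w) (ht : σ.nat 23 0 0 = t) (hy : σ.nat 21 0 0 = y) :
    (∀ i j, ¬ (i = t + 1 ∧ j = y) → (den ω bfEntry σ).real 4 i j = σ.real 4 i j) ∧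
    (∀ i j, ¬ (i = t + 1 ∧ j = y) → (den ω bfEntry σ).nat 6 i j = σ.nat 6 i j) ∧
    RowOK n (link a s) w (σ.real 4 t) ((den ω bfEntry σ).real 4 (t + 1))
      ((den ω bfEntry σ).nat 6 (t + 1)) y := by
  subst ht hy
  obtain ⟨h1, h2, h3⟩ := relaxAll_spec (ω := ω) (n := n) (a := a) (s := s) (w := w)
    (σ := (σ.setR 4 (σ.nat 23 0 0 + 1) (σ.nat 21 0 0) (σ.real 4 (σ.nat 23 0 0) (σ.nat 21 0 0))).setN
      6 (σ.nat 23 0 0 + 1) (σ.nat 21 0 0) (σ.nat 21 0 0)) (t := σ.nat 23 0 0) (y := σ.nat 21 0 0)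
    (by simpa using hn) (by rw [State.setN_nat_ne _ _ _ _ _ (by decide), State.setR_nat, ha])
    (by rw [State.setN_nat_ne _ _ _ _ _ (by decide), State.setR_nat, hs])
    (by rw [State.setN_real, State.setR_real_ne _ _ _ _ _ (by decide), hw]) (by simp) (by simp)
    (by simp) (by simp)
  simp only [bfEntry, den]
  have e : (State.setR σ 4 (σ.nat 23 0 0 + 1) (σ.nat 21 0 0)
      (σ.real 4 (σ.nat 23 0 0) (σ.nat 21 0 0))).real 4 (σ.nat 23 0 0) = σ.real 4 (σ.nat 23 0 0) := by
    funext j; simp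
  rw [State.setN_real, e] at h3
  refine ⟨fun i j h => (h1 i j h).trans ?_, fun i j h => (h2 i j h).trans ?_, h3⟩
  · simp [h]
  · simp [h]

theorem bfRound_spec {σ : State} {t : ℕ} (hn : σ.nat 0 0 0 = n) (ha : σ.nat 1 = a)
    (hs : σ.nat 3 = s) (hw : σ.real 1 = w) (ht : σ.nat 23 0 0 = t) :
    (∀ i, i ≠ t + 1 → (den ω (.rep 21 bfEntry) σ).real 4 i = σ.real 4 i) ∧
    (∀ i, i ≠ t + 1 → (den ω (.rep 21 bfEntry) σ).nat 6 i = σ.nat 6 i) ∧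
    ∀ y < n, RowOK n (link a s) w (σ.real 4 t) ((den ω (.rep 21 bfEntry) σ).real 4 (t + 1))
      ((den ω (.rep 21 bfEntry) σ).nat 6 (t + 1)) y := by
  obtain ⟨τ, ⟨i1, i2, i3⟩, e⟩ := rep_rule (ω := ω) 21 bfEntry σ n hn
    (fun k τ => (∀ i, i ≠ t + 1 → τ.real 4 i = σ.real 4 i) ∧
      (∀ i, i ≠ t + 1 → τ.nat 6 i = σ.nat 6 i) ∧
      ∀ y < k, RowOK n (link a s) w (σ.real 4 t) (τ.real 4 (t + 1)) (τ.nat 6 (t + 1)) y)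
    ⟨fun _ _ => rfl, fun _ _ => rfl, fun _ h => absurd h (by simp)⟩
    (fun k hk τ fn fr ⟨i1, i2, i3⟩ => by
      obtain ⟨h1, h2, h3⟩ := bfEntry_spec (ω := ω) (n := n) (a := a) (s := s) (w := w)
        (σ := τ.setN 21 0 0 k) (t := t) (y := k)
        (by simp [fn 0 (by decide) (by decide), hn])
        (by rw [State.setN_nat_ne _ _ _ _ _ (by decide), fn 1 (by decide) (by decide), ha])
        (by rw [State.setN_nat_ne _ _ _ _ _ (by decide), fn 3 (by decide) (by decide), hs])
        (by rw [State.setN_real, fr 1 (by decide), hw])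
        (by simp [fn 23 (by decide) (by decide), ht]) (by simp)
      rw [State.setN_real, i1 t (by omega)] at h3
      refine ⟨fun i hi => ?_, fun i hi => ?_, fun y hy => ?_⟩
      · funext j; rw [h1 i j (by tauto), State.setN_real, i1 i hi]
      · funext j; rw [h2 i j (by tauto), State.setN_nat_ne _ _ _ _ _ (by decide), i2 i hi]
      · rcases Nat.lt_or_eq_of_le (Nat.le_of_lt_succ hy) with h | rfl
        · have := i3 y h
          unfold RowOK at this ⊢
          rw [h1 _ _ (by omega), h2 _ _ (by omega)]
          simpa using this
        · exact h3)
  rw [e]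
  refine ⟨by simpa using i1, fun i hi => ?_, fun y hy => ?_⟩
  · rw [State.setN_nat_ne _ _ _ _ _ (by decide), i2 i hi]
  · rw [State.setN_nat_ne _ _ _ _ _ (by decide), State.setN_real]; exact i3 y hy

theorem bfInit_spec {σ : State} (hn : σ.nat 0 0 0 = n) :
    ∀ y < n, (den ω (.rep 21 bfInit) σ).real 4 0 y =
      if σ.nat 5 y 0 = 1 then 0 else σ.real 2 0 0 := by
  obtain ⟨τ, i1, e⟩ := rep_rule (ω := ω) 21 bfInit σ n hn
    (fun k τ => ∀ y < k, τ.real 4 0 y = if σ.nat 5 y 0 = 1 then 0 else σ.real 2 0 0)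
    (fun _ h => absurd h (by simp))
    (fun k hk τ fn fr i1 y hy => by
      have e1 : τ.nat 5 = σ.nat 5 := fn 5 (by decide) (by decide)
      have e2 : τ.real 2 = σ.real 2 := fr 2 (by decide)
      simp only [bfInit, den]
      rcases Nat.lt_or_eq_of_le (Nat.le_of_lt_succ hy) with h | rfl
      · split_ifs with h1 h2 h2 <;> simp [h.ne, i1 y h, h2]
      · split_ifs with h1 h2 h2 <;> simp_all)
  rw [e]
  simpa using i1

theorem bellmanFord_spec {σ : State} (hn : σ.nat 0 0 0 = n) (ha : σ.nat 1 = a)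
    (hs : σ.nat 3 = s) (hw : σ.real 1 = w) (hB : σ.real 2 0 0 = B) :
    LDD.BF n (link a s) w (fun y => σ.nat 5 y 0 = 1) B ((den ω bellmanFord σ).real 4)
      ((den ω bellmanFord σ).nat 6) := by
  have h0 := bfInit_spec (ω := ω) hn
  have f1 : ∀ b, b ≠ 21 → (den ω (.rep 21 bfInit) σ).nat b = σ.nat b := fun b hb =>
    den_nat _ _ (by simpa [nwrites, bfInit] using hb)
  have f2 : ∀ b, b ≠ 4 → (den ω (.rep 21 bfInit) σ).real b = σ.real b := fun b hb =>
    den_real _ _ (by simpa [rwrites, bfInit] using hb)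
  simp only [bellmanFord, den.eq_5]
  generalize den ω (.rep 21 bfInit) σ = σ₀ at h0 f1 f2
  obtain ⟨τ, ⟨i1, i2⟩, e⟩ := rep_rule (ω := ω) 23 (.rep 21 bfEntry) σ₀ n
    (by rw [f1 0 (by decide), hn])
    (fun k τ => τ.real 4 0 = σ₀.real 4 0 ∧ ∀ t < k, ∀ y < n,
      RowOK n (link a s) w (τ.real 4 t) (τ.real 4 (t + 1)) (τ.nat 6 (t + 1)) y)
    ⟨rfl, fun _ h => absurd h (by simp)⟩
    (fun k hk τ fn fr ⟨i1, i2⟩ => by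
      obtain ⟨h1, h2, h3⟩ := bfRound_spec (ω := ω) (n := n) (a := a) (s := s) (w := w)
        (σ := τ.setN 23 0 0 k) (t := k)
        (by simp [fn 0 (by decide) (by decide), f1 0 (by decide), hn])
        (by rw [State.setN_nat_ne _ _ _ _ _ (by decide), fn 1 (by decide) (by decide),
              f1 1 (by decide), ha])
        (by rw [State.setN_nat_ne _ _ _ _ _ (by decide), fn 3 (by decide) (by decide),
              f1 3 (by decide), hs])
        (by rw [State.setN_real, fr 1 (by decide), f2 1 (by decide), hw]) (by simp)
      refine ⟨by rw [h1 0 (by omega), State.setN_real, i1], fun t ht y hy => ?_⟩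
      rcases Nat.lt_or_eq_of_le (Nat.le_of_lt_succ ht) with h | rfl
      · rw [h1 t (by omega), h1 (t + 1) (by omega), h2 (t + 1) (by omega), State.setN_real,
          State.setN_nat_ne _ _ _ _ _ (by decide)]
        exact i2 t h y hy
      · rw [h1 t (by omega), State.setN_real]
        rw [State.setN_real] at h3
        exact h3 y hy)
  rw [e, State.setN_real, State.setN_nat_ne _ _ _ _ _ (by decide)]
  refine ⟨fun y hy hS => ?_, fun y hy hS => ?_, fun t ht y hy => (i2 t ht y hy).1,
    fun t ht x hx y hy => (i2 t ht y hy).2.1 x hx, fun t ht y hy => (i2 t ht y hy).2.2⟩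
  · rw [i1, h0 y hy, if_pos hS]
  · rw [i1, h0 y hy, if_neg hS, hB]

end Code

end RealRAM

/-! ### Skeletons: shortest paths to the root and their net points. -/

namespace LDD

variable {n : ℕ} {A : ℕ → ℕ → Prop} {w : ℕ → ℕ → ℝ} {D B : ℝ} {k t v l cur : ℕ} {s : ℕ → ℕ}
  {Q M : ℕ → Prop} {P : ℕ → ℕ → ℝ} {pr : ℕ → ℕ → ℕ} {ld : ℝ}

/-- A shortest path `Q` from the root `v` towards the label `l`, with its net points `M`. -/
structure Arm (n : ℕ) (A : ℕ → ℕ → Prop) (w : ℕ → ℕ → ℝ) (D : ℝ) (s : ℕ → ℕ) (v : ℕ) (f : ℕ → ℝ)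
    (l : ℕ) (Q M : ℕ → Prop) : Prop where
  sub : ∀ x, M x → Q x
  lt : ∀ x, Q x → x < n
  conn : ∀ x, Q x → ∃ r, WPath (restr (same A s) Q) w x v r
  cover : ∀ x, Q x → ∃ c r, M c ∧ r ≤ D ∧ WPath (restr (same A s) Q) w x c r
  sep : ∀ c c', M c → M c' → c ≠ c' → D < |f c - f c'|
  adj : ∀ x, Q x → AdjLabel A w s v l
  touch : AdjLabel A w s v l → ∃ x z, Q x ∧ A x z ∧ s z = l

/-- A path `Q` under construction that has reached `cur`, with its net points `M`, the last of which
is at distance `ld` from the root. -/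
structure Trace (n : ℕ) (A : ℕ → ℕ → Prop) (w : ℕ → ℕ → ℝ) (D : ℝ) (s : ℕ → ℕ) (f : ℕ → ℝ)
    (cur : ℕ) (ld : ℝ) (Q M : ℕ → Prop) : Prop where
  cur_mem : Q cur
  sub : ∀ x, M x → Q x
  lt : ∀ x, Q x → x < n
  conn : ∀ x, Q x → ∃ r, WPath (restr (same A s) Q) w x cur r
  cover : ∀ x, Q x → ∃ c r, M c ∧ r ≤ D ∧ WPath (restr (same A s) Q) w x c r
  last : ∃ c, M c ∧ WPath (restr (same A s) Q) w cur c (ld - f cur)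
  le : ld - f cur ≤ D
  sep : ∀ c c', M c → M c' → c ≠ c' → D < |f c - f c'|
  ge : ∀ c, M c → ld ≤ f c

theorem WPath.restr_mono {S S' : ℕ → Prop} (h : ∀ x, S x → S' x) {x y : ℕ} {r : ℝ}
    (p : WPath (restr A S) w x y r) : WPath (restr A S') w x y r :=
  p.mono fun _ _ a => ⟨a.1, h _ a.2.1, h _ a.2.2⟩

theorem Trace.start (hD : 0 ≤ D) {f : ℕ → ℝ} {y : ℕ} (hy : y < n) :
    Trace n A w D s f y (f y) (· = y) (· = y) where
  cur_mem := rfl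
  sub _ h := h
  lt x h := h ▸ hy
  conn x h := ⟨0, by subst h; exact .nil _⟩
  cover x h := ⟨y, 0, rfl, hD, by subst h; exact .nil _⟩
  last := ⟨y, rfl, by rw [sub_self]; exact .nil _⟩
  le := by simpa using hD
  sep c c' h h' hne := (hne (h.trans h'.symm)).elim
  ge c h := by rw [h]

/-- The predecessor of a vertex that is reached along a shortest path is also reached along a
shortest path. -/
theorem BF.pred_tight {S : ℕ → Prop} (h : BF n A w S B P pr) (hG : WG n A w) (hB : Huge n A w B)
    (ht : t < n) (hc : cur < n) (hP : P (t + 1) cur = P n cur) (hlt : P n cur < B) :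
    pr (t + 1) cur < n ∧ P t (pr (t + 1) cur) = P n (pr (t + 1) cur) ∧
      P n (pr (t + 1) cur) < B ∧
      (pr (t + 1) cur = cur ∨ (A (pr (t + 1) cur) cur ∧
        P n cur = P n (pr (t + 1) cur) + w (pr (t + 1) cur) cur)) := by
  rcases h.pred t ht cur hc with ⟨e, e'⟩ | ⟨a, e⟩
  · rw [e]
    exact ⟨hc, by rw [← e', hP], hlt, .inl rfl⟩
  · have hx := (hG.lt a).1
    have h1 := h.le_add hG hB hx (.single a)
    have h2 := h.antitone (t := t) (t' := n) ht.le le_rfl hx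
    have h3 : P t (pr (t + 1) cur) = P n (pr (t + 1) cur) := by linarith
    exact ⟨hx, h3, by linarith [hG.nonneg a], .inr ⟨a, by linarith⟩⟩

/-- On a shortest path, the walk back to the last net point has weight equal to the difference of
the distances to the root. A new net point is placed exactly when this exceeds `D`. As distances
decrease towards the root, it is then separated from all earlier ones. -/
theorem Trace.step (h : Trace n A w D s (P n) cur ld Q M) (hG : WG n A w) (hD : 0 ≤ D) {x : ℕ}
    (hx : x < n)
    (hpr : x = cur ∨ (same A s x cur ∧ P n cur = P n x + w x cur)) :
    (D < ld - P n x → Trace n A w D s (P n) x (P n x) (fun z => Q z ∨ z = x) fun z => M z ∨ z = x) ∧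
    (¬ D < ld - P n x → Trace n A w D s (P n) x ld (fun z => Q z ∨ z = x) M) := by
  have hG' := hG.same s
  have p : WPath (restr (same A s) fun z => Q z ∨ z = x) w cur x (P n cur - P n x) := by
    rcases hpr with rfl | ⟨a, e⟩
    · rw [sub_self]; exact .nil _
    · rw [show P n cur - P n x = w cur x by rw [e, hG.w_symm a.1]; ring]
      exact .single ⟨hG'.symm a, .inl h.cur_mem, .inr rfl⟩
  have hmono : ∀ z, Q z → (Q z ∨ z = x) := fun _ => .inl
  constructor
  · intro hlt
    refine ⟨.inr rfl, ?_, ?_, ?_, ?_, ⟨x, .inr rfl, by rw [sub_self]; exact .nil _⟩,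
      by simpa using hD, ?_, ?_⟩
    · rintro z (hz | rfl)
      exacts [.inl (h.sub z hz), .inr rfl]
    · rintro z (hz | rfl)
      exacts [h.lt z hz, hx]
    · rintro z (hz | rfl)
      · obtain ⟨r, q⟩ := h.conn z hz
        exact ⟨_, (q.restr_mono hmono).trans p⟩
      · exact ⟨0, .nil _⟩
    · rintro z (hz | rfl)
      · obtain ⟨c, r, h1, h2, h3⟩ := h.cover z hz
        exact ⟨c, r, .inl h1, h2, h3.restr_mono hmono⟩
      · exact ⟨z, 0, .inr rfl, hD, .nil _⟩
    · rintro c c' (hc | rfl) (hc' | rfl) hne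
      · exact h.sep c c' hc hc' hne
      · rw [lt_abs]; left; linarith [h.ge c hc]
      · rw [lt_abs]; right; linarith [h.ge c' hc']
      · exact (hne rfl).elim
    · rintro c (hc | rfl)
      · linarith [h.ge c hc]
      · exact le_rfl
  · intro hle
    have hlast : ∃ c, M c ∧ WPath (restr (same A s) fun z => Q z ∨ z = x) w x c (ld - P n x) := by
      obtain ⟨c, hc, q⟩ := h.last
      refine ⟨c, hc, ?_⟩
      have := (p.symm (hG'.restr _)).trans (q.restr_mono hmono)
      rwa [show P n cur - P n x + (ld - P n cur) = ld - P n x by ring] at this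
    push Not at hle
    refine ⟨.inr rfl, fun z hz => .inl (h.sub z hz), ?_, ?_, ?_, hlast, hle, h.sep, h.ge⟩
    · rintro z (hz | rfl)
      exacts [h.lt z hz, hx]
    · rintro z (hz | rfl)
      · obtain ⟨r, q⟩ := h.conn z hz
        exact ⟨_, (q.restr_mono hmono).trans p⟩
      · exact ⟨0, .nil _⟩
    · rintro z (hz | rfl)
      · obtain ⟨c, r, h1, h2, h3⟩ := h.cover z hz
        exact ⟨c, r, h1, h2, h3.restr_mono hmono⟩
      · obtain ⟨c, hc, q⟩ := hlast
        exact ⟨c, _, hc, hle, q⟩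

theorem Trace.arm {f : ℕ → ℝ} (h : Trace n A w D s f v ld Q M) (ha : AdjLabel A w s v l)
    {y z : ℕ} (hy : Q y) (hyz : A y z) (hz : s z = l) : Arm n A w D s v f l Q M where
  sub := h.sub
  lt := h.lt
  conn := h.conn
  cover := h.cover
  sep := h.sep
  adj _ _ := ha
  touch _ := ⟨y, z, hy, hyz, hz⟩

theorem Arm.empty {f : ℕ → ℝ} (ha : ¬ AdjLabel A w s v l) :
    Arm n A w D s v f l (fun _ => False) fun _ => False :=
  ⟨fun _ h => h, fun _ h => h.elim, fun _ h => h.elim, fun _ h => h.elim, fun _ _ h => h.elim,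
    fun _ h => h.elim, fun h => (ha h).elim⟩

/-- Pigeonhole: the rescaled values lie in `[0, 6]`, hence in seven unit cells, and no two points
share a cell. -/
theorem card_separated {f : ℕ → ℝ} (hD : 0 < D) (b : ℝ) (F : Finset ℕ)
    (hF : ∀ c ∈ F, |f c - b| ≤ 3 * D)
    (hs : ∀ c ∈ F, ∀ c' ∈ F, c ≠ c' → D < |f c - f c'|) : F.card ≤ 7 := by
  have : F.card ≤ (Finset.range 7).card := by
    refine Finset.card_le_card_of_injOn (fun c => ⌊(f c - b + 3 * D) / D⌋₊) (fun c hc => ?_)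
      fun c hc c' hc' e => ?_
    · have := abs_le.1 (hF c hc)
      simp only [Finset.coe_range, Set.mem_Iio]
      rw [Nat.floor_lt (div_nonneg (by linarith) hD.le), div_lt_iff₀ hD]
      push_cast
      linarith
    · by_contra hne
      have h1 := hs c hc c' hc' hne
      have a1 := abs_le.1 (hF c hc)
      have a2 := abs_le.1 (hF c' hc')
      have e1 := Nat.floor_le (a := (f c - b + 3 * D) / D) (div_nonneg (by linarith) hD.le)
      have e2 := Nat.lt_floor_add_one ((f c - b + 3 * D) / D)
      have e3 := Nat.floor_le (a := (f c' - b + 3 * D) / D) (div_nonneg (by linarith) hD.le)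
      have e4 := Nat.lt_floor_add_one ((f c' - b + 3 * D) / D)
      simp only at e
      rw [e] at e1 e2
      rw [le_div_iff₀ hD] at e1 e3
      rw [div_lt_iff₀ hD] at e2 e4
      rcases lt_abs.1 h1 with h | h <;> nlinarith
  simpa using this

theorem BF.sub_le {S : ℕ → Prop} (h : BF n A w S B P pr) (hG : WG n A w) (hB : Huge n A w B)
    {x y : ℕ} {r : ℝ} (hx : x < n) (p : WPath A w x y r) : |P n y - P n x| ≤ r := by
  have h1 := h.le_add hG hB hx p
  have h2 := h.le_add hG hB (p.lt_of_lt hG hx) (p.symm hG)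
  rw [abs_le]; constructor <;> linarith

/-- Labels are at most `t ≤ n`, so the arms towards `1, …, n` suffice, and only those to the at most
`k` adjacent labels are nonempty. For the count, distance to the root is 1-Lipschitz: net points
near `u` have distances in a window of length `6 * D`, which leaves seven per arm, plus the root. -/
theorem CopInv.skel {N : ℕ → Prop} {S : ℕ → Prop} (h : CopInv n A w D k t s N)
    (hG : WG n A w) (hB : Huge n A w B) (hD : 0 < D) (hm : NoMinor n A w k) (htn : t ≤ n)
    (hv : v < n) (hs : s v = 0) (hP : BF n (same A s) w S B P pr)
    {Q M : ℕ → ℕ → Prop} (hA : ∀ j < n, Arm n A w D s v (P n) (j + 1) (Q j) (M j)) :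
    Skel n A w D k s v (fun x => x = v ∨ ∃ j < n, Q j x) N
      fun x => N x ∨ x = v ∨ ∃ j < n, M j x where
  root := .inl rfl
  unassigned := by
    rintro x (rfl | ⟨j, hj, hx⟩)
    · exact ⟨hv, hs⟩
    · obtain ⟨r, p⟩ := (hA j hj).conn x hx
      refine ⟨(hA j hj).lt x hx, ?_⟩
      rw [← hs]
      exact (p.mono fun _ _ a => a.1).same_label
  conn := by
    rintro x (rfl | ⟨j, hj, hx⟩)
    · exact ⟨0, .nil _⟩
    · obtain ⟨r, p⟩ := (hA j hj).conn x hx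
      exact ⟨r, p.restr_mono fun z hz => .inr ⟨j, hj, hz⟩⟩
  touch := by
    intro l hl
    obtain ⟨h0, y, r, z, -, -, hz⟩ := id hl
    have hle := h.le z
    obtain ⟨j, rfl⟩ := Nat.exists_eq_succ_of_ne_zero h0
    obtain ⟨x, z, h1, h2, h3⟩ := (hA j (by omega)).touch hl
    exact ⟨x, z, .inr ⟨j, by omega, h1⟩, h2, h3⟩
  old c hc := .inl hc
  new := by
    rintro c (hc | rfl | ⟨j, hj, hc⟩)
    · exact .inl hc
    · exact .inr (.inl rfl)
    · exact .inr (.inr ⟨j, hj, (hA j hj).sub c hc⟩)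
  cover := by
    rintro x (rfl | ⟨j, hj, hx⟩)
    · exact ⟨x, 0, .inr (.inl rfl), .inl rfl, hD.le, .nil _⟩
    · obtain ⟨c, r, h1, h2, h3⟩ := (hA j hj).cover x hx
      exact ⟨c, r, .inr (.inr ⟨j, hj, h1⟩), .inr ⟨j, hj, (hA j hj).sub c h1⟩, h2,
        h3.restr_mono fun z hz => .inr ⟨j, hj, hz⟩⟩
  count := by
    classical
    intro u F hF
    let L := (Finset.range n).filter fun j => AdjLabel A w s v (j + 1)
    have hL : L.card ≤ k := by
      have := h.card_adj hm hv hs (L.image (· + 1)) (fun l hl => by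
        simp only [L, Finset.mem_image, Finset.mem_filter] at hl
        obtain ⟨j, hj, rfl⟩ := hl
        exact hj.2)
      rwa [Finset.card_image_of_injective _ (add_left_injective 1)] at this
    have hsub : F ⊆ {v} ∪ L.biUnion fun j => F.filter (M j) := by
      intro c hc
      obtain ⟨h1, h2, r, -, p⟩ := hF c hc
      have hsc : s c = 0 := by
        rcases h2 with rfl | ⟨j, hj, hq⟩
        · exact hs
        · obtain ⟨r, p⟩ := (hA j hj).conn c hq
          rw [← hs]
          exact (p.mono fun _ _ a => a.1).same_label
      rcases h1 with h1 | rfl | ⟨j, hj, h1⟩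
      · exact (h.net c h1 hsc).elim
      · simp
      · have := (hA j hj).adj c ((hA j hj).sub c h1)
        simp only [Finset.singleton_union, Finset.mem_insert, Finset.mem_biUnion, Finset.mem_filter]
        exact .inr ⟨j, by simp [L, hj, this], hc, h1⟩
    have hcard : ∀ j ∈ L, (F.filter (M j)).card ≤ 7 := by
      intro j hj
      simp only [L, Finset.mem_filter, Finset.mem_range] at hj
      rcases (F.filter (M j)).eq_empty_or_nonempty with h0 | ⟨c₀, hc₀⟩
      · simp [h0]
      have hun : u < n := by
        simp only [Finset.mem_filter] at hc₀
        obtain ⟨-, -, r, -, p⟩ := hF _ hc₀.1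
        exact (p.symm (hG.same s)).lt_of_lt (hG.same s)
          ((hA j hj.1).lt _ ((hA j hj.1).sub _ hc₀.2))
      refine card_separated (f := P n) hD (P n u) _ (fun c hc => ?_) fun c hc c' hc' hne => ?_
      · simp only [Finset.mem_filter] at hc
        obtain ⟨-, -, r, hr, p⟩ := hF c hc.1
        exact (hP.sub_le (hG.same s) (hB.mono fun _ _ a => a.1) hun p).trans hr
      · simp only [Finset.mem_filter] at hc hc'
        exact (hA j hj.1).sep c c' hc.2 hc'.2 hne
    calc F.card ≤ _ := Finset.card_le_card hsub
      _ ≤ 1 + (L.biUnion fun j => F.filter (M j)).card := by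
          simpa using Finset.card_union_le {v} (L.biUnion fun j => F.filter (M j))
      _ ≤ 1 + L.card * 7 := by gcongr; exact Finset.card_biUnion_le_card_mul _ _ _ hcard
      _ ≤ 7 * k + 1 := by nlinarith

end LDD

/-! ### Programs for skeletons and supernodes. -/

namespace RealRAM

namespace Code

/-- The data that never change during the main part of the computation. -/
structure Env (n k : ℕ) (a : ℕ → ℕ → ℕ) (w : ℕ → ℕ → ℝ) (B D : ℝ) (σ : State) : Prop where
  size : σ.nat 0 0 0 = n
  param : σ.nat 0 0 1 = k
  adj : σ.nat 1 = a
  weight : σ.real 1 = w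
  inf : σ.real 2 0 0 = B
  scale : σ.real 3 0 0 = D

variable {ω : ℕ → unitInterval} {n k : ℕ} {a : ℕ → ℕ → ℕ} {w : ℕ → ℕ → ℝ} {B D : ℝ} {σ τ : State}

theorem Env.congr (h : Env n k a w B D σ) (h0 : τ.nat 0 = σ.nat 0) (h1 : τ.nat 1 = σ.nat 1)
    (r1 : τ.real 1 = σ.real 1) (r2 : τ.real 2 = σ.real 2) (r3 : τ.real 3 = σ.real 3) :
    Env n k a w B D τ :=
  ⟨by rw [h0, h.size], by rw [h0, h.param], by rw [h1, h.adj], by rw [r1, h.weight],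
    by rw [r2, h.inf], by rw [r3, h.scale]⟩

theorem Env.setN (h : Env n k a w B D σ) (b i j x : ℕ) (hb : 1 < b) :
    Env n k a w B D (σ.setN b i j x) :=
  h.congr (State.setN_nat_ne _ _ _ _ _ (by omega)) (State.setN_nat_ne _ _ _ _ _ (by omega)) rfl rfl
    rfl

theorem Env.setR (h : Env n k a w B D σ) (b i j : ℕ) (x : ℝ) (hb : 3 < b) :
    Env n k a w B D (σ.setR b i j x) :=
  h.congr rfl rfl (State.setR_real_ne _ _ _ _ _ (by omega))
    (State.setR_real_ne _ _ _ _ _ (by omega)) (State.setR_real_ne _ _ _ _ _ (by omega))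

/-- The code does not change the data in `Env`. -/
abbrev Keeps (c : Code) : Prop :=
  (0 ∉ c.nwrites ∧ 1 ∉ c.nwrites) ∧ 1 ∉ c.rwrites ∧ 2 ∉ c.rwrites ∧ 3 ∉ c.rwrites

theorem Env.den (h : Env n k a w B D σ) {c : Code} (hc : Keeps c) :
    Env n k a w B D (Code.den ω c σ) :=
  h.congr (den_nat _ _ hc.1.1) (den_nat _ _ hc.1.2) (den_real _ _ hc.2.1) (den_real _ _ hc.2.2.1)
    (den_real _ _ hc.2.2.2)

theorem Env.loop (h : Env n k a w B D σ) {c : Code} {v i : ℕ} (hc : Keeps c) (hv : 1 < v)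
    (fn : ∀ a, a ≠ v → a ∉ c.nwrites → τ.nat a = σ.nat a)
    (fr : ∀ a, a ∉ c.rwrites → τ.real a = σ.real a) : Env n k a w B D (τ.setN v 0 0 i) :=
  (h.congr (fn _ (by omega) hc.1.1) (fn _ (by omega) hc.1.2) (fr _ hc.2.1) (fr _ hc.2.2.1)
    (fr _ hc.2.2.2)).setN _ _ _ _ hv

/-- The labels of the vertices. -/
def lab (σ : State) (x : ℕ) : ℕ := σ.nat 3 x 0

/-- The vertices marked in array `b`. -/
def marked (σ : State) (b x : ℕ) : Prop := σ.nat b x 0 = 1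

@[simp] theorem marked_setN_one {b x y : ℕ} : marked (σ.setN b x 0 1) b y ↔ y = x ∨ marked σ b y := by
  by_cases h : y = x <;> simp [marked, h]

theorem marked_setN_ne {b c i j x y : ℕ} (h : b ≠ c) :
    marked (σ.setN c i j x) b y ↔ marked σ b y := by
  simp [marked, h]

@[simp] theorem marked_setR {b c i j y : ℕ} {x : ℝ} :
    marked (σ.setR c i j x) b y ↔ marked σ b y := Iff.rfl

/-- The graph. -/
def adjRel (a : ℕ → ℕ → ℕ) (x y : ℕ) : Prop := a x y = 1

theorem Env.bellmanFord (h : Env n k a w B D σ) :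
    LDD.BF n (LDD.same (adjRel a) (lab σ)) w (marked σ 5) B ((Code.den ω bellmanFord σ).real 4)
      ((Code.den ω bellmanFord σ).nat 6) :=
  bellmanFord_spec h.size h.adj rfl h.weight h.inf

/-- One step along a shortest path towards the root. -/
def traceStep : Code :=
  .seq (.nset 7 (.const 0) (.const 0) (.get 6 (.sub (nv 0) (nv 23)) (nv 7)))
  (.seq (.nset 5 (nv 7) (.const 0) (.const 1))
  (.cond (rlt (rv 3) (.sub (rv 7) (.get 4 (nv 0) (nv 7))))
    (.seq (.nset 4 (nv 7) (.const 0) (.const 1))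
      (.rset 7 (.const 0) (.const 0) (.get 4 (nv 0) (nv 7)))) .skip))

/-- Trace a shortest path to the root. -/
def traceArm : Code :=
  .seq (.nset 5 (nv 7) (.const 0) (.const 1)) (.seq (.nset 4 (nv 7) (.const 0) (.const 1))
    (.seq (.rset 7 (.const 0) (.const 0) (.get 4 (nv 0) (nv 7))) (.rep 23 traceStep)))

open LDD in
-- Predecessors are read from round `n` backwards. After `m` passes the distance of the current
-- vertex is already attained in round `n - m`, which is what makes the predecessor of that round
-- tight.
theorem traceArm_spec {s : ℕ → ℕ} {v y : ℕ} {P : ℕ → ℕ → ℝ} {pr : ℕ → ℕ → ℕ}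
    (h : Env n k a w B D σ) (hG : WG n (adjRel a) w) (hB : Huge n (adjRel a) w B) (hD : 0 ≤ D)
    (hP : BF n (same (adjRel a) s) w (· = v) B P pr) (e4 : σ.real 4 = P) (e6 : σ.nat 6 = pr)
    (hy : y < n) (hyB : P n y < B) (e7 : σ.nat 7 0 0 = y) :
    ∃ Q M ld, Trace n (adjRel a) w D s (P n) v ld Q M ∧ Q y ∧
      (∀ x, marked (den ω traceArm σ) 5 x ↔ marked σ 5 x ∨ Q x) ∧
      (∀ x, marked (den ω traceArm σ) 4 x ↔ marked σ 4 x ∨ M x) := by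
  have hB' : Huge n (same (adjRel a) s) w B := hB.mono fun _ _ h => h.1
  have hG' := hG.same s
  set σ₀ := ((σ.setN 5 y 0 1).setN 4 y 0 1).setR 7 0 0 (P n y) with hσ₀
  have h₀ : Env n k a w B D σ₀ :=
    ((h.setN _ _ _ _ (by norm_num)).setN _ _ _ _ (by norm_num)).setR _ _ _ _ (by norm_num)
  have e : den ω traceArm σ = den ω (.rep 23 traceStep) σ₀ := by
    simp [traceArm, den, e7, e4, h.size, hσ₀]
  obtain ⟨τ, ⟨Q, M, i1, i2, i3, i4, i5, i6⟩, e'⟩ := rep_rule (ω := ω) 23 traceStep σ₀ n h₀.size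
    (fun m τ => ∃ Q M, Trace n (adjRel a) w D s (P n) (τ.nat 7 0 0) (τ.real 7 0 0) Q M ∧ Q y ∧
      (∀ x, marked τ 5 x ↔ marked σ 5 x ∨ Q x) ∧ (∀ x, marked τ 4 x ↔ marked σ 4 x ∨ M x) ∧
      P (n - m) (τ.nat 7 0 0) = P n (τ.nat 7 0 0) ∧ P n (τ.nat 7 0 0) < B)
    ⟨(· = y), (· = y), by
      refine ⟨?_, rfl, fun x => ?_, fun x => ?_, ?_, ?_⟩
      · simpa [hσ₀, e7] using Trace.start hD hy
      · simp [hσ₀, marked_setN_ne, or_comm]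
      · simp [hσ₀, marked_setN_ne, or_comm]
      · simp
      · simpa [hσ₀, e7] using hyB⟩
    (fun m hm τ fn fr ⟨Q, M, i1, i2, i3, i4, i5, i6⟩ => by
      have hE : Env n k a w B D (τ.setN 23 0 0 m) := h₀.loop (by decide) (by norm_num) fn fr
      have f4 : τ.real 4 = P := by rw [fr 4 (by decide), ← e4]; rfl
      have f6 : τ.nat 6 = pr := by
        rw [fn 6 (by decide) (by decide), ← e6, hσ₀, State.setR_nat,
          State.setN_nat_ne _ _ _ _ _ (by decide), State.setN_nat_ne _ _ _ _ _ (by decide)]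
      obtain ⟨t, ht⟩ : ∃ t, n - m = t + 1 := ⟨n - m - 1, by omega⟩
      have htn : t < n := by omega
      have hn0 : τ.nat 0 0 0 = n := by simpa using hE.size
      have hs0 : τ.real 3 0 0 = D := hE.scale
      generalize hc : τ.nat 7 0 0 = cur at *
      rw [ht] at i5
      obtain ⟨j1, j2, j3, j4⟩ := hP.pred_tight hG' hB' htn (i1.lt _ i1.cur_mem) i5 i6
      obtain ⟨s1, s2⟩ := i1.step hG hD j1 (by
        rcases j4 with j4 | j4
        exacts [.inl j4, .inr j4])
      have hsub : n - (m + 1) = t := by omega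
      generalize hx : pr (t + 1) cur = x at *
      have hm3 : ∀ z, (z = x ∨ marked τ 5 z) ↔ marked σ 5 z ∨ (Q z ∨ z = x) := by
        intro z; rw [i3, or_comm, or_assoc]
      have hm4 : ∀ z, (z = x ∨ marked τ 4 z) ↔ marked σ 4 z ∨ (M z ∨ z = x) := by
        intro z; rw [i4, or_comm, or_assoc]
      by_cases hb : D < τ.real 7 0 0 - P n x
      · have e1 : den ω traceStep (τ.setN 23 0 0 m) =
            ((((τ.setN 23 0 0 m).setN 7 0 0 x).setN 5 x 0 1).setN 4 x 0 1).setR 7 0 0 (P n x) := by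
          simp [traceStep, den, hn0, hs0, f4, f6, hc, ht, hx, hb]
        rw [e1]
        refine ⟨fun z => Q z ∨ z = x, fun z => M z ∨ z = x, by simpa using s1 hb, .inl i2, fun z => ?_, fun z => ?_, ?_, ?_⟩
        · rw [← hm3 z]
          simp [marked_setN_ne]
        · rw [← hm4 z]
          simp [marked_setN_ne]
        · simp [hsub, j2]
        · simp [j3]
      · have e1 : den ω traceStep (τ.setN 23 0 0 m) =
            ((τ.setN 23 0 0 m).setN 7 0 0 x).setN 5 x 0 1 := by
          simp [traceStep, den, hn0, hs0, f4, f6, hc, ht, hx, hb]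
        rw [e1]
        refine ⟨fun z => Q z ∨ z = x, M, by simpa using s2 hb, .inl i2, fun z => ?_, fun z => ?_, ?_, ?_⟩
        · rw [← hm3 z]
          simp [marked_setN_ne]
        · rw [← i4 z]
          simp [marked_setN_ne]
        · simp [hsub, j2]
        · simp [j3])
  -- In round `0` every vertex except the root has the value `B`.
  have hv : τ.nat 7 0 0 = v := by
    by_contra hne
    rw [Nat.sub_self] at i5
    rw [hP.nonsource _ (i1.lt _ i1.cur_mem) hne] at i5
    linarith
  rw [hv] at i1
  refine ⟨Q, M, _, i1, i2, fun x => ?_, fun x => ?_⟩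
  · rw [e, e', ← i3 x]; simp [marked]
  · rw [e, e', ← i4 x]; simp [marked]

end Code

end RealRAM

namespace LDD

theorem BF.congr {n : ℕ} {A : ℕ → ℕ → Prop} {w : ℕ → ℕ → ℝ} {S S' : ℕ → Prop} {B : ℝ}
    {P : ℕ → ℕ → ℝ} {pr : ℕ → ℕ → ℕ} (h : BF n A w S B P pr) (hS : ∀ y < n, (S' y ↔ S y)) :
    BF n A w S' B P pr :=
  { h with
    source := fun y hy h' => h.source y hy ((hS y hy).1 h')
    nonsource := fun y hy h' => h.nonsource y hy fun h'' => h' ((hS y hy).2 h'') }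

end LDD

namespace RealRAM

namespace Code

open LDD

variable {ω : ℕ → unitInterval} {n k : ℕ} {a : ℕ → ℕ → ℕ} {w : ℕ → ℕ → ℝ} {B D : ℝ} {σ τ : State}

/-- Test whether the edge from vertex `21` to vertex `22` leads from the component of the root to
label `24`. -/
def armTest : Code :=
  .cond (.and (natEq (.get 3 (nv 21) (.const 0)) (.const 0))
      (.and (rlt (.get 4 (nv 0) (nv 21)) (rv 2))
        (.and (natEq (.get 1 (nv 21) (nv 22)) (.const 1))
          (natEq (.get 3 (nv 22) (.const 0)) (.add (nv 24) (.const 1))))))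
    (.seq (.nset 8 (.const 0) (.const 0) (.const 1)) (.nset 7 (.const 0) (.const 0) (nv 21))) .skip

/-- The result of a search among the pairs in `S` for a pair in `R`. -/
def Found (n : ℕ) (R S : ℕ → ℕ → Prop) (τ : State) : Prop :=
  (τ.nat 8 0 0 = 0 ∧ ∀ y z, S y z → ¬ R y z) ∨
    (τ.nat 8 0 0 = 1 ∧ τ.nat 7 0 0 < n ∧ ∃ z, R (τ.nat 7 0 0) z)

/-- The edges from the component of the root to the label `l`. -/
def Exits (n : ℕ) (a : ℕ → ℕ → ℕ) (B : ℝ) (l : ℕ) (σ : State) (y z : ℕ) : Prop :=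
  lab σ y = 0 ∧ σ.real 4 n y < B ∧ adjRel a y z ∧ lab σ z = l

theorem armTest_spec {S : ℕ → ℕ → Prop} {y z l : ℕ} (h : Env n k a w B D σ) (hy : y < n)
    (e21 : σ.nat 21 0 0 = y) (e22 : σ.nat 22 0 0 = z) (e24 : σ.nat 24 0 0 = l)
    (hS : Found n (Exits n a B (l + 1) σ) S σ) :
    Found n (Exits n a B (l + 1) σ) (fun y' z' => S y' z' ∨ y' = y ∧ z' = z)
      (den ω armTest σ) := by
  have h0 := h.size
  have h1 := h.adj
  have h2 := h.inf
  by_cases hR : Exits n a B (l + 1) σ y z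
  · have e : den ω armTest σ = (σ.setN 8 0 0 1).setN 7 0 0 y := by
      obtain ⟨r1, r2, r3, r4⟩ := hR
      unfold lab at r1 r4
      unfold adjRel at r3
      simp [armTest, den, h0, h1, h2, e21, e22, e24, r1, r2, r3, r4]
    rw [e]
    exact .inr ⟨by simp, by simpa using hy, z, by simpa using hR⟩
  · have e : den ω armTest σ = σ := by
      simp only [armTest, den]
      rw [if_neg]
      simpa [Exits, lab, adjRel, h0, h1, h2, e21, e22, e24] using hR
    rw [e]
    rcases hS with ⟨h, h'⟩ | h
    · refine .inl ⟨h, ?_⟩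
      rintro y' z' (hs | ⟨rfl, rfl⟩)
      exacts [h' _ _ hs, hR]
    · exact .inr h

theorem Exits.congr {l : ℕ} (h3 : τ.nat 3 = σ.nat 3) (h4 : τ.real 4 = σ.real 4) :
    Exits n a B l τ = Exits n a B l σ := by
  unfold Exits lab
  rw [h3, h4]

theorem Found.setN {R S : ℕ → ℕ → Prop} {v i j x : ℕ} (h : Found n R S τ) (h7 : v ≠ 7)
    (h8 : v ≠ 8) : Found n R S (τ.setN v i j x) := by
  simpa [Found, h7.symm, h8.symm] using h

theorem Found.mono {R S S' : ℕ → ℕ → Prop} (h : Found n R S τ) (hS : ∀ y z, S' y z → S y z) :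
    Found n R S' τ :=
  h.imp (fun h => ⟨h.1, fun y z hs => h.2 y z (hS y z hs)⟩) id

theorem armRow_spec {y l : ℕ} (h : Env n k a w B D σ) (hy : y < n) (e21 : σ.nat 21 0 0 = y)
    (e24 : σ.nat 24 0 0 = l) (hS : Found n (Exits n a B (l + 1) σ) (fun y' z' => y' < y ∧ z' < n) σ) :
    Found n (Exits n a B (l + 1) σ) (fun y' z' => y' < y + 1 ∧ z' < n)
      (den ω (.rep 22 armTest) σ) := by
  obtain ⟨τ, i1, e⟩ := rep_rule (ω := ω) 22 armTest σ n h.size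
    (fun j τ => Found n (Exits n a B (l + 1) σ)
      (fun y' z' => (y' < y ∧ z' < n) ∨ (y' = y ∧ z' < j)) τ)
    (hS.mono (by rintro y' z' (h | h); exacts [h, absurd h.2 (by simp)]))
    (fun j hj τ fn fr i1 => by
      have e3 : (τ.setN 22 0 0 j).nat 3 = σ.nat 3 := by
        rw [State.setN_nat_ne _ _ _ _ _ (by decide), fn 3 (by decide) (by decide)]
      have e4 : (τ.setN 22 0 0 j).real 4 = σ.real 4 := fr 4 (by decide)
      rw [← Exits.congr e3 e4]
      rw [← Exits.congr e3 e4] at i1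
      refine (armTest_spec (h.loop (by decide) (by norm_num) fn fr) hy ?_ (by simp; rfl) ?_
        (i1.setN (by decide) (by decide))).mono ?_
      · simp [fn 21 (by decide) (by decide), e21]
      · simp [fn 24 (by decide) (by decide), e24]
      · rintro y' z' (h | h)
        · exact .inl (.inl h)
        · rcases Nat.lt_or_eq_of_le (Nat.le_of_lt_succ h.2) with h' | h'
          exacts [.inl (.inr ⟨h.1, h'⟩), .inr ⟨h.1, h'⟩])
  rw [e]
  refine (i1.setN (by decide) (by decide)).mono ?_
  intro y' z' h
  rcases Nat.lt_or_eq_of_le (Nat.le_of_lt_succ h.1) with h' | h'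
  exacts [.inl ⟨h', h.2⟩, .inr ⟨h', h.2⟩]

theorem armSearch_spec {l : ℕ} (h : Env n k a w B D σ) (e8 : σ.nat 8 0 0 = 0)
    (e24 : σ.nat 24 0 0 = l) :
    Found n (Exits n a B (l + 1) σ) (fun y z => y < n ∧ z < n)
      (den ω (.rep 21 (.rep 22 armTest)) σ) := by
  obtain ⟨τ, i1, e⟩ := rep_rule (ω := ω) 21 (.rep 22 armTest) σ n h.size
    (fun j τ => Found n (Exits n a B (l + 1) σ) (fun y' z' => y' < j ∧ z' < n) τ)
    (.inl ⟨e8, fun _ _ h => absurd h.1 (by simp)⟩)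
    (fun j hj τ fn fr i1 => by
      have e3 : (τ.setN 21 0 0 j).nat 3 = σ.nat 3 := by
        rw [State.setN_nat_ne _ _ _ _ _ (by decide), fn 3 (by decide) (by decide)]
      have e4 : (τ.setN 21 0 0 j).real 4 = σ.real 4 := fr 4 (by decide)
      rw [← Exits.congr e3 e4]
      rw [← Exits.congr e3 e4] at i1
      refine armRow_spec (h.loop (by decide) (by norm_num) fn fr) hj (by simp) ?_
        (i1.setN (by decide) (by decide))
      simp [fn 24 (by decide) (by decide), e24])
  rw [e]
  exact i1.setN (by decide) (by decide)

/-- Connect the root to label `24`. -/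
def arm : Code :=
  .seq (.nset 8 (.const 0) (.const 0) (.const 0)) (.seq (.rep 21 (.rep 22 armTest))
    (.cond (natEq (nv 8) (.const 1)) traceArm .skip))

/-- A table value below `B` is the test for lying in the component of the root. If the search finds
no edge to the label, the label is not adjacent and the empty arm will do. -/
theorem arm_spec {s : ℕ → ℕ} {v l : ℕ} {P : ℕ → ℕ → ℝ} {pr : ℕ → ℕ → ℕ}
    (h : Env n k a w B D σ) (hG : WG n (adjRel a) w) (hB : Huge n (adjRel a) w B) (hD : 0 ≤ D)
    (hP : BF n (same (adjRel a) s) w (· = v) B P pr) (hv : v < n) (hsv : s v = 0)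
    (e4 : σ.real 4 = P) (e6 : σ.nat 6 = pr) (es : lab σ = s) (e24 : σ.nat 24 0 0 = l) :
    ∃ Q M, Arm n (adjRel a) w D s v (P n) (l + 1) Q M ∧
      (∀ x, marked (den ω arm σ) 5 x ↔ marked σ 5 x ∨ Q x) ∧
      (∀ x, marked (den ω arm σ) 4 x ↔ marked σ 4 x ∨ M x) := by
  have hB' : Huge n (same (adjRel a) s) w B := hB.mono fun _ _ h => h.1
  have hG' := hG.same s
  have h₀ : Env n k a w B D (σ.setN 8 0 0 0) := h.setN _ _ _ _ (by norm_num)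
  have hf := armSearch_spec (ω := ω) (l := l) h₀ (by simp) (by simpa using e24)
  have h₁ : Env n k a w B D (den ω (.rep 21 (.rep 22 armTest)) (σ.setN 8 0 0 0)) :=
    h₀.den (by decide)
  have f4 : (den ω (.rep 21 (.rep 22 armTest)) (σ.setN 8 0 0 0)).real 4 = P := by
    rw [den_real _ _ (by decide), State.setN_real, e4]
  have f6 : (den ω (.rep 21 (.rep 22 armTest)) (σ.setN 8 0 0 0)).nat 6 = pr := by
    rw [den_nat _ _ (by decide), State.setN_nat_ne _ _ _ _ _ (by decide), e6]
  have g5 : ∀ x, marked (den ω (.rep 21 (.rep 22 armTest)) (σ.setN 8 0 0 0)) 5 x ↔ marked σ 5 x := by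
    intro x
    unfold marked
    rw [den_nat _ _ (by decide), State.setN_nat_ne _ _ _ _ _ (by decide)]
  have g4 : ∀ x, marked (den ω (.rep 21 (.rep 22 armTest)) (σ.setN 8 0 0 0)) 4 x ↔ marked σ 4 x := by
    intro x
    unfold marked
    rw [den_nat _ _ (by decide), State.setN_nat_ne _ _ _ _ _ (by decide)]
  have hE : Exits n a B (l + 1) (σ.setN 8 0 0 0) =
      fun y z => s y = 0 ∧ P n y < B ∧ adjRel a y z ∧ s z = l + 1 := by
    rw [Exits.congr (σ := σ) (State.setN_nat_ne _ _ _ _ _ (by decide)) rfl]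
    unfold Exits
    rw [es, e4]
  rw [hE] at hf
  simp only [arm, den.eq_1, den.eq_2, den.eq_5, den.eq_6, NExpr.eval]
  generalize den ω (.rep 21 (.rep 22 armTest)) (σ.setN 8 0 0 0) = σ₁ at *
  rcases hf with ⟨hf, hno⟩ | ⟨hf, hlt, z, z1, z2, z3, z4⟩
  · rw [if_neg (by simp [hf])]
    refine ⟨_, _, Arm.empty ?_, by simpa using g5, by simpa using g4⟩
    rintro ⟨-, y, r, z, p, hyz, hz⟩
    refine hno y z (hG.lt hyz) ⟨p.same_label.symm.trans hsv, ?_, hyz, hz⟩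
    exact (hP.le_path hG' hB' hv rfl p).2
  · rw [if_pos (by simp [hf])]
    obtain ⟨Q, M, ld, h1, h2, h3, h4⟩ := traceArm_spec (ω := ω) h₁ hG hB hD hP f4 f6 hlt z2 rfl
    obtain ⟨x, hx, rfl, p⟩ := hP.path hG' le_rfl hlt z2
    refine ⟨Q, M, h1.arm ⟨by omega, _, _, _, p, z3, z4⟩ h2 z3 z4, fun x => ?_, fun x => ?_⟩
    · rw [h3, g5]
    · rw [h4, g4]

theorem arms_spec {s : ℕ → ℕ} {v : ℕ} {P : ℕ → ℕ → ℝ} {pr : ℕ → ℕ → ℕ}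
    (h : Env n k a w B D σ) (hG : WG n (adjRel a) w) (hB : Huge n (adjRel a) w B) (hD : 0 ≤ D)
    (hP : BF n (same (adjRel a) s) w (· = v) B P pr) (hv : v < n) (hsv : s v = 0)
    (e4 : σ.real 4 = P) (e6 : σ.nat 6 = pr) (es : lab σ = s) :
    ∃ Q M : ℕ → ℕ → Prop, (∀ j < n, Arm n (adjRel a) w D s v (P n) (j + 1) (Q j) (M j)) ∧
      (∀ x, marked (den ω (.rep 24 arm) σ) 5 x ↔ marked σ 5 x ∨ ∃ j < n, Q j x) ∧
      (∀ x, marked (den ω (.rep 24 arm) σ) 4 x ↔ marked σ 4 x ∨ ∃ j < n, M j x) := by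
  obtain ⟨τ, ⟨Q, M, i1, i2, i3⟩, e⟩ := rep_rule (ω := ω) 24 arm σ n h.size
    (fun m τ => ∃ Q M : ℕ → ℕ → Prop,
      (∀ j < m, Arm n (adjRel a) w D s v (P n) (j + 1) (Q j) (M j)) ∧
      (∀ x, marked τ 5 x ↔ marked σ 5 x ∨ ∃ j < m, Q j x) ∧
      (∀ x, marked τ 4 x ↔ marked σ 4 x ∨ ∃ j < m, M j x))
    ⟨fun _ _ => False, fun _ _ => False, by simp⟩
    (fun m hm τ fn fr ⟨Q, M, i1, i2, i3⟩ => by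
      obtain ⟨Q', M', h1, h2, h3⟩ := arm_spec (ω := ω) (σ := τ.setN 24 0 0 m) (l := m)
        (h.loop (by decide) (by norm_num) fn fr) hG hB hD hP hv hsv
        (by rw [State.setN_real, fr 4 (by decide), e4])
        (by rw [State.setN_nat_ne _ _ _ _ _ (by decide), fn 6 (by decide) (by decide), e6])
        (by unfold lab; rw [State.setN_nat_ne _ _ _ _ _ (by decide), fn 3 (by decide) (by decide)]
            exact es)
        (by simp)
      have key : ∀ (R : ℕ → ℕ → Prop) (R' : ℕ → Prop) x,
          ((∃ j < m, R j x) ∨ R' x) ↔ ∃ j < m + 1, (if j = m then R' else R j) x := by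
        intro R R' x
        constructor
        · rintro (⟨j, hj, hR⟩ | hR)
          · exact ⟨j, by omega, by rwa [if_neg (by omega)]⟩
          · exact ⟨m, by omega, by rwa [if_pos rfl]⟩
        · rintro ⟨j, hj, hR⟩
          by_cases e : j = m
          · rw [if_pos e] at hR; exact .inr hR
          · rw [if_neg e] at hR; exact .inl ⟨j, by omega, hR⟩
      refine ⟨fun j => if j = m then Q' else Q j, fun j => if j = m then M' else M j,
        fun j hj => ?_, fun x => ?_, fun x => ?_⟩
      · by_cases e : j = m
        · subst e; simpa using h1
        · simpa [e] using i1 j (by omega)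
      · rw [h2, marked_setN_ne (by decide), i2, or_assoc, key]
      · rw [h3, marked_setN_ne (by decide), i3, or_assoc, key])
  refine ⟨Q, M, i1, fun x => ?_, fun x => ?_⟩
  · rw [e, marked_setN_ne (by decide), i2]
  · rw [e, marked_setN_ne (by decide), i3]

/-- Clear the marks. -/
def clear : Code := .nset 5 (nv 21) (.const 0) (.const 0)

theorem clear_spec (hn : σ.nat 0 0 0 = n) : ∀ x < n, ¬ marked (den ω (.rep 21 clear) σ) 5 x := by
  obtain ⟨τ, i1, e⟩ := rep_rule (ω := ω) 21 clear σ n hn (fun m τ => ∀ x < m, ¬ marked τ 5 x)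
    (fun _ h => absurd h (by simp))
    (fun m hm τ fn fr i1 x hx => by
      have e : den ω clear (τ.setN 21 0 0 m) = (τ.setN 21 0 0 m).setN 5 m 0 0 := by
        simp [clear, den]
      rw [e]
      rcases Nat.lt_or_eq_of_le (Nat.le_of_lt_succ hx) with h | rfl
      · simpa [marked, h.ne] using i1 x h
      · simp [marked])
  intro x hx
  rw [e, marked_setN_ne (by decide)]
  exact i1 x hx

/-- Distances to vertex `b`. -/
def single (b : ℕ) : Code :=
  .seq (.rep 21 clear) (.seq (.nset 5 (nv b) (.const 0) (.const 1)) bellmanFord)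

theorem clear_mark_spec (hn : σ.nat 0 0 0 = n) {b v : ℕ} (hb : σ.nat b 0 0 = v) (h21 : b ≠ 21)
    (h5 : b ≠ 5) : ∀ x < n, (marked (den ω (.nset 5 (nv b) (.const 0) (.const 1))
      (den ω (.rep 21 clear) σ)) 5 x ↔ x = v) := by
  intro x hx
  have e : (den ω (.rep 21 clear) σ).nat b = σ.nat b := den_nat _ _ (by simp [nwrites, clear, h21, h5])
  simp [den.eq_2, e, hb, clear_spec hn x hx]

theorem single_spec (h : Env n k a w B D σ) {b v : ℕ} (hb : σ.nat b 0 0 = v) (h21 : b ≠ 21)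
    (h5 : b ≠ 5) :
    BF n (same (adjRel a) (lab σ)) w (· = v) B ((Code.den ω (single b) σ).real 4)
      ((Code.den ω (single b) σ).nat 6) := by
  have h₁ : Env n k a w B D (den ω (.nset 5 (nv b) (.const 0) (.const 1))
      (den ω (.rep 21 clear) σ)) := (h.den (by decide)).den (by simp [Keeps, nwrites, rwrites])
  have := h₁.bellmanFord (ω := ω)
  have e : lab (den ω (.nset 5 (nv b) (.const 0) (.const 1)) (den ω (.rep 21 clear) σ)) = lab σ := by
    unfold lab; rw [den_nat _ _ (by simp [nwrites]), den_nat _ _ (by decide)]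
  rw [e] at this
  exact this.congr fun y hy => (clear_mark_spec h.size hb h21 h5 y hy).symm

/-- Compute the skeleton of the supernode with root `20`, and the distances to it. -/
def prepare : Code :=
  .seq (single 20) (.seq (.nset 4 (nv 20) (.const 0) (.const 1)) (.seq (.rep 24 arm) bellmanFord))

/-- The first run of Bellman–Ford has the root as its only source and yields the shortest paths. The
marks that tracing adds turn array `5` into the skeleton, which is the source set of the second run.
-/
theorem prepare_spec {t : ℕ} (h : Env n k a w B D σ) (hG : WG n (adjRel a) w)
    (hB : Huge n (adjRel a) w B) (hD : 0 < D) (hm : NoMinor n (adjRel a) w k)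
    (hI : CopInv n (adjRel a) w D k t (lab σ) (marked σ 4)) (ht : t < n) (e20 : σ.nat 20 0 0 = t)
    (hs : lab σ t = 0) :
    ∃ T, BF n (same (adjRel a) (lab σ)) w T B ((den ω prepare σ).real 4) ((den ω prepare σ).nat 6) ∧
      Skel n (adjRel a) w D k (lab σ) t T (marked σ 4) (marked (den ω prepare σ) 4) := by
  have hP := single_spec (ω := ω) h e20 (by decide) (by decide)
  have h₁ : Env n k a w B D (den ω (single 20) σ) := h.den (by decide)
  have e₁ : (den ω (single 20) σ).nat 20 = σ.nat 20 := den_nat _ _ (by decide)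
  have g3 : (den ω (single 20) σ).nat 3 = σ.nat 3 := den_nat _ _ (by decide)
  have g4 : (den ω (single 20) σ).nat 4 = σ.nat 4 := den_nat _ _ (by decide)
  have g5 : ∀ x < n, (marked (den ω (single 20) σ) 5 x ↔ x = t) := fun x hx => by
    refine Iff.trans ?_ (clear_mark_spec (ω := ω) h.size e20 (by decide) (by decide) x hx)
    simp only [single, den.eq_5, marked]
    rw [den_nat bellmanFord _ (by decide)]
  have e₂ : den ω prepare σ = den ω bellmanFord (den ω (.rep 24 arm)
      ((den ω (single 20) σ).setN 4 t 0 1)) := by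
    simp [prepare, den.eq_5, den.eq_2, e₁, e20]
  rw [e₂]
  generalize den ω (single 20) σ = σ₁ at *
  obtain ⟨Q, M, h1, h2, h3⟩ := arms_spec (ω := ω) (σ := σ₁.setN 4 t 0 1)
    (h₁.setN _ _ _ _ (by norm_num)) hG hB hD.le hP ht hs rfl
    (State.setN_nat_ne _ _ _ _ _ (by decide))
    (by unfold lab; rw [State.setN_nat_ne _ _ _ _ _ (by decide), g3])
  have hE : Env n k a w B D (den ω (.rep 24 arm) (σ₁.setN 4 t 0 1)) :=
    (h₁.setN _ _ _ _ (by norm_num)).den (by decide)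
  have hS := hI.skel hG (hB.mono (fun _ _ h => h)) hD hm ht.le ht hs hP h1
  have e : lab (den ω (.rep 24 arm) (σ₁.setN 4 t 0 1)) = lab σ := by
    unfold lab
    rw [den_nat _ _ (by decide), State.setN_nat_ne _ _ _ _ _ (by decide), g3]
  have hBF := hE.bellmanFord (ω := ω)
  rw [e] at hBF
  refine ⟨fun y => y = t ∨ ∃ j < n, Q j y, hBF.congr fun y hy => ?_, ?_⟩
  · rw [h2, marked_setN_ne (by decide), g5 y hy]
  · convert hS using 1
    funext x
    unfold marked at h3 ⊢
    rw [den_nat bellmanFord _ (by decide), h3]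
    have := @marked_setN_one σ₁ 4 t x
    unfold marked at this
    rw [this, g4]
    exact propext (by tauto)

/-- `3 k`. -/
def threeK : RExpr := .mul (.ofNat (.const 3)) (.ofNat (.get 0 (.const 0) (.const 1)))

/-- `exp (-3 k)`. -/
def minY : RExpr := .exp (.sub (.ofNat (.const 0)) threeK)

/-- Assign vertex `21` to the supernode with root `20` if it is close enough to the skeleton. -/
def capture : Code :=
  .cond (.and (natEq (.get 3 (nv 21) (.const 0)) (.const 0))
      (.rle (.add minY (.mul (.sub (.ofNat (.const 1)) minY) (rv 6)))
        (.exp (.sub (.ofNat (.const 0)) (.mul (.div threeK (rv 3)) (.get 4 (nv 0) (nv 21)))))))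
    (.nset 3 (nv 21) (.const 0) (.add (nv 20) (.const 1))) .skip

theorem capture_spec {t : ℕ} (h : Env n k a w B D σ) (e20 : σ.nat 20 0 0 = t)
    {U : unitInterval} (hU : σ.real 6 0 0 = U) :
    lab (den ω (.rep 21 capture) σ) = relabel n (lab σ) (σ.real 4 n) (3 * k / D)
      (unif (Real.exp (-(3 * k))) U) t := by
  obtain ⟨τ, i1, e⟩ := rep_rule (ω := ω) 21 capture σ n h.size
    (fun m τ => ∀ x, lab τ x = if x < m then relabel n (lab σ) (σ.real 4 n) (3 * k / D)
      (unif (Real.exp (-(3 * k))) U) t x else lab σ x)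
    (fun x => by simp)
    (fun m hm τ fn fr i1 x => by
      have hE : Env n k a w B D (τ.setN 21 0 0 m) := h.loop (by decide) (by norm_num) fn fr
      have hn0 : τ.nat 0 0 0 = n := by simpa using hE.size
      have hk0 : τ.nat 0 0 1 = k := by simpa using hE.param
      have hs0 : τ.real 3 0 0 = D := hE.scale
      have f4 : τ.real 4 = σ.real 4 := fr 4 (by decide)
      have f6 : τ.real 6 = σ.real 6 := fr 6 (by decide)
      have f20 : τ.nat 20 0 0 = t := by rw [fn 20 (by decide) (by decide), e20]
      have hl : τ.nat 3 m 0 = lab σ m := by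
        have := i1 m
        rwa [if_neg (lt_irrefl _)] at this
      by_cases hc : Cap n (lab σ) (σ.real 4 n) (3 * k / D)
          (unif (Real.exp (-(3 * k))) U) m
      · have e : den ω capture (τ.setN 21 0 0 m) = (τ.setN 21 0 0 m).setN 3 m 0 (t + 1) := by
          obtain ⟨-, c1, c2⟩ := hc
          unfold unif at c2
          simp [capture, den, minY, threeK, hn0, hk0, hs0, f4, f6, f20, hl, hU, c1, c2]
        rw [e]
        by_cases hx : x = m
        · subst hx
          simp [lab, relabel, hc]
        · have : x < m + 1 ↔ x < m := by omega
          simp only [this, ← i1 x]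
          simp [lab, hx]
      · have e : den ω capture (τ.setN 21 0 0 m) = τ.setN 21 0 0 m := by
          simp only [capture, den]
          rw [if_neg]
          contrapose! hc
          simp [minY, threeK, hn0, hk0, hs0, f4, f6, hl, hU] at hc
          exact ⟨hm, hc.1, by unfold unif; exact hc.2⟩
        rw [e]
        by_cases hx : x = m
        · subst hx
          simp [lab, relabel, hc]
          exact hl
        · have : x < m + 1 ↔ x < m := by omega
          simp only [this, ← i1 x]
          simp [lab])
  rw [e]
  funext x
  have h1 := i1 x
  have h2 : lab (τ.setN 21 0 0 n) x = lab τ x := by simp [lab]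
  rw [h2, h1]
  split_ifs with hx
  · rfl
  · have : ¬ Cap n (lab σ) (σ.real 4 n) (3 * k / D)
        (unif (Real.exp (-(3 * k))) U) x := fun hc => hx hc.1
    rw [relabel, if_neg this]

/-- The part of an iteration that precedes the choice of a random number. -/
def copDet : Code := .cond (natEq (.get 3 (nv 20) (.const 0)) (.const 0)) prepare .skip

/-- The part of an iteration that follows the choice of a random number. -/
def copCut : Code :=
  .cond (natEq (.get 3 (nv 20) (.const 0)) (.const 0)) (.rep 21 capture) .skip

/-- One iteration of the construction of supernodes. -/
def copStep : Code := .seq copDet (.seq (.sample 6 (.const 0) (.const 0)) copCut)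

/-- A coin is drawn even if the root is already assigned. Thus coin `t` always belongs to iteration
`t`. -/
theorem copStep_skip {t : ℕ} (e20 : σ.nat 20 0 0 = t) (hs : lab σ t ≠ 0) :
    den ω copStep σ = σ.draw 6 0 0 (ω σ.drawn) := by
  unfold lab at hs
  simp [copStep, copDet, copCut, den.eq_5, den.eq_6, den.eq_4, den.eq_1, e20, hs]

theorem copStep_spec {t : ℕ} (h : Env n k a w B D σ) (hG : WG n (adjRel a) w)
    (hB : Huge n (adjRel a) w B) (hD : 0 < D) (hm : NoMinor n (adjRel a) w k)
    (hI : CopInv n (adjRel a) w D k t (lab σ) (marked σ 4)) (ht : t < n) (e20 : σ.nat 20 0 0 = t)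
    (hs : lab σ t = 0) :
    ∃ T N' P pr, BF n (same (adjRel a) (lab σ)) w T B P pr ∧
      Skel n (adjRel a) w D k (lab σ) t T (marked σ 4) N' ∧ ∀ ω,
        lab (den ω copStep σ) = relabel n (lab σ) (P n) (3 * k / D)
          (unif (Real.exp (-(3 * k))) (ω σ.drawn)) t ∧ marked (den ω copStep σ) 4 = N' := by
  -- The preparation draws no coins, so the skeleton and distances found with an arbitrary coin
  -- sequence serve for all `ω`.
  obtain ⟨T, h1, h2⟩ := prepare_spec (ω := fun _ => 0) h hG hB hD hm hI ht e20 hs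
  refine ⟨T, _, _, _, h1, h2, fun ω => ?_⟩
  have hdet : prepare.Det := by simp [prepare, single, clear, bellmanFord, bfInit, bfEntry, relaxAll,
    relaxEdge, arm, armTest, traceArm, traceStep, Det]
  rw [den_det (ω := fun _ => 0) (ω' := ω) prepare hdet]
  have f3 : (den ω prepare σ).nat 3 = σ.nat 3 := den_nat _ _ (by decide)
  have f20 : (den ω prepare σ).nat 20 = σ.nat 20 := den_nat _ _ (by decide)
  have hdr := den_drawn (ω := ω) prepare hdet σ
  have hE : Env n k a w B D (den ω prepare σ) := h.den (by decide)
  have e : den ω copStep σ =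
      den ω (.rep 21 capture) ((den ω prepare σ).draw 6 0 0 (ω (den ω prepare σ).drawn)) := by
    unfold lab at hs
    simp [copStep, copDet, copCut, den.eq_5, den.eq_6, den.eq_4, e20, hs, f3, f20]
  rw [e, hdr]
  have hE' : Env n k a w B D ((den ω prepare σ).draw 6 0 0 (ω σ.drawn)) :=
    hE.congr rfl rfl (State.draw_real_ne _ _ _ _ _ (by decide))
      (State.draw_real_ne _ _ _ _ _ (by decide)) (State.draw_real_ne _ _ _ _ _ (by decide))
  have hl : lab ((den ω prepare σ).draw 6 0 0 (ω σ.drawn)) = lab σ := by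
    unfold lab; rw [State.draw_nat, f3]
  constructor
  · rw [capture_spec hE' (t := t) (by rw [State.draw_nat, f20, e20])
      (U := ω σ.drawn) (by simp), hl, State.draw_real_ne _ _ _ _ _ (by decide)]
  · funext x
    unfold marked
    rw [den_nat _ _ (by decide), State.draw_nat]

end Code

end RealRAM

namespace LDD

theorem APSP.of_rows {n : ℕ} {A : ℕ → ℕ → Prop} {w : ℕ → ℕ → ℝ} {B : ℝ} {d : ℕ → ℕ → ℝ}
    (hG : WG n A w) (hB : Huge n A w B)
    (h : ∀ c < n, ∃ P pr, BF n A w (· = c) B P pr ∧ ∀ y < n, d c y = P n y) : APSP n A w B d where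
  path c hc x hx hd := by
    obtain ⟨P, pr, hP, e⟩ := h c hc
    rw [e x hx] at hd ⊢
    obtain ⟨_, -, rfl, p⟩ := hP.path hG le_rfl hx hd
    exact p
  le c hc x r p := by
    obtain ⟨P, pr, hP, e⟩ := h c hc
    rw [e x (p.lt_of_lt hG hc)]
    exact hP.le_path hG hB hc rfl p
  le_B c hc x hx := by
    obtain ⟨P, pr, hP, e⟩ := h c hc
    rw [e x hx]
    exact hP.le_B hB.pos le_rfl hx
  nonneg c hc x hx := by
    obtain ⟨P, pr, hP, e⟩ := h c hc
    rw [e x hx]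
    exact hP.nonneg hG hB.pos le_rfl hx
  le_add c hc x hx y r p := by
    obtain ⟨P, pr, hP, e⟩ := h c hc
    rw [e x hx, e y (p.lt_of_lt hG hx)]
    exact hP.le_add hG hB hx p

end LDD

/-! ### Programs for the clustering around centers. -/

namespace RealRAM

namespace Code

open LDD

variable {ω : ℕ → unitInterval} {n k : ℕ} {a : ℕ → ℕ → ℕ} {w : ℕ → ℕ → ℝ} {B D : ℝ} {σ τ : State}

/-- Copy the distance of vertex `21` to row `26` of the distance matrix. -/
def copyEntry : Code := .rset 5 (nv 26) (nv 21) (.get 4 (nv 0) (nv 21))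

/-- Compute the distances between all pairs of vertices. -/
def allPairs : Code := .rep 26 (.seq (single 26) (.rep 21 copyEntry))

theorem copy_spec (hn : σ.nat 0 0 0 = n) {c : ℕ} (hc : σ.nat 26 0 0 = c) :
    (∀ y < n, (den ω (.rep 21 copyEntry) σ).real 5 c y = σ.real 4 n y) ∧
      ∀ i, i ≠ c → (den ω (.rep 21 copyEntry) σ).real 5 i = σ.real 5 i := by
  obtain ⟨τ, ⟨i1, i2⟩, e⟩ := rep_rule (ω := ω) 21 copyEntry σ n hn
    (fun m τ => (∀ y < m, τ.real 5 c y = σ.real 4 n y) ∧ ∀ i, i ≠ c → τ.real 5 i = σ.real 5 i)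
    ⟨fun _ h => absurd h (by simp), fun _ _ => rfl⟩
    (fun m hm τ fn fr ⟨i1, i2⟩ => by
      have e : den ω copyEntry (τ.setN 21 0 0 m) =
          (τ.setN 21 0 0 m).setR 5 c m (σ.real 4 n m) := by
        simp [copyEntry, den, fn 26 (by decide) (by decide), hc, fr 4 (by decide),
          fn 0 (by decide) (by decide), hn]
      rw [e]
      refine ⟨fun y hy => ?_, fun i hi => ?_⟩
      · rcases Nat.lt_or_eq_of_le (Nat.le_of_lt_succ hy) with h | rfl
        · simp [h.ne, i1 y h]
        · simp
      · funext y
        simp [hi, i2 i hi])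
  rw [e]
  exact ⟨i1, i2⟩

theorem allPairs_spec (h : Env n k a w B D σ) (hG : WG n (adjRel a) w)
    (hB : Huge n (adjRel a) w B) :
    APSP n (same (adjRel a) (lab σ)) w B ((den ω allPairs σ).real 5) := by
  obtain ⟨τ, i1, e⟩ := rep_rule (ω := ω) 26 (.seq (single 26) (.rep 21 copyEntry)) σ n h.size
    (fun m τ => ∀ c < m, ∃ P pr, BF n (same (adjRel a) (lab σ)) w (· = c) B P pr ∧
      ∀ y < n, τ.real 5 c y = P n y) (fun _ h => absurd h (by simp))
    (fun m hm τ fn fr i1 c hc => by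
      have hE : Env n k a w B D (τ.setN 26 0 0 m) := h.loop (by decide) (by norm_num) fn fr
      have hl : lab (τ.setN 26 0 0 m) = lab σ := by
        unfold lab
        rw [State.setN_nat_ne _ _ _ _ _ (by decide), fn 3 (by decide) (by decide)]
      have hP := single_spec (ω := ω) hE (b := 26) (v := m) (by simp) (by decide) (by decide)
      have hE' : Env n k a w B D (den ω (single 26) (τ.setN 26 0 0 m)) := hE.den (by decide)
      have e26 : (den ω (single 26) (τ.setN 26 0 0 m)).nat 26 0 0 = m := by
        rw [den_nat _ _ (by decide)]; simp
      have e5 : (den ω (single 26) (τ.setN 26 0 0 m)).real 5 = τ.real 5 :=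
        den_real _ _ (by decide)
      obtain ⟨h1, h2⟩ := copy_spec (ω := ω) hE'.size e26
      rw [hl] at hP
      rw [den.eq_5]
      rcases Nat.lt_or_eq_of_le (Nat.le_of_lt_succ hc) with h' | rfl
      · obtain ⟨P, pr, g1, g2⟩ := i1 c h'
        exact ⟨P, pr, g1, fun y hy => by rw [h2 c h'.ne, e5, g2 y hy]⟩
      · exact ⟨_, _, hP, h1⟩)
  rw [allPairs, e]
  exact APSP.of_rows (hG.same _) (hB.mono fun _ _ h => h.1) i1

/-- Count center `26` if it is close to vertex `21`. -/
def countCenter : Code :=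
  .cond (.and (natEq (.get 4 (nv 26) (.const 0)) (.const 1))
      (.rle (.get 5 (nv 26) (nv 21)) (.mul (.ofNat (.const 3)) (rv 3))))
    (.nset 9 (.const 0) (.const 0) (.add (nv 9) (.const 1))) .skip

/-- Count the centers that are close to vertex `21`. -/
def countCenters : Code :=
  .seq (.nset 9 (.const 0) (.const 0) (.const 0)) (.seq (.rep 26 countCenter)
    (.cond (.nle (nv 9) (nv 10)) .skip (.nset 10 (.const 0) (.const 0) (nv 9))))

/-- The maximal number of centers that are close to a vertex. -/
def maxCount : Code := .seq (.nset 10 (.const 0) (.const 0) (.const 0)) (.rep 21 countCenters)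

open Classical in
/-- The number of centers that are close to vertex `u`. -/
noncomputable def nearCenters (n : ℕ) (N : ℕ → Prop) (d : ℕ → ℕ → ℝ) (D : ℝ) (u : ℕ) : ℕ :=
  ((Finset.range n).filter fun c => N c ∧ d c u ≤ 3 * D).card

theorem countCenter_spec (h : Env n k a w B D σ) {u : ℕ} (e21 : σ.nat 21 0 0 = u)
    (e9 : σ.nat 9 0 0 = 0) : (den ω (.rep 26 countCenter) σ).nat 9 0 0 =
      nearCenters n (marked σ 4) (σ.real 5) D u := by
  classical
  obtain ⟨τ, i1, e⟩ := rep_rule (ω := ω) 26 countCenter σ n h.size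
    (fun m τ => τ.nat 9 0 0 = nearCenters m (marked σ 4) (σ.real 5) D u)
    (by simp [nearCenters, e9])
    (fun m hm τ fn fr i1 => by
      have hE : Env n k a w B D (τ.setN 26 0 0 m) := h.loop (by decide) (by norm_num) fn fr
      have hs0 : τ.real 3 0 0 = D := hE.scale
      have f4 : τ.nat 4 = σ.nat 4 := fn 4 (by decide) (by decide)
      have f5 : τ.real 5 = σ.real 5 := fr 5 (by decide)
      have f21 : τ.nat 21 0 0 = u := by rw [fn 21 (by decide) (by decide), e21]
      have key : nearCenters (m + 1) (marked σ 4) (σ.real 5) D u =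
          nearCenters m (marked σ 4) (σ.real 5) D u +
            if marked σ 4 m ∧ σ.real 5 m u ≤ 3 * D then 1 else 0 := by
        unfold nearCenters
        rw [Finset.range_add_one, Finset.filter_insert]
        split_ifs
        · rw [Finset.card_insert_of_notMem (by simp)]
        · rfl
      rw [key]
      by_cases hc : marked σ 4 m ∧ σ.real 5 m u ≤ 3 * D
      · rw [if_pos hc]
        unfold marked at hc
        simp [countCenter, den, hs0, f4, f5, f21, hc, i1]
      · rw [if_neg hc]
        have e : den ω countCenter (τ.setN 26 0 0 m) = τ.setN 26 0 0 m := by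
          simp only [countCenter, den]
          rw [if_neg]
          unfold marked at hc
          simpa [hs0, f4, f5, f21] using hc
        rw [e]
        simpa using i1)
  rw [e]
  simpa using i1

/-- The maximum must dominate the number of near centers at every vertex. That it is attained, or
zero, lets a bound on these numbers carry over to it. -/
theorem maxCount_spec (h : Env n k a w B D σ) :
    (∀ u < n, nearCenters n (marked σ 4) (σ.real 5) D u ≤ (den ω maxCount σ).nat 10 0 0) ∧
      ((den ω maxCount σ).nat 10 0 0 = 0 ∨ ∃ u < n,
        (den ω maxCount σ).nat 10 0 0 = nearCenters n (marked σ 4) (σ.real 5) D u) := by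
  have h₀ : Env n k a w B D (σ.setN 10 0 0 0) := h.setN _ _ _ _ (by norm_num)
  obtain ⟨τ, ⟨i1, i2⟩, e⟩ := rep_rule (ω := ω) 21 countCenters (σ.setN 10 0 0 0) n h₀.size
    (fun m τ => (∀ u < m, nearCenters n (marked σ 4) (σ.real 5) D u ≤ τ.nat 10 0 0) ∧
      (τ.nat 10 0 0 = 0 ∨ ∃ u < n, τ.nat 10 0 0 = nearCenters n (marked σ 4) (σ.real 5) D u))
    ⟨fun _ h => absurd h (by simp), .inl (by simp)⟩
    (fun m hm τ fn fr ⟨i1, i2⟩ => by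
      have hE : Env n k a w B D ((τ.setN 21 0 0 m).setN 9 0 0 0) :=
        (h₀.loop (by decide) (by norm_num) fn fr).setN _ _ _ _ (by norm_num)
      have h1 := countCenter_spec (ω := ω) hE (u := m) (by simp) (by simp)
      have e4 : marked ((τ.setN 21 0 0 m).setN 9 0 0 0) 4 = marked σ 4 := by
        unfold marked
        rw [State.setN_nat_ne _ _ _ _ _ (by decide), State.setN_nat_ne _ _ _ _ _ (by decide),
          fn 4 (by decide) (by decide), State.setN_nat_ne _ _ _ _ _ (by decide)]
      have e5 : ((τ.setN 21 0 0 m).setN 9 0 0 0).real 5 = σ.real 5 := fr 5 (by decide)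
      have e10 : (den ω (.rep 26 countCenter) ((τ.setN 21 0 0 m).setN 9 0 0 0)).nat 10 =
          τ.nat 10 := by
        rw [den_nat _ _ (by decide), State.setN_nat_ne _ _ _ _ _ (by decide),
          State.setN_nat_ne _ _ _ _ _ (by decide)]
      rw [e4, e5] at h1
      simp only [countCenters, den.eq_5, den.eq_2, den.eq_6, den.eq_1, NExpr.eval, BExpr.eval]
      generalize den ω (.rep 26 countCenter) ((τ.setN 21 0 0 m).setN 9 0 0 0) = τ' at *
      rw [h1, e10]
      split_ifs with hb
      · rw [e10]
        refine ⟨fun u hu => ?_, i2⟩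
        rcases Nat.lt_or_eq_of_le (Nat.le_of_lt_succ hu) with h | rfl
        exacts [i1 u h, hb]
      · simp only [State.setN_nat, true_and, if_true]
        refine ⟨fun u hu => ?_, .inr ⟨m, hm, rfl⟩⟩
        rcases Nat.lt_or_eq_of_le (Nat.le_of_lt_succ hu) with h | rfl
        exacts [(i1 u h).trans (by omega), le_rfl])
  have e' : (den ω maxCount σ).nat 10 0 0 = τ.nat 10 0 0 := by
    have : den ω maxCount σ = den ω (.rep 21 countCenters) (σ.setN 10 0 0 0) := by
      simp [maxCount, den.eq_5, den.eq_2]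
    rw [this, e]; simp
  rw [e']
  exact ⟨i1, i2⟩

/-- Draw a random number for each vertex. -/
def sampleAll : Code := .rep 27 (.sample 8 (nv 27) (.const 0))

theorem sampleAll_spec (hn : σ.nat 0 0 0 = n) :
    ∀ i < n, (den ω sampleAll σ).real 8 i 0 = ω (σ.drawn + i) := by
  obtain ⟨τ, ⟨i1, -⟩, e⟩ := rep_rule (ω := ω) 27 (.sample 8 (nv 27) (.const 0)) σ n hn
    (fun m τ => (∀ i < m, τ.real 8 i 0 = ω (σ.drawn + i)) ∧ τ.drawn = σ.drawn + m)
    ⟨fun _ h => absurd h (by simp), rfl⟩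
    (fun m hm τ fn fr ⟨i1, i2⟩ => by
      simp only [den, NExpr.eval, State.draw_drawn, State.setN_drawn]
      refine ⟨fun i hi => ?_, by omega⟩
      rcases Nat.lt_or_eq_of_le (Nat.le_of_lt_succ hi) with h | rfl
      · simp [h.ne, i1 i h]
      · simp [i2])
  rw [sampleAll, e]
  exact i1

/-- The rate of the exponential distribution. -/
def rate : RExpr := .div (.log (.add (.ofNat (nv 10)) (.ofNat (.const 1)))) (rv 3)

/-- The lower end of the truncated distribution. -/
def lowest : RExpr := .div (.ofNat (.const 1)) (.add (.ofNat (nv 10)) (.ofNat (.const 1)))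

/-- The scaled distance of vertex `21` from center `26`. -/
def scaled : RExpr :=
  .mul (.add lowest (.mul (.sub (.ofNat (.const 1)) lowest) (.get 8 (nv 26) (.const 0))))
    (.exp (.mul rate (.get 5 (nv 26) (nv 21))))

/-- Assign vertex `21` to center `26` if this is the best choice so far. -/
def tryCenter : Code :=
  .cond (.and (natEq (.get 4 (nv 26) (.const 0)) (.const 1)) (rlt scaled (rv 11)))
    (.seq (.rset 11 (.const 0) (.const 0) scaled) (.nset 2 (nv 21) (.const 0) (nv 26))) .skip

/-- Assign vertex `21` to the best center. -/
def bestCenter : Code :=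
  .seq (.rset 11 (.const 0) (.const 0)
    (.add (.exp (.mul rate (rv 2))) (.ofNat (.const 1)))) (.rep 26 tryCenter)

theorem tryCenter_spec (h : Env n k a w B D σ) {x tau : ℕ} {U : ℕ → unitInterval}
    (e21 : σ.nat 21 0 0 = x) (e10 : σ.nat 10 0 0 = tau) (e8 : ∀ i < n, σ.real 8 i 0 = U i)
    (hlt : ∀ c < n, marked σ 4 c → unif (1 / (tau + 1)) (U c) *
      Real.exp (Real.log (tau + 1) / D * σ.real 5 c x) < σ.real 11 0 0)
    (hex : ∃ c < n, marked σ 4 c) :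
    Top n (marked σ 4) (Real.log (tau + 1) / D) (fun i => unif (1 / (tau + 1)) (U i))
      (fun c => σ.real 5 c x) ((den ω (.rep 26 tryCenter) σ).nat 2 x 0) ∧
    ∀ y, y ≠ x → (den ω (.rep 26 tryCenter) σ).nat 2 y 0 = σ.nat 2 y 0 := by
  set val : ℕ → ℝ := fun c => unif (1 / (tau + 1)) (U c) *
      Real.exp (Real.log (tau + 1) / D * σ.real 5 c x) with hval
  obtain ⟨τ, ⟨i1, i2, i3⟩, e⟩ := rep_rule (ω := ω) 26 tryCenter σ n h.size
    (fun m τ => (∀ c < m, marked σ 4 c → τ.real 11 0 0 ≤ val c) ∧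
      (τ.real 11 0 0 = σ.real 11 0 0 ∨ (τ.nat 2 x 0 < n ∧ marked σ 4 (τ.nat 2 x 0) ∧
        τ.real 11 0 0 = val (τ.nat 2 x 0))) ∧ ∀ y, y ≠ x → τ.nat 2 y 0 = σ.nat 2 y 0)
    ⟨fun _ h => absurd h (by simp), .inl rfl, fun _ _ => rfl⟩
    (fun m hm τ fn fr ⟨i1, i2, i3⟩ => by
      have hE : Env n k a w B D (τ.setN 26 0 0 m) := h.loop (by decide) (by norm_num) fn fr
      have hs0 : τ.real 3 0 0 = D := hE.scale
      have f4 : τ.nat 4 = σ.nat 4 := fn 4 (by decide) (by decide)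
      have f5 : τ.real 5 = σ.real 5 := fr 5 (by decide)
      have f8 : τ.real 8 m 0 = U m := by rw [fr 8 (by decide), e8 m hm]
      have f10 : τ.nat 10 0 0 = tau := by rw [fn 10 (by decide) (by decide), e10]
      have f21 : τ.nat 21 0 0 = x := by rw [fn 21 (by decide) (by decide), e21]
      have ev : scaled.eval (τ.setN 26 0 0 m) = val m := by
        simp [scaled, rate, lowest, hs0, f5, f8, f10, f21, hval, unif]
      by_cases hc : marked σ 4 m ∧ val m < τ.real 11 0 0
      · have e : den ω tryCenter (τ.setN 26 0 0 m) =
            ((τ.setN 26 0 0 m).setR 11 0 0 (val m)).setN 2 x 0 m := by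
          unfold marked at hc
          simp [tryCenter, den, ev, f4, f21, hc]
        rw [e]
        refine ⟨fun c hc' hN => ?_, .inr ⟨?_, ?_, ?_⟩, fun y hy => ?_⟩
        · simp only [State.setN_real, State.setR_real]
          simp only [true_and, if_true]
          rcases Nat.lt_or_eq_of_le (Nat.le_of_lt_succ hc') with h | rfl
          exacts [hc.2.le.trans (i1 c h hN), le_rfl]
        · simpa using hm
        · simpa using hc.1
        · simp
        · simpa [hy] using i3 y hy
      · have e : den ω tryCenter (τ.setN 26 0 0 m) = τ.setN 26 0 0 m := by
          simp only [tryCenter, den]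
          rw [if_neg]
          unfold marked at hc
          simpa [f4, ev] using hc
        rw [e]
        refine ⟨fun c hc' hN => ?_, ?_, fun y hy => ?_⟩
        · rcases Nat.lt_or_eq_of_le (Nat.le_of_lt_succ hc') with h | rfl
          · exact i1 c h hN
          · push Not at hc
            exact hc hN
        · simpa using i2
        · simpa using i3 y hy)
  rw [e]
  refine ⟨?_, fun y hy => by simpa using i3 y hy⟩
  have e2 : (τ.setN 26 0 0 n).nat 2 x 0 = τ.nat 2 x 0 := by simp
  rw [e2]
  rcases i2 with i2 | ⟨j1, j2, j3⟩
  · obtain ⟨c, hc, hN⟩ := hex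
    have := i1 c hc hN
    have h2 := hlt c hc hN
    rw [i2] at this
    exact absurd h2 (not_lt.2 this)
  · refine ⟨j1, j2, fun c hc hN => ?_⟩
    have := i1 c hc hN
    rw [j3] at this
    exact this

/-- Assign all vertices to centers. -/
def assign : Code := .rep 21 bestCenter

theorem assign_spec (h : Env n k a w B D σ) (hD : 0 < D) {tau : ℕ} {U : ℕ → unitInterval}
    (e10 : σ.nat 10 0 0 = tau) (e8 : ∀ i < n, σ.real 8 i 0 = U i)
    (hdB : ∀ c < n, ∀ x < n, σ.real 5 c x ≤ B) (hex : ∃ c < n, marked σ 4 c) :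
    ∀ x < n, Top n (marked σ 4) (Real.log (tau + 1) / D) (fun i => unif (1 / (tau + 1)) (U i))
      (fun c => σ.real 5 c x) ((den ω assign σ).nat 2 x 0) := by
  have hlam : 0 ≤ Real.log (tau + 1) / D :=
    div_nonneg (Real.log_nonneg (by linarith [(Nat.cast_nonneg tau : (0 : ℝ) ≤ tau)])) hD.le
  obtain ⟨τ, i1, e⟩ := rep_rule (ω := ω) 21 bestCenter σ n h.size
    (fun m τ => ∀ x < m, Top n (marked σ 4) (Real.log (tau + 1) / D)
      (fun i => unif (1 / (tau + 1)) (U i)) (fun c => σ.real 5 c x) (τ.nat 2 x 0))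
    (fun _ h => absurd h (by simp))
    (fun m hm τ fn fr i1 x hx => by
      have hE : Env n k a w B D (τ.setN 21 0 0 m) := h.loop (by decide) (by norm_num) fn fr
      have hs0 : τ.real 3 0 0 = D := hE.scale
      have hb0 : τ.real 2 0 0 = B := hE.inf
      have f4 : τ.nat 4 = σ.nat 4 := fn 4 (by decide) (by decide)
      have f5 : τ.real 5 = σ.real 5 := fr 5 (by decide)
      have f8 : τ.real 8 = σ.real 8 := fr 8 (by decide)
      have f10 : τ.nat 10 0 0 = tau := by rw [fn 10 (by decide) (by decide), e10]
      -- The starting value exceeds every scaled distance, as distances are at most `B` and the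
      -- random factors at most `1`. So some center is always chosen.
      set τ' := (τ.setN 21 0 0 m).setR 11 0 0 (Real.exp (Real.log (tau + 1) / D * B) + 1) with hτ'
      have e : den ω bestCenter (τ.setN 21 0 0 m) = den ω (.rep 26 tryCenter) τ' := by
        simp [bestCenter, den.eq_5, den.eq_3, rate, hs0, hb0, f10, hτ']
      have m4 : marked τ' 4 = marked σ 4 := by
        funext c
        simp [hτ', marked, f4]
      have r5 : τ'.real 5 = σ.real 5 := by
        rw [hτ', State.setR_real_ne _ _ _ _ _ (by decide), State.setN_real, f5]
      obtain ⟨h1, h2⟩ := tryCenter_spec (ω := ω) (σ := τ') (x := m) (tau := tau) (U := U)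
        (hE.setR _ _ _ _ (by norm_num)) (by simp [hτ']) (by simp [hτ', f10])
        (fun i hi => by simp [hτ', f8, e8 i hi])
        (fun c hc hN => by
          have u1 : unif (1 / (tau + 1)) (U c) ≤ 1 := unif_le (by
            rw [div_le_one (by positivity)]; linarith [(Nat.cast_nonneg tau : (0 : ℝ) ≤ tau)]) _
          have u2 : Real.exp (Real.log (tau + 1) / D * τ'.real 5 c m) ≤
              Real.exp (Real.log (tau + 1) / D * B) := by
            rw [r5]
            exact Real.exp_le_exp.2 (mul_le_mul_of_nonneg_left (hdB c hc m hm) hlam)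
          have u3 := mul_le_mul_of_nonneg_right u1
            (Real.exp_pos (Real.log (tau + 1) / D * τ'.real 5 c m)).le
          have u4 : τ'.real 11 0 0 = Real.exp (Real.log (tau + 1) / D * B) + 1 := by simp [hτ']
          rw [u4]
          linarith)
        (by rw [m4]; exact hex)
      rw [e]
      rw [m4, r5] at h1
      rcases Nat.lt_or_eq_of_le (Nat.le_of_lt_succ hx) with h' | rfl
      · rw [h2 x h'.ne]
        simpa [hτ'] using i1 x h'
      · exact h1)
  intro x hx
  rw [assign, e]
  simpa using i1 x hx

/-- The part of the final clustering that precedes the choice of random numbers. -/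
def mpxDet : Code := .seq allPairs maxCount

/-- Cluster the label classes around the centers. -/
def mpx : Code := .seq mpxDet (.seq sampleAll assign)

theorem mpx_spec (h : Env n k a w B D σ) (hG : WG n (adjRel a) w) (hB : Huge n (adjRel a) w B)
    (hD : 0 < D) (hex : ∃ c < n, marked σ 4 c) :
    APSP n (same (adjRel a) (lab σ)) w B ((den ω mpxDet σ).real 5) ∧
    (∀ u < n, nearCenters n (marked σ 4) ((den ω mpxDet σ).real 5) D u ≤
      (den ω mpxDet σ).nat 10 0 0) ∧
    ((den ω mpxDet σ).nat 10 0 0 = 0 ∨ ∃ u < n, (den ω mpxDet σ).nat 10 0 0 =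
      nearCenters n (marked σ 4) ((den ω mpxDet σ).real 5) D u) ∧
    ∀ x < n, Top n (marked σ 4) (Real.log ((den ω mpxDet σ).nat 10 0 0 + 1) / D)
      (fun i => unif (1 / ((den ω mpxDet σ).nat 10 0 0 + 1)) (ω (σ.drawn + i)))
      (fun c => (den ω mpxDet σ).real 5 c x) ((den ω mpx σ).nat 2 x 0) := by
  have hE : Env n k a w B D (den ω allPairs σ) := h.den (by decide)
  have hE₁ : Env n k a w B D (den ω mpxDet σ) := h.den (by decide)
  have hE₂ : Env n k a w B D (den ω sampleAll (den ω mpxDet σ)) := hE₁.den (by decide)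
  have d5 : (den ω mpxDet σ).real 5 = (den ω allPairs σ).real 5 := by
    rw [mpxDet, den.eq_5, den_real _ _ (by decide)]
  have m4 : marked (den ω allPairs σ) 4 = marked σ 4 := by
    unfold marked; rw [den_nat _ _ (by decide)]
  have m4' : marked (den ω sampleAll (den ω mpxDet σ)) 4 = marked σ 4 := by
    unfold marked; rw [den_nat _ _ (by decide), den_nat _ _ (by decide)]
  have hd := allPairs_spec (ω := ω) h hG hB
  obtain ⟨h1, h2⟩ := maxCount_spec (ω := ω) hE
  rw [m4] at h1 h2
  have hdr : (den ω mpxDet σ).drawn = σ.drawn := den_drawn _ (by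
    simp [mpxDet, allPairs, single, clear, bellmanFord, bfInit, bfEntry, relaxAll, relaxEdge,
      copyEntry, maxCount, countCenters, countCenter, Det]) _
  have hs := sampleAll_spec (ω := ω) hE₁.size
  rw [hdr] at hs
  have d5' : (den ω sampleAll (den ω mpxDet σ)).real 5 = (den ω mpxDet σ).real 5 :=
    den_real _ _ (by decide)
  refine ⟨by rw [d5]; exact hd, by rw [d5]; exact h1, by rw [d5]; exact h2, ?_⟩
  have := assign_spec (ω := ω) hE₂ hD (tau := (den ω mpxDet σ).nat 10 0 0)
    (U := fun i => ω (σ.drawn + i)) (by rw [den_nat _ _ (by decide)]) hs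
    (by rw [d5', d5]; exact hd.le_B) (by rw [m4']; exact hex)
  rw [m4', d5'] at this
  exact this

end Code

end RealRAM

/-! ### Programs for the initialization and for greedy nets. -/

namespace RealRAM

namespace Code

open LDD

variable {ω : ℕ → unitInterval} {n k : ℕ} {a : ℕ → ℕ → ℕ} {w : ℕ → ℕ → ℝ} {B D : ℝ} {σ τ : State}

/-- Add `n` times the weight of an edge to the value for infinity. -/
def addWeight : Code :=
  .rset 2 (.const 0) (.const 0)
    (.add (rv 2) (.mul (.ofNat (nv 0)) (.get 1 (nv 21) (nv 22))))

/-- Compute the scale and the value for infinity. -/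
def setup : Code :=
  .seq (.rset 3 (.const 0) (.const 0) (.div (rv 0) (.ofNat (.const 6))))
    (.seq (.rset 2 (.const 0) (.const 0) (.add (.ofNat (.const 1)) (rv 0)))
      (.rep 21 (.rep 22 addWeight)))

theorem addRow_spec (hn : σ.nat 0 0 0 = n) (hw : σ.real 1 = w) {x : ℕ} (hx : σ.nat 21 0 0 = x) :
    (den ω (.rep 22 addWeight) σ).real 2 0 0 =
      σ.real 2 0 0 + ∑ y ∈ Finset.range n, n * w x y := by
  obtain ⟨τ, i1, e⟩ := rep_rule (ω := ω) 22 addWeight σ n hn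
    (fun m τ => τ.real 2 0 0 = σ.real 2 0 0 + ∑ y ∈ Finset.range m, n * w x y) (by simp)
    (fun m hm τ fn fr i1 => by
      simp [addWeight, den, fn 0 (by decide) (by decide), hn, fr 1 (by decide), hw,
        fn 21 (by decide) (by decide), hx, i1, Finset.sum_range_succ, add_assoc])
  rw [e]
  exact i1

theorem addAll_spec (hn : σ.nat 0 0 0 = n) (hw : σ.real 1 = w) :
    (den ω (.rep 21 (.rep 22 addWeight)) σ).real 2 0 0 =
      σ.real 2 0 0 + ∑ x ∈ Finset.range n, ∑ y ∈ Finset.range n, n * w x y := by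
  obtain ⟨τ, i1, e⟩ := rep_rule (ω := ω) 21 (.rep 22 addWeight) σ n hn
    (fun m τ => τ.real 2 0 0 =
      σ.real 2 0 0 + ∑ x ∈ Finset.range m, ∑ y ∈ Finset.range n, n * w x y) (by simp)
    (fun m hm τ fn fr i1 => by
      rw [addRow_spec (n := n) (w := w) (x := m) (by simp [fn 0 (by decide) (by decide), hn])
        (by rw [State.setN_real, fr 1 (by decide), hw]) (by simp), State.setN_real, i1,
        Finset.sum_range_succ, add_assoc])
  rw [e]
  exact i1

theorem setup_spec {Δ : ℝ} (hn : σ.nat 0 0 0 = n) (hk : σ.nat 0 0 1 = k) (ha : σ.nat 1 = a)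
    (hw : σ.real 1 = w) (hΔ : σ.real 0 0 0 = Δ) (hΔ0 : 0 < Δ) (hw0 : ∀ x y, 0 ≤ w x y)
    (hlt : ∀ x y, adjRel a x y → x < n ∧ y < n) :
    ∃ B, 3 * (Δ / 6) < B ∧ Huge n (adjRel a) w B ∧ Env n k a w B (Δ / 6) (den ω setup σ) := by
  have e : den ω setup σ = den ω (.rep 21 (.rep 22 addWeight))
      ((σ.setR 3 0 0 (Δ / 6)).setR 2 0 0 (1 + Δ)) := by
    simp [setup, den.eq_5, den.eq_3, hΔ]
  rw [e]
  have h := addAll_spec (ω := ω) (n := n) (w := w) (σ := (σ.setR 3 0 0 (Δ / 6)).setR 2 0 0 (1 + Δ))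
    hn (by rw [State.setR_real_ne _ _ _ _ _ (by decide), State.setR_real_ne _ _ _ _ _ (by decide),
      hw])
  have hsum : (0 : ℝ) ≤ ∑ x ∈ Finset.range n, ∑ y ∈ Finset.range n, n * w x y :=
    Finset.sum_nonneg fun x _ => Finset.sum_nonneg fun y _ => mul_nonneg (Nat.cast_nonneg _) (hw0 x y)
  have h2 : ((σ.setR 3 0 0 (Δ / 6)).setR 2 0 0 (1 + Δ)).real 2 0 0 = 1 + Δ := by simp
  -- `B` is `1 + Δ` plus `n` times the sum of all entries of the weight matrix; that sum bounds
  -- every single weight.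
  refine ⟨_, ?_, ⟨∑ x ∈ Finset.range n, ∑ y ∈ Finset.range n, w x y, ?_, ?_, ?_⟩,
    ?_, ?_, ?_, ?_, h, ?_⟩
  · rw [h2]; linarith
  · exact Finset.sum_nonneg fun x _ => Finset.sum_nonneg fun y _ => hw0 x y
  · intro x y hxy
    obtain ⟨hx, hy⟩ := hlt x y hxy
    calc w x y ≤ ∑ y ∈ Finset.range n, w x y :=
          Finset.single_le_sum (f := fun y => w x y) (fun y _ => hw0 x y) (Finset.mem_range.2 hy)
      _ ≤ _ := Finset.single_le_sum (f := fun x => ∑ y ∈ Finset.range n, w x y)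
          (fun x _ => Finset.sum_nonneg fun y _ => hw0 x y) (Finset.mem_range.2 hx)
  · rw [h2]
    simp_rw [← Finset.mul_sum]
    linarith
  · rw [den_nat _ _ (by decide)]; exact hn
  · rw [den_nat _ _ (by decide)]; exact hk
  · rw [den_nat _ _ (by decide)]; exact ha
  · rw [den_real _ _ (by decide), State.setR_real_ne _ _ _ _ _ (by decide),
      State.setR_real_ne _ _ _ _ _ (by decide), hw]
  · rw [den_real _ _ (by decide), State.setR_real_ne _ _ _ _ _ (by decide)]
    simp

/-- Test whether center `26` covers vertex `27`. -/
def netTest : Code :=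
  .cond (.and (natEq (.get 4 (nv 26) (.const 0)) (.const 1)) (.rle (.get 5 (nv 26) (nv 27)) (rv 3)))
    (.nset 8 (.const 0) (.const 0) (.const 1)) .skip

/-- Make vertex `27` a center if it is not covered yet. -/
def netStep : Code :=
  .seq (.nset 8 (.const 0) (.const 0) (.const 0)) (.seq (.rep 26 netTest)
    (.cond (natEq (nv 8) (.const 1)) .skip (.nset 4 (nv 27) (.const 0) (.const 1))))

/-- Construct a net. -/
def net : Code := .seq allPairs (.rep 27 netStep)

theorem netTest_spec (h : Env n k a w B D σ) {x : ℕ} (e27 : σ.nat 27 0 0 = x)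
    (e8 : σ.nat 8 0 0 = 0) : (den ω (.rep 26 netTest) σ).nat 8 0 0 = 1 ↔
      ∃ c < n, marked σ 4 c ∧ σ.real 5 c x ≤ D := by
  obtain ⟨τ, i1, e⟩ := rep_rule (ω := ω) 26 netTest σ n h.size
    (fun m τ => τ.nat 8 0 0 = 1 ↔ ∃ c < m, marked σ 4 c ∧ σ.real 5 c x ≤ D)
    (by simp [e8])
    (fun m hm τ fn fr i1 => by
      have hE : Env n k a w B D (τ.setN 26 0 0 m) := h.loop (by decide) (by norm_num) fn fr
      have hs0 : τ.real 3 0 0 = D := hE.scale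
      have f4 : τ.nat 4 = σ.nat 4 := fn 4 (by decide) (by decide)
      have f5 : τ.real 5 = σ.real 5 := fr 5 (by decide)
      have f27 : τ.nat 27 0 0 = x := by rw [fn 27 (by decide) (by decide), e27]
      by_cases hc : marked σ 4 m ∧ σ.real 5 m x ≤ D
      · have e : den ω netTest (τ.setN 26 0 0 m) = (τ.setN 26 0 0 m).setN 8 0 0 1 := by
          unfold marked at hc
          simp [netTest, den, hs0, f4, f5, f27, hc]
        rw [e]
        exact iff_of_true (by simp) ⟨m, by omega, hc⟩
      · have e : den ω netTest (τ.setN 26 0 0 m) = τ.setN 26 0 0 m := by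
          simp only [netTest, den]
          rw [if_neg]
          unfold marked at hc
          simpa [hs0, f4, f5, f27] using hc
        rw [e]
        have : (τ.setN 26 0 0 m).nat 8 0 0 = τ.nat 8 0 0 := by simp
        rw [this, i1]
        constructor
        · rintro ⟨c, h1, h2⟩; exact ⟨c, by omega, h2⟩
        · rintro ⟨c, h1, h2⟩
          rcases Nat.lt_or_eq_of_le (Nat.le_of_lt_succ h1) with h' | rfl
          exacts [⟨c, h', h2⟩, (hc h2).elim])
  rw [e]
  simpa using i1

/-- A vertex becomes a center only if no earlier center is within `D`, so separation is obtained for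
`c < c'`. -/
theorem net_spec (h : Env n k a w B D σ) (hG : WG n (adjRel a) w) (hB : Huge n (adjRel a) w B)
    (hD : 0 ≤ D) (h4 : ∀ c, ¬ marked σ 4 c) :
    ∃ d, APSP n (same (adjRel a) (lab σ)) w B d ∧
      (∀ x < n, ∃ c < n, marked (den ω net σ) 4 c ∧ d c x ≤ D) ∧
      ∀ c c', marked (den ω net σ) 4 c → marked (den ω net σ) 4 c' → c < c' → D < d c c' := by
  have hd := allPairs_spec (ω := ω) h hG hB
  have hE : Env n k a w B D (den ω allPairs σ) := h.den (by decide)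
  have m4 : marked (den ω allPairs σ) 4 = marked σ 4 := by
    unfold marked; rw [den_nat _ _ (by decide)]
  refine ⟨_, hd, ?_⟩
  rw [net, den.eq_5]
  generalize den ω allPairs σ = σ₁ at *
  obtain ⟨τ, ⟨i1, i2, i3⟩, e⟩ := rep_rule (ω := ω) 27 netStep σ₁ n hE.size
    (fun m τ => (∀ x < m, ∃ c < n, marked τ 4 c ∧ σ₁.real 5 c x ≤ D) ∧
      (∀ c c', marked τ 4 c → marked τ 4 c' → c < c' → D < σ₁.real 5 c c') ∧
      ∀ c, marked τ 4 c → c < m)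
    ⟨fun _ h => absurd h (by simp), fun c _ hc => (h4 c (m4 ▸ hc)).elim,
      fun c hc => (h4 c (m4 ▸ hc)).elim⟩
    (fun m hm τ fn fr ⟨i1, i2, i3⟩ => by
      have hE' : Env n k a w B D ((τ.setN 27 0 0 m).setN 8 0 0 0) :=
        (hE.loop (by decide) (by norm_num) fn fr).setN _ _ _ _ (by norm_num)
      have h1 := netTest_spec (ω := ω) hE' (x := m) (by simp) (by simp)
      have e4 : marked ((τ.setN 27 0 0 m).setN 8 0 0 0) 4 = marked τ 4 := by
        funext c
        simp [marked_setN_ne]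
      have e5 : ((τ.setN 27 0 0 m).setN 8 0 0 0).real 5 = σ₁.real 5 := fr 5 (by decide)
      have g4 : marked (den ω (.rep 26 netTest) ((τ.setN 27 0 0 m).setN 8 0 0 0)) 4 =
          marked τ 4 := by
        rw [← e4]; unfold marked; rw [den_nat _ _ (by decide)]
      have g27 : (den ω (.rep 26 netTest) ((τ.setN 27 0 0 m).setN 8 0 0 0)).nat 27 0 0 = m := by
        rw [den_nat _ _ (by decide)]; simp
      rw [e4, e5] at h1
      simp only [netStep, den.eq_5, den.eq_2, den.eq_6, den.eq_1, NExpr.eval]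
      generalize den ω (.rep 26 netTest) ((τ.setN 27 0 0 m).setN 8 0 0 0) = τ' at *
      split_ifs with hb
      · simp only [natEq_eval, NExpr.eval] at hb
        rw [g4]
        refine ⟨fun x hx => ?_, i2, fun c hc => (i3 c hc).trans (by omega)⟩
        rcases Nat.lt_or_eq_of_le (Nat.le_of_lt_succ hx) with h | rfl
        exacts [i1 x h, h1.1 hb]
      · simp only [natEq_eval, NExpr.eval] at hb
        have hno := fun h => hb (h1.2 h)
        rw [g27]
        have e : ∀ c, marked (τ'.setN 4 m 0 1) 4 c ↔ c = m ∨ marked τ 4 c := by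
          intro c; rw [marked_setN_one, g4]
        simp only [e]
        refine ⟨fun x hx => ?_, ?_, ?_⟩
        · rcases Nat.lt_or_eq_of_le (Nat.le_of_lt_succ hx) with h | rfl
          · obtain ⟨c, h1, h2, h3⟩ := i1 x h
            exact ⟨c, h1, .inr h2, h3⟩
          · refine ⟨x, hm, .inl rfl, ?_⟩
            exact ((hd.le x hm x 0 (.nil _)).1).trans hD
        · rintro c c' (rfl | hc) (rfl | hc') hlt
          · exact (lt_irrefl _ hlt).elim
          · have := i3 c' hc'; omega
          · by_contra hle
            exact hno ⟨c, by omega, hc, not_lt.1 hle⟩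
          · exact i2 c c' hc hc' hlt
        · rintro c (rfl | hc)
          · omega
          · have := i3 c hc; omega)
  rw [e]
  have : marked (τ.setN 27 0 0 n) 4 = marked τ 4 := by
    funext c
    simp [marked_setN_ne]
  rw [this]
  exact ⟨i1, i2⟩

end Code

end RealRAM

/-! ### Probabilistic analysis of the clustering around centers. -/

namespace RealRAM

namespace Code

open LDD MeasureTheory

variable {n k : ℕ} {a : ℕ → ℕ → ℕ} {w : ℕ → ℕ → ℝ} {B D : ℝ}

theorem mpxDet_det : mpxDet.Det := by
  simp [mpxDet, allPairs, single, clear, bellmanFord, bfInit, bfEntry, relaxAll, relaxEdge,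
    copyEntry, maxCount, countCenters, countCenter, Det]

/-- What the last phase needs to know about the random state in which it starts. -/
structure Ready (n k : ℕ) (a : ℕ → ℕ → ℕ) (w : ℕ → ℕ → ℝ) (B D : ℝ) (m τm : ℕ)
    (S : (ℕ → unitInterval) → State) : Prop where
  meas : MeasState S
  env : ∀ ω, Env n k a w B D (S ω)
  drawn : ∀ ω, (S ω).drawn = m
  indep : ∀ ω i x, m ≤ i → S (Function.update ω i x) = S ω
  cover : ∀ ω, ∀ x < n, ∃ c < n, marked (S ω) 4 c ∧
    ∃ r ≤ 2 * D, WPath (same (adjRel a) (lab (S ω))) w c x r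
  count : ∀ ω, ∀ u < n, ∀ F : Finset ℕ, (∀ c ∈ F, marked (S ω) 4 c ∧
    ∃ r ≤ 3 * D, WPath (same (adjRel a) (lab (S ω))) w u c r) → F.card ≤ τm

namespace Ready

variable {m τm : ℕ} {S : (ℕ → unitInterval) → State}

/-- The labels in the final state. -/
def label (σ : State) (x : ℕ) : ℕ := σ.nat 2 x 0

/-- The centers, distances and `τ` depend on coins before `m` only, since `mpxDet` draws none; the
centers use the coins from `m` on. This is the independence that `coins_nearTie` requires. -/
theorem nearTie_le (h : Ready n k a w B D m τm S) (hG : WG n (adjRel a) w)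
    (hB : Huge n (adjRel a) w B) (hD : 0 < D) (hDB : 3 * D < B) {u : ℕ} (hu : u < n) {r : ℝ}
    (hr : 0 ≤ r) :
    coins {ω | ∃ c, NearTie n (marked (S ω) 4)
      (Real.log ((den ω mpxDet (S ω)).nat 10 0 0 + 1) / D)
      (fun i => unif (1 / ((den ω mpxDet (S ω)).nat 10 0 0 + 1)) (ω (m + i)))
      (fun c => (den ω mpxDet (S ω)).real 5 c u)
      (Real.exp (2 * (Real.log ((den ω mpxDet (S ω)).nat 10 0 0 + 1) / D * r))) c} ≤
      ENNReal.ofReal (4 * (Real.log (τm + 1) / D * r)) := by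
  have hex : ∀ ω, ∃ c < n, marked (S ω) 4 c := fun ω => by
    obtain ⟨c, h1, h2, -⟩ := h.cover ω u hu
    exact ⟨c, h1, h2⟩
  have hsp := fun ω => mpx_spec (ω := ω) (h.env ω) hG hB hD (hex ω)
  have hM : MeasState fun ω => den ω mpxDet (S ω) := h.meas.den measurable_id mpxDet
  have hi : ∀ ω i x, m ≤ i → den (Function.update ω i x) mpxDet (S (Function.update ω i x)) =
      den ω mpxDet (S ω) := fun ω i x hi => by rw [h.indep ω i x hi]; exact den_det _ mpxDet_det _
  have hcov : ∀ ω, ∃ c < n, marked (S ω) 4 c ∧ (den ω mpxDet (S ω)).real 5 c u ≤ 2 * D := fun ω => by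
    obtain ⟨c, h1, h2, r, h3, p⟩ := h.cover ω u hu
    exact ⟨c, h1, h2, ((hsp ω).1.le c h1 u r p).1.trans h3⟩
  have hnear : ∀ ω, ∀ v < n, nearCenters n (marked (S ω) 4) ((den ω mpxDet (S ω)).real 5) D v ≤ τm := by
    intro ω v hv
    refine h.count ω v hv _ fun c hc => ?_
    simp only [Finset.mem_filter, Finset.mem_range] at hc
    exact ⟨hc.2.1, _, hc.2.2, ((hsp ω).1.path c hc.1 v hv (hc.2.2.trans_lt hDB)).symm (hG.same _)⟩
  refine coins_nearTie hD hr (N := fun ω => marked (S ω) 4)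
    (d := fun ω c => (den ω mpxDet (S ω)).real 5 c u) (τ := fun ω => (den ω mpxDet (S ω)).nat 10 0 0)
    (fun c => ?_) (fun c => hM.real 5 c u) (hM.nat 10 0 0) (fun ω i x him => ?_)
    (fun ω i x him => ?_) (fun ω i x him => ?_) (fun ω => ?_) (fun ω => ?_) (fun ω => ?_) hcov
  · exact measurableSet_eq_fun (h.meas.nat 4 c 0) measurable_const
  · simp only [h.indep ω i x him]
  · simp only [hi ω i x him]
  · simp only [hi ω i x him]
  · obtain ⟨c, h1, h2, h3⟩ := hcov ω
    refine le_trans ?_ ((hsp ω).2.1 u hu)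
    refine Finset.card_pos.2 ⟨c, ?_⟩
    simp only [Finset.mem_filter, Finset.mem_range]
    exact ⟨h1, h2, h3.trans (by linarith)⟩
  · rcases (hsp ω).2.2.1 with h0 | ⟨v, hv, h0⟩
    · simp only [h0]; exact Nat.zero_le _
    · simp only [h0]; exact hnear ω v hv
  · exact (hsp ω).2.1 u hu

/-- With `r = 0`, near ties are exact ties and have probability zero. Off this null event every
winner is strict. -/
theorem ae_diam (h : Ready n k a w B D m τm S) (hG : WG n (adjRel a) w)
    (hB : Huge n (adjRel a) w B) (hD : 0 < D) (hDB : 3 * D < B) :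
    ∀ᵐ ω ∂coins, ∀ x < n, ∀ y < n, label (den ω mpx (S ω)) x = label (den ω mpx (S ω)) y →
      ∃ r ≤ 6 * D, WPath (restr (adjRel a) fun z =>
        label (den ω mpx (S ω)) z = label (den ω mpx (S ω)) x) w x y r := by
  have h1 : ∀ u : Fin n, ∀ᵐ ω ∂coins, ¬ ∃ c, NearTie n (marked (S ω) 4)
      (Real.log ((den ω mpxDet (S ω)).nat 10 0 0 + 1) / D)
      (fun i => unif (1 / ((den ω mpxDet (S ω)).nat 10 0 0 + 1)) (ω (m + i)))
      (fun c => (den ω mpxDet (S ω)).real 5 c u) 1 c := by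
    intro u
    have := h.nearTie_le hG hB hD hDB u.2 (r := 0) le_rfl
    simp only [mul_zero, Real.exp_zero, ENNReal.ofReal_zero, nonpos_iff_eq_zero] at this
    rw [ae_iff]
    simpa using this
  rw [← ae_all_iff] at h1
  filter_upwards [h1] with ω hω x hx y hy hxy
  have hex : ∃ c < n, marked (S ω) 4 c := by
    obtain ⟨c, h1, h2, -⟩ := h.cover ω x hx
    exact ⟨c, h1, h2⟩
  obtain ⟨s1, s2, s3, s4⟩ := mpx_spec (ω := ω) (h.env ω) hG hB hD hex
  rw [h.drawn ω] at s4
  set tau := (den ω mpxDet (S ω)).nat 10 0 0 with htau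
  have htau0 : (0 : ℝ) ≤ tau := Nat.cast_nonneg _
  have htau1 : 1 ≤ tau := by
    obtain ⟨c, h1, h2, r, h3, p⟩ := h.cover ω x hx
    refine le_trans ?_ (s2 x hx)
    refine Finset.card_pos.2 ⟨c, ?_⟩
    simp only [Finset.mem_filter, Finset.mem_range]
    exact ⟨h1, h2, ((s1.le c h1 x r p).1.trans h3).trans (by linarith)⟩
  have hlog : 0 < Real.log (tau + 1) := Real.log_pos (by
    have : (1 : ℝ) ≤ tau := by exact_mod_cast htau1
    linarith)
  have hE : Real.exp (-(Real.log (tau + 1) / D * D)) = 1 / (tau + 1) := by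
    rw [div_mul_cancel₀ _ hD.ne', Real.exp_neg, Real.exp_log (by linarith), one_div]
  have hE1 : 1 / ((tau : ℝ) + 1) ≤ 1 := by
    rw [div_le_one (by positivity)]; linarith
  obtain ⟨r, hr, p⟩ := cluster_diam (hG.same (lab (S ω))) s1 hDB (div_pos hlog hD)
    (fun c => by rw [hE]; exact le_unif hE1 (ω (m + c))) (fun c => unif_le hE1 (ω (m + c)))
    (N := marked (S ω) 4) (out := label (den ω mpx (S ω))) (fun x hx => by
      obtain ⟨c, h1, h2, r, h3, p⟩ := h.cover ω x hx
      exact ⟨c, h1, h2, (s1.le c h1 x r p).1.trans h3⟩)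
    (fun x hx => ⟨(s4 x hx).1, (s4 x hx).2.1, fun c hc hN hne => by
      by_contra hle
      refine hω ⟨x, hx⟩ ⟨_, s4 x hx, c, hc, hN, hne, ?_⟩
      rw [one_mul]
      exact not_lt.1 hle⟩) hx hy hxy
  exact ⟨r, hr, p.mono fun _ _ h => ⟨h.1.1, h.2⟩⟩

theorem cut_le (h : Ready n k a w B D m τm S) (hG : WG n (adjRel a) w)
    (hB : Huge n (adjRel a) w B) (hD : 0 < D) (hDB : 3 * D < B) {u v : ℕ} (huv : adjRel a u v) :
    coins {ω | lab (S ω) u = lab (S ω) v ∧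
      label (den ω mpx (S ω)) u ≠ label (den ω mpx (S ω)) v} ≤
      ENNReal.ofReal (4 * (Real.log (τm + 1) / D * w u v)) := by
  refine (measure_mono ?_).trans (h.nearTie_le hG hB hD hDB (hG.lt huv).1 (hG.nonneg huv))
  rintro ω ⟨h1, h2⟩
  have hu := (hG.lt huv).1
  obtain ⟨c, hc1, hc2, r, hr, p⟩ := h.cover ω u hu
  obtain ⟨s1, s2, s3, s4⟩ := mpx_spec (ω := ω) (h.env ω) hG hB hD ⟨c, hc1, hc2⟩
  rw [h.drawn ω] at s4
  set tau := (den ω mpxDet (S ω)).nat 10 0 0 with htau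
  have htau0 : (0 : ℝ) ≤ tau := Nat.cast_nonneg _
  have htau1 : 1 ≤ tau := by
    refine le_trans ?_ (s2 u hu)
    refine Finset.card_pos.2 ⟨c, ?_⟩
    simp only [Finset.mem_filter, Finset.mem_range]
    exact ⟨hc1, hc2, ((s1.le c hc1 u r p).1.trans hr).trans (by linarith)⟩
  have hlog : 0 < Real.log (tau + 1) := Real.log_pos (by
    have : (1 : ℝ) ≤ tau := by exact_mod_cast htau1
    linarith)
  have hE1 : 1 / ((tau : ℝ) + 1) ≤ 1 := by
    rw [div_le_one (by positivity)]; linarith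
  have hE0 : 0 < 1 / ((tau : ℝ) + 1) := by positivity
  exact nearTie_of_cut (hG.same (lab (S ω))) s1 (div_pos hlog hD)
    (fun c => hE0.trans_le (le_unif hE1 (ω (m + c)))) s4 ⟨huv, h1⟩ h2

end Ready

end Code

end RealRAM

/-! ### Probabilistic analysis of the supernodes. -/

namespace RealRAM

namespace Code

open LDD MeasureTheory

variable {ω : ℕ → unitInterval} {n k : ℕ} {a : ℕ → ℕ → ℕ} {w : ℕ → ℕ → ℝ} {B D : ℝ} {σ : State}

theorem prepare_det : prepare.Det := by
  simp [prepare, single, clear, bellmanFord, bfInit, bfEntry, relaxAll, relaxEdge, arm, armTest,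
    traceArm, traceStep, Det]

theorem copStep_drawn (σ : State) : (den ω copStep σ).drawn = σ.drawn + 1 := by
  have h1 : copDet.Det := ⟨prepare_det, trivial⟩
  have h2 : copCut.Det := by simp [copCut, capture, Det]
  simp only [copStep, den.eq_5]
  rw [den_drawn _ h2, den.eq_4, State.draw_drawn, den_drawn _ h1]

theorem copStep_congr {ω' : ℕ → unitInterval} (σ : State) (h : ω σ.drawn = ω' σ.drawn) :
    den ω copStep σ = den ω' copStep σ := by
  have h1 : copDet.Det := ⟨prepare_det, trivial⟩
  have h2 : copCut.Det := by simp [copCut, capture, Det]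
  simp only [copStep, den.eq_5, den.eq_4]
  rw [den_det (ω' := ω') _ h2, den_det (ω' := ω') _ h1, den_drawn _ h1, h]

/-- The state after `t` iterations of the construction of supernodes. -/
noncomputable def copState (σ : State) (ω : ℕ → unitInterval) (t : ℕ) : State :=
  iter (fun k τ => den ω copStep (τ.setN 20 0 0 k)) σ t

theorem copState_succ (t : ℕ) :
    copState σ ω (t + 1) = den ω copStep ((copState σ ω t).setN 20 0 0 t) := rfl

theorem measState_copState (t : ℕ) : MeasState fun ω => copState σ ω t := by
  induction t with
  | zero =>
    have e : ∀ ω, copState σ ω 0 = σ := fun _ => rfl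
    simp only [e]
    exact ⟨fun _ _ _ => measurable_const, fun _ _ _ => measurable_const, measurable_const⟩
  | succ t ih =>
    exact MeasState.den (W := id) measurable_id copStep
      (ih.setN 20 measurable_const measurable_const measurable_const)

theorem copState_drawn (h0 : σ.drawn = 0) (t : ℕ) : (copState σ ω t).drawn = t := by
  induction t with
  | zero => exact h0
  | succ t ih => rw [copState_succ, copStep_drawn, State.setN_drawn, ih]

theorem copState_congr {ω' : ℕ → unitInterval} (h0 : σ.drawn = 0) (t : ℕ) (h : ∀ i < t, ω i = ω' i) :
    copState σ ω t = copState σ ω' t := by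
  induction t with
  | zero => rfl
  | succ t ih =>
    rw [copState_succ, copState_succ, ih fun i hi => h i (by omega)]
    refine copStep_congr _ ?_
    rw [State.setN_drawn, copState_drawn h0]
    exact h t (by omega)

/-- The data of the construction of supernodes. -/
structure CopSetup (n k : ℕ) (a : ℕ → ℕ → ℕ) (w : ℕ → ℕ → ℝ) (B D : ℝ) (σ : State) : Prop where
  env : Env n k a w B D σ
  graph : WG n (adjRel a) w
  huge : Huge n (adjRel a) w B
  scale_pos : 0 < D
  lt_inf : D < B
  noMinor : NoMinor n (adjRel a) w k
  param_pos : 1 ≤ k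
  drawn : σ.drawn = 0
  lab_zero : ∀ x, lab σ x = 0
  unmarked : ∀ c, ¬ marked σ 4 c

namespace CopSetup

theorem rate_pos (h : CopSetup n k a w B D σ) : 0 < 3 * (k : ℝ) / D :=
  div_pos (by have := h.param_pos; positivity) h.scale_pos

theorem rate_mul (h : CopSetup n k a w B D σ) : 3 * (k : ℝ) / D * D = 3 * k :=
  div_mul_cancel₀ _ h.scale_pos.ne'

theorem start (h : CopSetup n k a w B D σ) :
    CopInv n (adjRel a) w D k 0 (lab σ) (marked σ 4) where
  zero x _ := h.lab_zero x
  le x := (h.lab_zero x).le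
  done x hx := absurd hx (by simp)
  conn x y _ hx := (hx (h.lab_zero x)).elim
  adj u _ _ l l' _ hl := by
    obtain ⟨h0, _, _, z, -, -, hz⟩ := hl
    exact (h0 (hz.symm.trans (h.lab_zero z))).elim
  net c hc := (h.unmarked c hc).elim
  cover u hu := (hu (h.lab_zero u)).elim
  count u hu := (hu (h.lab_zero u)).elim

theorem lab_setN {τ : State} {v x : ℕ} (hv : v ≠ 3) : lab (τ.setN v 0 0 x) = lab τ := by
  unfold lab; rw [State.setN_nat_ne _ _ _ _ _ hv.symm]

theorem marked_setN {τ : State} {v x : ℕ} (hv : v ≠ 4) :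
    marked (τ.setN v 0 0 x) 4 = marked τ 4 := by
  funext c; exact propext (marked_setN_ne hv.symm)

theorem envState (h : CopSetup n k a w B D σ) (ω : ℕ → unitInterval) (t : ℕ) :
    Env n k a w B D (copState σ ω t) := by
  induction t with
  | zero => exact h.env
  | succ t ih => exact (ih.setN _ _ _ _ (by norm_num)).den (by decide)

/-- The skeleton and the distances are the same for all `ω` with the same state after `t`
iterations. Only coin `t` varies, so it can be integrated out. -/
theorem step_of_zero (h : CopSetup n k a w B D σ) {ω₀ : ℕ → unitInterval} {t : ℕ} (ht : t < n)
    (hI : CopInv n (adjRel a) w D k t (lab (copState σ ω₀ t)) (marked (copState σ ω₀ t) 4))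
    (hs : lab (copState σ ω₀ t) t = 0) :
    ∃ T N' P pr, BF n (same (adjRel a) (lab (copState σ ω₀ t))) w T B P pr ∧
      Skel n (adjRel a) w D k (lab (copState σ ω₀ t)) t T (marked (copState σ ω₀ t) 4) N' ∧
      ∀ ω, copState σ ω t = copState σ ω₀ t →
        lab (copState σ ω (t + 1)) = relabel n (lab (copState σ ω₀ t)) (P n) (3 * k / D)
          (unif (Real.exp (-(3 * k))) (ω t)) t ∧ marked (copState σ ω (t + 1)) 4 = N' := by
  have hE := (h.envState ω₀ t).setN 20 0 0 t (by norm_num)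
  have e3 := lab_setN (τ := copState σ ω₀ t) (v := 20) (x := t) (by decide)
  have e4 := marked_setN (τ := copState σ ω₀ t) (v := 20) (x := t) (by decide)
  obtain ⟨T, N', P, pr, h1, h2, h3⟩ := copStep_spec hE h.graph h.huge h.scale_pos h.noMinor
    (t := t) (by rw [e3, e4]; exact hI) ht (by simp) (by rw [e3]; exact hs)
  rw [e3] at h1 h2 h3
  rw [e4] at h2
  refine ⟨T, N', P, pr, h1, h2, fun ω hω => ?_⟩
  have := h3 ω
  rw [State.setN_drawn, copState_drawn h.drawn] at this
  rwa [copState_succ, hω]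

theorem step_of_ne {t : ℕ} (hs : lab (copState σ ω t) t ≠ 0) :
    lab (copState σ ω (t + 1)) = lab (copState σ ω t) ∧
      marked (copState σ ω (t + 1)) 4 = marked (copState σ ω t) 4 := by
  have e3 := lab_setN (τ := copState σ ω t) (v := 20) (x := t) (by decide)
  rw [copState_succ, copStep_skip (t := t) (by simp) (by rw [e3]; exact hs)]
  exact ⟨e3, marked_setN (τ := copState σ ω t) (v := 20) (x := t) (by decide)⟩

theorem inv (h : CopSetup n k a w B D σ) (ω : ℕ → unitInterval) {t : ℕ} (ht : t ≤ n) :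
    CopInv n (adjRel a) w D k t (lab (copState σ ω t)) (marked (copState σ ω t) 4) := by
  induction t with
  | zero => exact h.start
  | succ t ih =>
    have hI := ih (by omega)
    by_cases hs : lab (copState σ ω t) t = 0
    · obtain ⟨T, N', P, pr, h1, h2, h3⟩ := h.step_of_zero (by omega) hI hs
      obtain ⟨e1, e2⟩ := h3 ω rfl
      have hE1 : Real.exp (-(3 * (k : ℝ))) ≤ 1 := Real.exp_le_one_iff.2 (by
        have : (0 : ℝ) ≤ k := Nat.cast_nonneg k
        linarith)
      rw [e1, e2]
      exact hI.step h.graph (by omega) h2 h.huge h.lt_inf h1 h.rate_pos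
        (by rw [h.rate_mul]; exact le_unif hE1 _) (unif_le hE1 _)
    · obtain ⟨e1, e2⟩ := step_of_ne hs
      rw [e1, e2]
      exact hI.skip hs

/-- The cost in terms of the labels. -/
noncomputable abbrev costAt (n k : ℕ) (a : ℕ → ℕ → ℕ) (w : ℕ → ℕ → ℝ) (D : ℝ) (u v : ℕ)
    (τ : State) : ℝ≥0∞ :=
  ENNReal.ofReal (cost n (adjRel a) w (3 * k / D) (1 / (2 * k)) k u v (lab τ))

/-- Labels vanish from `n` on, so the cost factors through the labels below `n`, which range over a
countable discrete space. -/
theorem measurable_costAt (h : CopSetup n k a w B D σ) (u v : ℕ) {t : ℕ} (ht : t ≤ n) :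
    Measurable fun ω => costAt n k a w D u v (copState σ ω t) := by
  let ext : (Fin n → ℕ) → ℕ → ℕ := fun g x => if hx : x < n then g ⟨x, hx⟩ else 0
  have e : ∀ ω, lab (copState σ ω t) = ext fun i => (copState σ ω t).nat 3 i 0 := fun ω => by
    funext x
    by_cases hx : x < n
    · simp [ext, hx, lab]
    · simp [ext, hx, (h.inv ω ht).zero x (by omega)]
  have hm : Measurable fun ω => fun i : Fin n => (copState σ ω t).nat 3 i 0 :=
    measurable_pi_iff.2 fun i => (measState_copState t).nat 3 i 0
  have hF : Measurable fun g : Fin n → ℕ => ENNReal.ofReal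
      (cost n (adjRel a) w (3 * k / D) (1 / (2 * k)) k u v (ext g)) := Measurable.of_discrete
  have := hF.comp hm
  simp only [costAt, e]
  exact this

theorem lintegral_cost_succ (h : CopSetup n k a w B D σ) {u v : ℕ} (huv : adjRel a u v)
    (hη : 3 * k / D * w u v ≤ 1) {t : ℕ} (ht : t < n) :
    ∫⁻ ω, costAt n k a w D u v (copState σ ω (t + 1)) ∂coins ≤
      ∫⁻ ω, costAt n k a w D u v (copState σ ω t) ∂coins := by
  rw [lintegral_resample t (h.measurable_costAt u v (by omega))]
  refine lintegral_mono fun ω => ?_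
  have hω : ∀ x, copState σ (Function.update ω t x) t = copState σ ω t := fun x =>
    copState_congr h.drawn t fun i hi => Function.update_of_ne hi.ne _ _
  have hI := h.inv ω ht.le
  by_cases hs : lab (copState σ ω t) t = 0
  · obtain ⟨T, N', P, pr, h1, h2, h3⟩ := h.step_of_zero ht hI hs
    have e : ∀ x, lab (copState σ (Function.update ω t x) (t + 1)) =
        relabel n (lab (copState σ ω t)) (P n) (3 * k / D) (unif (Real.exp (-(3 * k))) x) t := by
      intro x
      have := (h3 _ (hω x)).1
      rwa [Function.update_self] at this
    simp only [costAt, e]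
    exact cost_step hI h.graph ht h.noMinor h.huge h.lt_inf h1 h.param_pos h.rate_pos h.rate_mul rfl
      rfl huv hη
  · have e : ∀ x, lab (copState σ (Function.update ω t x) (t + 1)) = lab (copState σ ω t) := by
      intro x
      rw [(step_of_ne (by rw [hω]; exact hs)).1, hω]
    simp only [costAt, e, lintegral_const, measure_univ, mul_one]
    exact le_rfl

/-- The expected cost starts at most at `36 * η` and never increases. In the end every vertex has a
label, so the cost is `1` on the event of a cut, and Markov's inequality applies. -/
theorem cut_le_of_small (h : CopSetup n k a w B D σ) {u v : ℕ} (huv : adjRel a u v)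
    (hη : 3 * k / D * w u v ≤ 1) :
    coins {ω | lab (copState σ ω n) u ≠ lab (copState σ ω n) v} ≤
      ENNReal.ofReal (36 * (3 * k / D * w u v)) := by
  have key : ∀ t ≤ n, ∫⁻ ω, costAt n k a w D u v (copState σ ω t) ∂coins ≤
      ENNReal.ofReal (36 * (3 * k / D * w u v)) := by
    intro t ht
    induction t with
    | zero =>
      have e : ∀ ω, copState σ ω 0 = σ := fun _ => rfl
      simp only [e, lintegral_const, measure_univ, mul_one, costAt]
      refine ENNReal.ofReal_le_ofReal ?_
      have hk : (0 : ℝ) < k := by exact_mod_cast h.param_pos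
      have hp : 0 ≤ pot n (adjRel a) w (3 * k / D) (1 / (2 * k)) (lab σ) u :=
        pot_nonneg h.graph h.rate_pos
      have h0 : 0 ≤ 3 * k / D * w u v := mul_nonneg h.rate_pos.le (h.graph.nonneg huv)
      rw [cost, if_pos ⟨h.lab_zero u, h.lab_zero v⟩]
      calc _ ≤ 12 * (3 * k / D * w u v) / k * (3 * k) := by
            gcongr; linarith
        _ = _ := by field_simp; ring
    | succ t ih => exact (h.lintegral_cost_succ huv hη ht).trans (ih (by omega))
  refine le_trans ?_ (key n le_rfl)
  have hm := h.measurable_costAt u v le_rfl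
  have := mul_meas_ge_le_lintegral₀ (μ := coins) hm.aemeasurable 1
  rw [one_mul] at this
  refine (measure_mono fun ω hω => ?_).trans this
  have hI := h.inv ω le_rfl
  have hu := hI.done u (h.graph.lt huv).1 (h.graph.lt huv).1
  simp only [Set.mem_ofPred_eq] at hω ⊢
  rw [costAt, cost, if_neg (fun h => hu h.1), if_neg hω, ENNReal.ofReal_one]

theorem cut_le (h : CopSetup n k a w B D σ) {u v : ℕ} (huv : adjRel a u v) :
    coins {ω | lab (copState σ ω n) u ≠ lab (copState σ ω n) v} ≤
      ENNReal.ofReal (36 * (3 * k / D * w u v)) := by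
  rcases le_or_gt (3 * k / D * w u v) 1 with hη | hη
  · exact h.cut_le_of_small huv hη
  · refine prob_le_one.trans ?_
    rw [ENNReal.one_le_ofReal]
    linarith

theorem ready (h : CopSetup n k a w B D σ) :
    Ready n k a w B D n (7 * k + 1) fun ω => den ω (.rep 20 copStep) σ := by
  have e : ∀ ω, den ω (.rep 20 copStep) σ = (copState σ ω n).setN 20 0 0 n := fun ω => by
    rw [den.eq_7, h.env.size]; rfl
  have e3 : ∀ ω, lab ((copState σ ω n).setN 20 0 0 n) = lab (copState σ ω n) := fun ω =>
    lab_setN (by decide)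
  have e4 : ∀ ω, marked ((copState σ ω n).setN 20 0 0 n) 4 = marked (copState σ ω n) 4 := fun ω =>
    marked_setN (by decide)
  have hne : ∀ ω, ∀ x < n, lab (copState σ ω n) x ≠ 0 := fun ω x hx => (h.inv ω le_rfl).done x hx hx
  simp only [e]
  refine ⟨?_, fun ω => (h.envState ω n).setN _ _ _ _ (by norm_num), fun ω => ?_, fun ω i x hi => ?_,
    fun ω x hx => ?_, fun ω u hu F hF => ?_⟩
  · exact (measState_copState n).setN 20 measurable_const measurable_const measurable_const
  · rw [State.setN_drawn, copState_drawn h.drawn]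
  · rw [copState_congr (ω' := ω) h.drawn n fun j hj => Function.update_of_ne (by omega) _ _]
  · simp only [e3, e4]
    obtain ⟨c, r, h1, h2, h3⟩ := (h.inv ω le_rfl).cover x (hne ω x hx)
    exact ⟨c, h3.lt_of_lt (h.graph.same _) hx, h1, r, h2, h3.symm (h.graph.same _)⟩
  · simp only [e3, e4] at hF
    exact (h.inv ω le_rfl).count u (hne ω u hu) F hF

end CopSetup

end Code

end RealRAM

/-! ### The two algorithms and their separation constants. -/

namespace RealRAM

namespace Code

open LDD MeasureTheory

variable {n k : ℕ} {a : ℕ → ℕ → ℕ} {w : ℕ → ℕ → ℝ} {B D : ℝ} {σ : State}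

theorem ready_net (h : Env n k a w B D σ) (hG : WG n (adjRel a) w) (hB : Huge n (adjRel a) w B)
    (hD : 0 < D) (hDB : D < B) (hdr : σ.drawn = 0) (hl : ∀ x, lab σ x = 0)
    (h4 : ∀ c, ¬ marked σ 4 c) {τm : ℕ}
    (hpack : ∀ u < n, ∀ F : Finset ℕ, (∀ c ∈ F, ∃ r ≤ 3 * D, WPath (adjRel a) w u c r) →
      (∀ c ∈ F, ∀ c' ∈ F, c ≠ c' → ∀ r, WPath (adjRel a) w c c' r → D < r) → F.card ≤ τm) :
    Ready n k a w B D 0 τm fun ω => den ω net σ := by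
  have hdet : net.Det := by
    simp [net, netStep, netTest, allPairs, single, clear, bellmanFord, bfInit, bfEntry, relaxAll,
      relaxEdge, copyEntry, Det]
  have hs : ∀ ω, lab (den ω net σ) = lab σ := fun ω => by
    unfold lab; rw [den_nat _ _ (by decide)]
  have hA : ∀ x y, adjRel a x y → same (adjRel a) (lab σ) x y := fun x y h =>
    ⟨h, (hl x).trans (hl y).symm⟩
  refine ⟨?_, fun ω => h.den (by decide), fun ω => (den_drawn _ hdet _).trans hdr,
    fun ω i x _ => den_det _ hdet _, fun ω x hx => ?_, fun ω u hu F hF => ?_⟩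
  · exact MeasState.den (W := id) measurable_id net (f := fun _ => σ)
      ⟨fun _ _ _ => measurable_const, fun _ _ _ => measurable_const, measurable_const⟩
  · obtain ⟨d, hd, h1, -⟩ := net_spec (ω := ω) h hG hB hD.le h4
    obtain ⟨c, hc, hN, hcd⟩ := h1 x hx
    refine ⟨c, hc, hN, d c x, by linarith, ?_⟩
    rw [hs]
    exact hd.path c hc x hx (by linarith)
  · obtain ⟨d, hd, -, h2⟩ := net_spec (ω := ω) h hG hB hD.le h4
    rw [hs] at hF
    have hlt : ∀ c ∈ F, c < n := fun c hc => by
      obtain ⟨-, r, -, p⟩ := hF c hc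
      exact p.lt_of_lt (hG.same _) hu
    have key : ∀ c ∈ F, ∀ c' ∈ F, c < c' → ∀ r, WPath (adjRel a) w c c' r → D < r :=
      fun c hc c' hc' hlt' r p =>
        (h2 c c' (hF c hc).1 (hF c' hc').1 hlt').trans_le (hd.le c (hlt c hc) c' r (p.mono hA)).1
    refine hpack u hu F (fun c hc => ?_) fun c hc c' hc' hne r p => ?_
    · obtain ⟨-, r, hr, p⟩ := hF c hc
      exact ⟨r, hr, p.mono fun _ _ h => h.1⟩
    · rcases lt_or_gt_of_ne hne with h' | h'
      exacts [key c hc c' hc' h' r p, key c' hc' c hc h' r (p.symm hG)]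

/-- The code computes a random clustering with clusters of strong diameter at most `Δ`, in which an
edge of weight `r` is cut with probability at most `K * r`. -/
structure Clusters (c : Code) (σ : State) (n : ℕ) (A : ℕ → ℕ → Prop) (w : ℕ → ℕ → ℝ)
    (Δ K : ℝ) : Prop where
  meas : ∀ x, Measurable fun ω => (den ω c σ).nat 2 x 0
  diam : ∀ᵐ ω ∂coins, ∀ x < n, ∀ y < n, (den ω c σ).nat 2 x 0 = (den ω c σ).nat 2 y 0 →
    ∃ r ≤ Δ, WPath (restr A fun z => (den ω c σ).nat 2 z 0 = (den ω c σ).nat 2 x 0) w x y r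
  cut : ∀ x y, A x y → coins {ω | (den ω c σ).nat 2 x 0 ≠ (den ω c σ).nat 2 y 0} ≤
    ENNReal.ofReal (K * w x y)

theorem Ready.measurable {m τm : ℕ} {S : (ℕ → unitInterval) → State}
    (h : Ready n k a w B D m τm S) (x : ℕ) : Measurable fun ω => (den ω mpx (S ω)).nat 2 x 0 :=
  (h.meas.den measurable_id mpx).nat 2 x 0

theorem setup_det : setup.Det := by simp [setup, addWeight, Det]

/-- The algorithm for graphs with an excluded minor. -/
def minorCode : Code := .seq setup (.seq (.rep 20 copStep) mpx)

/-- The algorithm for graphs of bounded doubling dimension. -/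
def doublingCode : Code := .seq setup (.seq net mpx)

/-- The input of the algorithms. -/
structure Input (n k : ℕ) (a : ℕ → ℕ → ℕ) (w : ℕ → ℕ → ℝ) (Δ : ℝ) (σ : State) : Prop where
  size : σ.nat 0 0 0 = n
  param : σ.nat 0 0 1 = k
  adj : σ.nat 1 = a
  weight : σ.real 1 = w
  bound : σ.real 0 0 0 = Δ
  bound_pos : 0 < Δ
  weight_nonneg : ∀ x y, 0 ≤ w x y
  graph : WG n (adjRel a) w
  zero : ∀ i x, 1 < i → σ.nat i x 0 = 0
  drawn : σ.drawn = 0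

namespace Input

variable {Δ : ℝ}

theorem setup_eq (h : Input n k a w Δ σ) : ∃ (B : ℝ) (σ₁ : State), (∀ ω, den ω setup σ = σ₁) ∧
    3 * (Δ / 6) < B ∧ Huge n (adjRel a) w B ∧ Env n k a w B (Δ / 6) σ₁ ∧ σ₁.drawn = 0 ∧
    (∀ x, lab σ₁ x = 0) ∧ ∀ c, ¬ marked σ₁ 4 c := by
  obtain ⟨B, h1, h2, h3⟩ := setup_spec (ω := fun _ => 0) h.size h.param h.adj h.weight h.bound
    h.bound_pos h.weight_nonneg fun _ _ => h.graph.lt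
  refine ⟨B, _, fun ω => den_det _ setup_det _, h1, h2, h3, ?_, fun x => ?_, fun c => ?_⟩
  · rw [den_drawn _ setup_det, h.drawn]
  · unfold lab
    rw [den_nat _ _ (by decide), h.zero _ _ (by norm_num)]
  · unfold marked
    rw [den_nat _ _ (by decide), h.zero _ _ (by norm_num)]
    norm_num

/-- An edge is cut either between supernodes or inside one. The two bounds add up to `648 + 192`,
which is rounded up to `1000`. -/
theorem minor (h : Input n k a w Δ σ) (hk : 1 ≤ k) (hm : NoMinor n (adjRel a) w k) :
    Clusters minorCode σ n (adjRel a) w Δ (1000 * k / Δ) := by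
  obtain ⟨B, σ₁, e, h1, h2, h3, h4, h5, h6⟩ := h.setup_eq
  have hD : 0 < Δ / 6 := by linarith [h.bound_pos]
  have hS : CopSetup n k a w B (Δ / 6) σ₁ :=
    ⟨h3, h.graph, h2, hD, by linarith, hm, hk, h4, h5, h6⟩
  have hR := hS.ready
  have e' : ∀ ω, den ω minorCode σ = den ω mpx (den ω (.rep 20 copStep) σ₁) := fun ω => by
    simp only [minorCode, den.eq_5, e]
  refine ⟨fun x => ?_, ?_, fun x y hxy => ?_⟩
  · simp only [e']; exact hR.measurable x
  · have := hR.ae_diam h.graph h2 hD h1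
    rw [show 6 * (Δ / 6) = Δ by ring] at this
    simp only [e']
    exact this
  · simp only [e']
    have c1 := hS.cut_le hxy
    have c2 := hR.cut_le h.graph h2 hD h1 hxy
    have hl : ∀ ω, lab (den ω (.rep 20 copStep) σ₁) = lab (copState σ₁ ω n) := fun ω => by
      rw [den.eq_7, h3.size]
      exact CopSetup.lab_setN (by decide)
    simp only [hl] at c2
    have hw := h.weight_nonneg x y
    have hk' : (1 : ℝ) ≤ k := by exact_mod_cast hk
    have hΔ := h.bound_pos
    calc _ ≤ coins ({ω | lab (copState σ₁ ω n) x ≠ lab (copState σ₁ ω n) y} ∪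
          {ω | lab (copState σ₁ ω n) x = lab (copState σ₁ ω n) y ∧
            Ready.label (den ω mpx (den ω (.rep 20 copStep) σ₁)) x ≠
              Ready.label (den ω mpx (den ω (.rep 20 copStep) σ₁)) y}) := by
          refine measure_mono fun ω hω => ?_
          by_cases h' : lab (copState σ₁ ω n) x = lab (copState σ₁ ω n) y
          · exact .inr ⟨h', hω⟩
          · exact .inl h'
      _ ≤ _ := (measure_union_le _ _).trans (add_le_add c1 c2)
      _ = ENNReal.ofReal (36 * (3 * k / (Δ / 6) * w x y) +
          4 * (Real.log ((7 * k + 1 : ℕ) + 1) / (Δ / 6) * w x y)) := by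
          rw [ENNReal.ofReal_add]
          · positivity
          · have : 0 ≤ Real.log ((7 * k + 1 : ℕ) + 1) := Real.log_nonneg (by push_cast; linarith)
            positivity
      _ ≤ _ := by
          refine ENNReal.ofReal_le_ofReal ?_
          -- A linear bound on the logarithm is enough here, since the supernodes already cost a
          -- factor `k`.
          have hlog : Real.log ((7 * k + 1 : ℕ) + 1) ≤ 8 * k := by
            have := Real.log_le_sub_one_of_pos (x := ((7 * k + 1 : ℕ) + 1 : ℝ)) (by positivity)
            push_cast at this ⊢
            linarith
          have e1 : 36 * (3 * k / (Δ / 6) * w x y) = 648 * k / Δ * w x y := by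
            field_simp; ring
          have e2 : 4 * (Real.log ((7 * k + 1 : ℕ) + 1) / (Δ / 6) * w x y) ≤
              192 * k / Δ * w x y := by
            calc _ ≤ 4 * (8 * k / (Δ / 6) * w x y) := by gcongr
              _ = _ := by field_simp; ring
          have e3 : 1000 * k / Δ * w x y = 648 * k / Δ * w x y + 192 * k / Δ * w x y +
              160 * k / Δ * w x y := by ring
          have e4 : 0 ≤ 160 * k / Δ * w x y := by positivity
          linarith

theorem doubling (h : Input n k a w Δ σ) {τm : ℕ}
    (hpack : ∀ u < n, ∀ F : Finset ℕ, (∀ c ∈ F, ∃ r ≤ 3 * (Δ / 6), WPath (adjRel a) w u c r) →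
      (∀ c ∈ F, ∀ c' ∈ F, c ≠ c' → ∀ r, WPath (adjRel a) w c c' r → Δ / 6 < r) → F.card ≤ τm) :
    Clusters doublingCode σ n (adjRel a) w Δ (24 * Real.log (τm + 1) / Δ) := by
  obtain ⟨B, σ₁, e, h1, h2, h3, h4, h5, h6⟩ := h.setup_eq
  have hD : 0 < Δ / 6 := by linarith [h.bound_pos]
  have hR := ready_net h3 h.graph h2 hD (by linarith) h4 h5 h6 hpack
  have e' : ∀ ω, den ω doublingCode σ = den ω mpx (den ω net σ₁) := fun ω => by
    simp only [doublingCode, den.eq_5, e]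
  have hl : ∀ ω x, lab (den ω net σ₁) x = 0 := fun ω x => by
    rw [← h5 x]; unfold lab; rw [den_nat _ _ (by decide)]
  refine ⟨fun x => ?_, ?_, fun x y hxy => ?_⟩
  · simp only [e']; exact hR.measurable x
  · have := hR.ae_diam h.graph h2 hD h1
    rw [show 6 * (Δ / 6) = Δ by ring] at this
    simp only [e']
    exact this
  · simp only [e']
    have c2 := hR.cut_le h.graph h2 hD h1 hxy
    simp only [hl, true_and] at c2
    have e3 : 4 * (Real.log (τm + 1) / (Δ / 6) * w x y) = 24 * Real.log (τm + 1) / Δ * w x y := by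
      have := h.bound_pos
      field_simp; ring
    rw [← e3]
    exact c2

end Input

theorem minorCode_wf : minorCode.WF := by
  simp [minorCode, setup, addWeight, copStep, copDet, copCut, prepare, capture, single, clear,
    bellmanFord, bfInit, bfEntry, relaxAll, relaxEdge, arm, armTest, traceArm, traceStep, mpx, mpxDet,
    allPairs, copyEntry, maxCount, countCenters, countCenter, sampleAll, assign, bestCenter,
    tryCenter, WF, nwrites]

theorem doublingCode_wf : doublingCode.WF := by
  simp [doublingCode, setup, addWeight, net, netStep, netTest, single, clear,
    bellmanFord, bfInit, bfEntry, relaxAll, relaxEdge, mpx, mpxDet,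
    allPairs, copyEntry, maxCount, countCenters, countCenter, sampleAll, assign, bestCenter,
    tryCenter, WF, nwrites]

end Code

end RealRAM

/-! ### Packing in graphs of bounded doubling dimension. -/

namespace WGraph

variable {V : Type u} {G : SimpleGraph V} {w : Sym2 V → ℝ≥0}

@[simp] theorem walkWeight_nil (v : V) : walkWeight w (.nil : G.Walk v v) = 0 := by
  simp [walkWeight]

@[simp] theorem walkWeight_cons {u v x : V} (h : G.Adj u v) (p : G.Walk v x) :
    walkWeight w (.cons h p) = w s(u, v) + walkWeight w p := by
  simp [walkWeight]

theorem walkWeight_append {u v x : V} (p : G.Walk u v) (q : G.Walk v x) :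
    walkWeight w (p.append q) = walkWeight w p + walkWeight w q := by
  simp [walkWeight]

theorem walkWeight_reverse {u v : V} (p : G.Walk u v) : walkWeight w p.reverse = walkWeight w p := by
  simp [walkWeight, List.sum_reverse]

theorem dist_le {u v : V} (p : G.Walk u v) : dist G w u v ≤ walkWeight w p := iInf_le _ p

theorem dist_self (v : V) : dist G w v v = 0 := by
  have := dist_le (w := w) (.nil : G.Walk v v)
  simpa using this

/-- Two vertices in a common ball are joined by a short walk. -/
theorem exists_walk_of_mem_ball {x u v : V} {ρ ε : ℝ} (hρε : ρ < ε) (hε : 0 < ε)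
    (hu : u ∈ ball G w x ρ) (hv : v ∈ ball G w x ρ) :
    ∃ p : G.Walk u v, (walkWeight w p : ℝ) < 2 * ε := by
  have key : ∀ y ∈ ball G w x ρ, ∃ p : G.Walk x y, (walkWeight w p : ℝ) < ε := by
    intro y hy
    have h1 : dist G w x y < ENNReal.ofReal ε :=
      lt_of_le_of_lt hy ((ENNReal.ofReal_lt_ofReal_iff hε).2 hρε)
    obtain ⟨p, hp⟩ := iInf_lt_iff.1 h1
    refine ⟨p, ?_⟩
    rw [← ENNReal.ofReal_coe_nnreal, ENNReal.ofReal_lt_ofReal_iff hε] at hp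
    exact hp
  obtain ⟨p, hp⟩ := key u hu
  obtain ⟨q, hq⟩ := key v hv
  refine ⟨p.reverse.append q, ?_⟩
  rw [walkWeight_append, walkWeight_reverse, NNReal.coe_add]
  linarith

theorem HasDoublingDim.cover {ddim : ℝ} (h : HasDoublingDim G w ddim) (m : ℕ) :
    ∀ (v : V) (ρ : ℝ), 0 < ρ → ∃ S : Finset V, (S.card : ℝ) ≤ ((2 : ℝ) ^ ddim) ^ m ∧
      ball G w v (2 ^ m * ρ) ⊆ ⋃ x ∈ S, ball G w x ρ := by
  classical
  induction m with
  | zero =>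
    intro v ρ _
    exact ⟨{v}, by simp, by simp⟩
  | succ m ih =>
    intro v ρ hρ
    obtain ⟨S, hS, hc⟩ := h v (2 ^ m * ρ) (by positivity)
    choose T hT hTc using fun x => ih x ρ hρ
    refine ⟨S.biUnion T, ?_, ?_⟩
    · have h1 : ((S.biUnion T).card : ℝ) ≤ ∑ x ∈ S, ((T x).card : ℝ) := by
        exact_mod_cast Finset.card_biUnion_le
      have h2 : ∑ x ∈ S, ((T x).card : ℝ) ≤ S.card * ((2 : ℝ) ^ ddim) ^ m := by
        rw [← nsmul_eq_mul]
        exact Finset.sum_le_card_nsmul _ _ _ fun x _ => hT x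
      calc ((S.biUnion T).card : ℝ) ≤ S.card * ((2 : ℝ) ^ ddim) ^ m := h1.trans h2
        _ ≤ (2 : ℝ) ^ ddim * ((2 : ℝ) ^ ddim) ^ m := by gcongr
        _ = _ := by ring
    · rw [show (2 : ℝ) ^ (m + 1) * ρ = 2 * (2 ^ m * ρ) by ring]
      intro y hy
      obtain ⟨x, hx, hy'⟩ := Set.mem_iUnion₂.1 (hc hy)
      obtain ⟨z, hz, hy''⟩ := Set.mem_iUnion₂.1 (hTc x hy')
      exact Set.mem_iUnion₂.2 ⟨z, Finset.mem_biUnion.2 ⟨x, hx, hz⟩, hy''⟩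

/-- Below dimension one, all distances vanish. -/
theorem HasDoublingDim.dist_eq_zero (hG : G.Connected) {ddim : ℝ} (h : HasDoublingDim G w ddim)
    (hd : ddim < 1) (u v : V) : dist G w u v = 0 := by
  obtain ⟨p⟩ := hG.preconnected u v
  have h2 : (2 : ℝ) ^ ddim < 2 := by
    calc (2 : ℝ) ^ ddim < 2 ^ (1 : ℝ) := Real.rpow_lt_rpow_of_exponent_lt (by norm_num) hd
      _ = 2 := by simp
  -- Below dimension one, a ball is covered by at most one ball of half the radius. So two vertices
  -- in a common ball stay together while the radius is halved repeatedly.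
  have key : ∀ (m : ℕ) (x : V) (ρ : ℝ), 0 < ρ → u ∈ ball G w x (2 ^ m * ρ) →
      v ∈ ball G w x (2 ^ m * ρ) → ∃ z, u ∈ ball G w z ρ ∧ v ∈ ball G w z ρ := by
    intro m
    induction m with
    | zero => intro x ρ _ hu hv; exact ⟨x, by simpa using hu, by simpa using hv⟩
    | succ m ih =>
      intro x ρ hρ hu hv
      obtain ⟨S, hS, hc⟩ := h x (2 ^ m * ρ) (by positivity)
      rw [show (2 : ℝ) ^ (m + 1) * ρ = 2 * (2 ^ m * ρ) by ring] at hu hv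
      obtain ⟨y, hy, hu'⟩ := Set.mem_iUnion₂.1 (hc hu)
      obtain ⟨z, hz, hv'⟩ := Set.mem_iUnion₂.1 (hc hv)
      have hS1 : S.card ≤ 1 := by
        have : (S.card : ℝ) < 2 := hS.trans_lt h2
        have : S.card < 2 := by exact_mod_cast this
        omega
      obtain rfl := Finset.card_le_one.1 hS1 y hy z hz
      exact ih y ρ hρ hu' hv'
  refine le_antisymm (ENNReal.le_of_forall_pos_le_add fun ε hε _ => ?_) bot_le
  have hε' : (0 : ℝ) < ε := hε
  obtain ⟨m, hm⟩ := pow_unbounded_of_one_lt ((walkWeight w p : ℝ) / (ε / 4)) (one_lt_two : (1 : ℝ) < 2)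
  rw [div_lt_iff₀ (by positivity)] at hm
  obtain ⟨z, hu, hv⟩ := key m u (ε / 4) (by positivity)
    (by simp [ball, dist_self]) (by
      refine (dist_le p).trans ?_
      rw [← ENNReal.ofReal_coe_nnreal]
      exact ENNReal.ofReal_le_ofReal hm.le)
  obtain ⟨q, hq⟩ := exists_walk_of_mem_ball (ε := ε / 2) (by linarith) (by linarith) hu hv
  refine (dist_le q).trans ?_
  rw [zero_add]
  have : (walkWeight w q : ℝ) ≤ ε := by linarith
  exact_mod_cast this

/-- Three halvings turn radius `3 * D` into `3 * D / 8`. Two points in one such ball are joined by a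
walk of weight less than `D`, so each ball contains at most one point of `F`. -/
theorem HasDoublingDim.card_le {ddim : ℝ} (h : HasDoublingDim G w ddim) {D : ℝ} (hD : 0 < D)
    (u : V) (F : Finset V) (hF : ∀ c ∈ F, c ∈ ball G w u (3 * D))
    (hs : ∀ c ∈ F, ∀ c' ∈ F, c ≠ c' → ∀ p : G.Walk c c', D < walkWeight w p) :
    (F.card : ℝ) ≤ ((2 : ℝ) ^ ddim) ^ 3 := by
  obtain ⟨S, hS, hc⟩ := h.cover 3 u (3 * D / 8) (by positivity)
  rw [show (2 : ℝ) ^ 3 * (3 * D / 8) = 3 * D by ring] at hc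
  have hx : ∀ c ∈ F, ∃ x ∈ S, c ∈ ball G w x (3 * D / 8) := fun c hcF => by
    simpa using hc (hF c hcF)
  choose! f hf1 hf2 using hx
  refine le_trans ?_ hS
  have : F.card ≤ S.card := by
    refine Finset.card_le_card_of_injOn f hf1 fun c hcF c' hcF' e => ?_
    by_contra hne
    have h1 := hf2 c hcF
    have h2 := hf2 c' hcF'
    rw [← e] at h2
    obtain ⟨p, hp⟩ := exists_walk_of_mem_ball (ε := D / 2) (by linarith) (by linarith) h1 h2
    have := hs c hcF c' hcF' hne p
    linarith
  exact_mod_cast this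

end WGraph

/-! ### From index graphs to the given graph. -/

namespace RealRAM

open LDD WGraph

variable {V : Type u} {n : ℕ} {e : Fin n ≃ V} {G : SimpleGraph V} {w : Sym2 V → ℝ≥0} {Δ : ℝ} {k : ℕ}

/-- Adjacency of indices. -/
abbrev inputAdj (e : Fin n ≃ V) (G : SimpleGraph V) (w : Sym2 V → ℝ≥0) (Δ : ℝ) (k : ℕ) :
    ℕ → ℕ → Prop := Code.adjRel ((input e G w Δ k).nat 1)

theorem inputAdj_iff {i j : ℕ} : inputAdj e G w Δ k i j ↔
    ∃ (hi : i < n) (hj : j < n), G.Adj (e ⟨i, hi⟩) (e ⟨j, hj⟩) := by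
  simp [inputAdj, Code.adjRel, input]

theorem input_weight {i j : ℕ} (hi : i < n) (hj : j < n) (h : G.Adj (e ⟨i, hi⟩) (e ⟨j, hj⟩)) :
    (input e G w Δ k).real 1 i j = w s(e ⟨i, hi⟩, e ⟨j, hj⟩) := by
  have : ∃ (hi : i < n) (hj : j < n), G.Adj (e ⟨i, hi⟩) (e ⟨j, hj⟩) := ⟨hi, hj, h⟩
  simp [input, this]

theorem input_weight_nonneg (i j : ℕ) : 0 ≤ (input e G w Δ k).real 1 i j := by
  simp only [input]
  split_ifs <;> simp_all

theorem input_graph : WG n (inputAdj e G w Δ k) ((input e G w Δ k).real 1) where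
  lt h := by
    obtain ⟨hi, hj, -⟩ := inputAdj_iff.1 h
    exact ⟨hi, hj⟩
  symm h := by
    obtain ⟨hi, hj, h⟩ := inputAdj_iff.1 h
    exact inputAdj_iff.2 ⟨hj, hi, h.symm⟩
  w_symm h := by
    obtain ⟨hi, hj, h⟩ := inputAdj_iff.1 h
    rw [input_weight hi hj h, input_weight hj hi h.symm, Sym2.eq_swap]
  nonneg _ := input_weight_nonneg _ _

theorem input_spec (hΔ : 0 < Δ) : Code.Input n k ((input e G w Δ k).nat 1)
    ((input e G w Δ k).real 1) Δ (input e G w Δ k) where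
  size := by simp [input]
  param := by simp [input]
  adj := rfl
  weight := rfl
  bound := by simp [input]
  bound_pos := hΔ
  weight_nonneg := input_weight_nonneg
  graph := input_graph
  zero i x hi := by
    have h0 : i ≠ 0 := by omega
    have h1 : i ≠ 1 := by omega
    simp [input, h0, h1]
  drawn := rfl

/-- Walks of indices within a set are walks of vertices in the induced graph. -/
theorem exists_walk_of_wpath {S : ℕ → Prop} {i j : ℕ} {r : ℝ}
    (p : WPath (restr (inputAdj e G w Δ k) S) ((input e G w Δ k).real 1) i j r) (hi : i < n)
    (hj : j < n) {C : Set V} (hC : ∀ x : Fin n, e x ∈ C ↔ S x) (hiC : e ⟨i, hi⟩ ∈ C)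
    (hjC : e ⟨j, hj⟩ ∈ C) :
    ∃ q : (G.induce C).Walk ⟨e ⟨i, hi⟩, hiC⟩ ⟨e ⟨j, hj⟩, hjC⟩,
      (walkWeight (fun s => w (s.map Subtype.val)) q : ℝ) = r := by
  induction p with
  | nil => exact ⟨.nil, by simp⟩
  | @cons x y z r h _ ih =>
    obtain ⟨hx, hy, hxy⟩ := inputAdj_iff.1 h.1
    have hyC : e ⟨y, hy⟩ ∈ C := (hC _).2 h.2.2
    obtain ⟨q, hq⟩ := ih hy hj hyC hjC
    refine ⟨.cons (v := ⟨e ⟨y, hy⟩, hyC⟩) (by simpa using hxy) q, ?_⟩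
    rw [walkWeight_cons, NNReal.coe_add, hq, input_weight hx hy hxy]
    simp

theorem wpath_of_walk {u v : V} (p : G.Walk u v) :
    WPath (inputAdj e G w Δ k) ((input e G w Δ k).real 1) (e.symm u) (e.symm v) (walkWeight w p) := by
  induction p with
  | nil => simpa using WPath.nil _
  | @cons u v x h p ih =>
    have h' : G.Adj (e ⟨e.symm u, (e.symm u).2⟩) (e ⟨e.symm v, (e.symm v).2⟩) := by simpa using h
    have := WPath.cons (A := inputAdj e G w Δ k) (w := (input e G w Δ k).real 1)
      (inputAdj_iff.2 ⟨_, _, h'⟩) ih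
    rw [input_weight _ _ h'] at this
    simpa using this

theorem walk_of_wpath {i j : ℕ} {r : ℝ}
    (p : WPath (inputAdj e G w Δ k) ((input e G w Δ k).real 1) i j r) (hi : i < n) (hj : j < n) :
    ∃ q : G.Walk (e ⟨i, hi⟩) (e ⟨j, hj⟩), (walkWeight w q : ℝ) = r := by
  induction p with
  | nil => exact ⟨.nil, by simp⟩
  | @cons x y z r h _ ih =>
    obtain ⟨hx, hy, hxy⟩ := inputAdj_iff.1 h
    obtain ⟨q, hq⟩ := ih hy hj
    refine ⟨.cons hxy q, ?_⟩
    rw [walkWeight_cons, NNReal.coe_add, hq, input_weight hx hy hxy]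

theorem input_noMinor (h : ¬ IsMinor (⊤ : SimpleGraph (Fin k)) G) :
    NoMinor n (inputAdj e G w Δ k) ((input e G w Δ k).real 1) k := by
  intro S hne hlt hconn hdisj hadj
  have hC : ∀ i (x : Fin n), e x ∈ {v | S i (e.symm v)} ↔ S i x := fun i x => by simp
  refine h ⟨fun i => {v | S i (e.symm v)}, fun i => ?_, fun i j hij => ?_, fun i j hij => ?_⟩
  · obtain ⟨x, hx⟩ := hne i
    have : Nonempty ({v | S i (e.symm v)} : Set V) :=
      ⟨⟨e ⟨x, hlt i x hx⟩, (hC i _).2 hx⟩⟩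
    refine ⟨fun u v => ?_⟩
    obtain ⟨r, p⟩ := hconn i _ _ u.2 v.2
    obtain ⟨q, -⟩ := exists_walk_of_wpath p (e.symm u).2 (e.symm v).2 (hC i)
      (by simp) (by simp)
    have := q.reachable
    simpa using this
  · rw [Set.disjoint_left]
    intro v hi hj
    exact hij (hdisj i j _ hi hj)
  · obtain ⟨x, y, hx, hy, a⟩ := hadj i j (by simpa using hij)
    obtain ⟨hx', hy', a'⟩ := inputAdj_iff.1 a
    exact ⟨_, (hC i ⟨x, hx'⟩).2 hx, _, (hC j ⟨y, hy'⟩).2 hy, a'⟩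

open MeasureTheory in
-- Union bound: if the ends of a walk are separated, so are the ends of one of its edges.
theorem cut_walk_le {K : ℝ} (hK : 0 ≤ K) {lab : (ℕ → unitInterval) → ℕ → ℕ}
    (h : ∀ x y, inputAdj e G w Δ k x y → coins {ω | lab ω x ≠ lab ω y} ≤
      ENNReal.ofReal (K * (input e G w Δ k).real 1 x y)) {u v : V} (p : G.Walk u v) :
    coins {ω | lab ω (e.symm u) ≠ lab ω (e.symm v)} ≤ ENNReal.ofReal K * walkWeight w p := by
  induction p with
  | nil => simp
  | @cons u v x a p ih =>
    have a' : G.Adj (e ⟨e.symm u, (e.symm u).2⟩) (e ⟨e.symm v, (e.symm v).2⟩) := by simpa using a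
    have h1 := h _ _ (inputAdj_iff.2 ⟨_, _, a'⟩)
    rw [input_weight _ _ a', ENNReal.ofReal_mul hK, ENNReal.ofReal_coe_nnreal] at h1
    simp only [Fin.eta, Equiv.apply_symm_apply] at h1
    rw [walkWeight_cons, ENNReal.coe_add, mul_add]
    refine (measure_mono ?_).trans ((measure_union_le _ _).trans (add_le_add h1 ih))
    intro ω hω
    by_cases h' : lab ω (e.symm u) = lab ω (e.symm v)
    · exact .inr fun h'' => hω (h'.trans h'')
    · exact .inl h'

open MeasureTheory in
-- The distribution is the law of the output, a measure on the finite set of partitions.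
theorem exists_decomposition {c : Code} (hwf : c.WF) {K : ℝ} (hK : 0 < K) (hΔ : 0 < Δ)
    (h : Code.Clusters c (input e G w Δ k) n (inputAdj e G w Δ k) ((input e G w Δ k).real 1) Δ
      (K / Δ)) :
    ∃ D : PMF (Setoid V), StronglySeparating G w K Δ D ∧
      SamplesWithin c.toProg e (input e G w Δ k) (c.time.eval n) D := by
  classical
  set σ := input e G w Δ k with hσ
  let out : (ℕ → unitInterval) → Setoid V := fun ω => output e (c.den ω σ)
  have hout : ∀ ω u v, out ω u v ↔
      (c.den ω σ).nat 2 (e.symm u) 0 = (c.den ω σ).nat 2 (e.symm v) 0 := fun ω u v => Iff.rfl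
  have : Finite V := .of_equiv _ e
  have : Finite (Setoid V) :=
    Finite.of_injective (fun s : Setoid V => fun u v => s u v) fun s t hst => Setoid.ext fun u v => by
      have := congrFun (congrFun hst u) v
      simpa using this
  let _ : MeasurableSpace (Setoid V) := ⊤
  have hm : Measurable out := by
    let F : (Fin n → ℕ) → Setoid V := fun g => Setoid.ker fun v => g (e.symm v)
    have hF : Measurable F := Measurable.of_discrete
    have hg : Measurable fun ω => fun i : Fin n => (c.den ω σ).nat 2 i 0 :=
      measurable_pi_iff.2 fun i => h.meas i
    exact hF.comp hg
  have : IsProbabilityMeasure (coins.map out) := Measure.isProbabilityMeasure_map hm.aemeasurable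
  have hmass : ∀ P, (coins.map out).toPMF P = coins {ω | out ω = P} := fun P => by
    rw [Measure.toPMF_apply, Measure.map_apply hm (MeasurableSet.singleton P)]
    rfl
  refine ⟨(coins.map out).toPMF, ⟨fun P hP C hC => ?_, fun u v => ?_⟩, out, fun ω => ?_, hmass⟩
  · rw [PMF.mem_support_iff, hmass] at hP
    -- A partition in the support has positive mass, so some `ω` producing it avoids the exceptional
    -- null set. Hence the almost sure diameter bound holds on the whole support.
    obtain ⟨ω, hω, hdiam⟩ := (frequently_ae_mem_iff.2 hP).and_eventually h.diam |>.exists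
    simp only [Set.mem_ofPred_eq] at hω
    subst hω
    refine iSup₂_le fun x y => ?_
    obtain ⟨z, rfl⟩ := hC
    have hx : out ω x z := x.2
    have hy : out ω y z := y.2
    have hxy : out ω x y := (out ω).trans hx ((out ω).symm hy)
    obtain ⟨r, hr, p⟩ := hdiam _ (e.symm x).2 _ (e.symm y).2 ((hout ω _ _).1 hxy)
    have hC : ∀ i : Fin n, e i ∈ {a | out ω a z} ↔
        (c.den ω σ).nat 2 i 0 = (c.den ω σ).nat 2 (e.symm x) 0 := fun i => by
      have h1 := (hout ω x z).1 hx
      rw [Set.mem_ofPred_eq, hout, Equiv.symm_apply_apply, h1]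
    obtain ⟨q, hq⟩ := exists_walk_of_wpath p (e.symm x).2 (e.symm y).2 hC (by simp)
      (by simp)
    have hd := dist_le (w := fun s => w (s.map Subtype.val)) q
    have hle : (walkWeight (fun s => w (s.map Subtype.val)) q : ℝ≥0∞) ≤ ENNReal.ofReal Δ := by
      rw [← ENNReal.ofReal_coe_nnreal, hq]
      exact ENNReal.ofReal_le_ofReal hr
    have := hd.trans hle
    simp only [Fin.eta, Equiv.apply_symm_apply] at this
    exact this
  · rw [← PMF.toMeasure_apply_eq_toOuterMeasure, Measure.toPMF_toMeasure,
      Measure.map_apply hm (MeasurableSpace.measurableSet_top)]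
    have h1 : ∀ p : G.Walk u v, coins {ω | ¬ out ω u v} ≤
        ENNReal.ofReal (K / Δ) * walkWeight w p := fun p =>
      cut_walk_le (lab := fun ω x => (c.den ω σ).nat 2 x 0) (by positivity) h.cut p
    -- The bound holds for every walk, and the infimum over walks is the distance. Since `K / Δ ≠
    -- 0`, the factor can be moved out even if there are no walks.
    calc coins (out ⁻¹' {P | ¬ P u v}) ≤ ⨅ p : G.Walk u v, ENNReal.ofReal (K / Δ) * walkWeight w p :=
          le_iInf h1
      _ = ENNReal.ofReal (K / Δ) * dist G w u v := by
          rw [WGraph.dist, ENNReal.mul_iInf_of_ne (by simpa using div_pos hK hΔ) ENNReal.ofReal_ne_top]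
      _ = _ := by
          rw [ENNReal.ofReal_div_of_pos hΔ, ENNReal.mul_comm_div]
  · obtain ⟨m, hm, hex⟩ := Code.exec_den (ω := ω) c hwf σ
    refine ⟨m, _, hex, ?_, rfl⟩
    have : σ.nat 0 0 0 = n := by simp [hσ, input]
    rwa [this] at hm

theorem exists_minor_decomposition (hΔ : 0 < Δ) (h : ¬ IsMinor (⊤ : SimpleGraph (Fin k)) G) :
    ∃ D : PMF (Setoid V), StronglySeparating G w (1000 * k) Δ D ∧
      SamplesWithin Code.minorCode.toProg e (input e G w Δ k) (Code.minorCode.time.eval n) D := by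
  have hk : 1 ≤ k := by
    -- The clique on no vertices is a minor of every graph.
    rcases Nat.eq_zero_or_pos k with rfl | hk
    · exact (h ⟨fun i => i.elim0, fun i => i.elim0, fun i => i.elim0, fun i => i.elim0⟩).elim
    · exact hk
  exact exists_decomposition Code.minorCode_wf (by positivity) hΔ
    ((input_spec hΔ).minor hk (input_noMinor h))

theorem exists_doubling_decomposition {ddim : ℝ} (hG : G.Connected) (hΔ : 0 < Δ)
    (h : HasDoublingDim G w ddim) :
    ∃ D : PMF (Setoid V), StronglySeparating G w (200 * ddim) Δ D ∧
      SamplesWithin Code.doublingCode.toProg e (input e G w Δ k) (Code.doublingCode.time.eval n) D := by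
  have := hG.nonempty
  -- The extra `1` keeps the logarithm positive even if the floor is zero.
  set τm := ⌊((2 : ℝ) ^ ddim) ^ 3⌋₊ + 1 with hτm
  have hlog : 0 < Real.log (τm + 1) := Real.log_pos (by rw [hτm]; push_cast; linarith [
    (Nat.cast_nonneg ⌊((2 : ℝ) ^ ddim) ^ 3⌋₊ : (0 : ℝ) ≤ _)])
  have hC := (input_spec (e := e) (G := G) (w := w) (k := k) hΔ).doubling (τm := τm) (by
    intro u hu F hF hs
    have hlt : ∀ c ∈ F, c < n := fun c hc => by
      obtain ⟨r, -, p⟩ := hF c hc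
      exact p.lt_of_lt input_graph hu
    let f : {c // c ∈ F} ↪ V := ⟨fun c => e ⟨c, hlt c c.2⟩, fun c c' hcc =>
      Subtype.ext (Fin.mk.inj_iff.1 (e.injective hcc))⟩
    let F' : Finset V := F.attach.map f
    have hF' : F'.card = F.card := by simp [F']
    have hmem : ∀ v ∈ F', ∃ c, ∃ hc : c ∈ F, v = e ⟨c, hlt c hc⟩ := fun v hv => by
      obtain ⟨c, -, hc⟩ := Finset.mem_map.1 hv
      exact ⟨c, c.2, hc.symm⟩
    have key := h.card_le (D := Δ / 6) (by linarith) (e ⟨u, hu⟩) F' (fun v hv => ?_)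
      fun v hv v' hv' hne p => ?_
    · rw [hF'] at key
      have := Nat.le_floor key
      omega
    · obtain ⟨c, hc, rfl⟩ := hmem v hv
      obtain ⟨r, hr, p⟩ := hF c hc
      obtain ⟨q, hq⟩ := walk_of_wpath p hu (hlt c hc)
      refine (dist_le q).trans ?_
      rw [← ENNReal.ofReal_coe_nnreal, hq]
      exact ENNReal.ofReal_le_ofReal hr
    · obtain ⟨c, hc, rfl⟩ := hmem v hv
      obtain ⟨c', hc', rfl⟩ := hmem v' hv'
      have := wpath_of_walk (e := e) (w := w) (Δ := Δ) (k := k) p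
      simp only [Equiv.symm_apply_apply] at this
      exact hs c hc c' hc' (fun hcc => hne (by subst hcc; rfl)) _ this)
  obtain ⟨D, ⟨h1, h2⟩, h3⟩ := exists_decomposition Code.doublingCode_wf (by positivity) hΔ hC
  refine ⟨D, ⟨h1, fun u v => (h2 u v).trans ?_⟩, h3⟩
  -- The logarithm of `τm + 1` carries an additive constant, which a multiple of `ddim` absorbs only
  -- for `ddim ≥ 1`. Otherwise all distances vanish, and the bound for `K` is already zero.
  rcases lt_or_ge ddim 1 with hd | hd
  · rw [h.dist_eq_zero hG hd]; simp
  · refine mul_le_mul' (ENNReal.ofReal_le_ofReal ?_) le_rfl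
    have h8 : ((2 : ℝ) ^ ddim) ^ 3 = Real.exp (3 * ddim * Real.log 2) := by
      rw [← Real.rpow_natCast, ← Real.rpow_mul (by norm_num), Real.rpow_def_of_pos (by norm_num)]
      congr 1; push_cast; ring
    have hl2 : 0 < Real.log 2 := Real.log_pos (by norm_num)
    have hl2' : Real.log 2 < 1 := by linarith [Real.log_two_lt_d9]
    have h1 : (1 : ℝ) ≤ ((2 : ℝ) ^ ddim) ^ 3 := by
      rw [h8]; exact Real.one_le_exp (by positivity)
    have h4 : ((τm : ℝ) + 1) ≤ 3 * ((2 : ℝ) ^ ddim) ^ 3 := by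
      have := Nat.floor_le (show (0 : ℝ) ≤ ((2 : ℝ) ^ ddim) ^ 3 by positivity)
      rw [hτm]; push_cast; linarith
    have h5 : Real.log (τm + 1) ≤ Real.log 3 + 3 * ddim * Real.log 2 := by
      calc _ ≤ Real.log (3 * ((2 : ℝ) ^ ddim) ^ 3) := Real.log_le_log (by positivity) h4
        _ = _ := by rw [Real.log_mul (by norm_num) (by positivity), h8, Real.log_exp]
    have h6 : Real.log 3 ≤ 2 := by
      have := Real.log_le_sub_one_of_pos (x := 3) (by norm_num)
      linarith
    nlinarith

end RealRAM

theorem corollary6p3 :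
    (∃ (C : ℝ) (p : RealRAM.Prog) (q : Polynomial ℕ), 0 < C ∧
      ∀ (r : ℕ) (V : Type u) (n : ℕ) (e : Fin n ≃ V) (G : SimpleGraph V) (w : Sym2 V → ℝ≥0)
        (Δ : ℝ), G.Connected → 0 < Δ →
        ¬ WGraph.IsMinor (⊤ : SimpleGraph (Fin r)) G →
        ∃ D : PMF (Setoid V), WGraph.StronglySeparating G w (C * r) Δ D ∧
          RealRAM.SamplesWithin p e (RealRAM.input e G w Δ r) (q.eval n) D) ∧
    (∃ (C : ℝ) (p : RealRAM.Prog) (q : Polynomial ℕ), 0 < C ∧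
      ∀ (ddim : ℝ) (V : Type u) (n : ℕ) (e : Fin n ≃ V) (G : SimpleGraph V) (w : Sym2 V → ℝ≥0)
        (Δ : ℝ), G.Connected → 0 < Δ →
        WGraph.HasDoublingDim G w ddim →
        ∃ D : PMF (Setoid V), WGraph.StronglySeparating G w (C * ddim) Δ D ∧
          RealRAM.SamplesWithin p e (RealRAM.input e G w Δ 0) (q.eval n) D) :=
  ⟨⟨1000, _, _, by norm_num, fun _ _ _ _ _ _ _ _ hΔ h =>
      RealRAM.exists_minor_decomposition hΔ h⟩,
    ⟨200, _, _, by norm_num, fun _ _ _ _ _ _ _ hG hΔ h =>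
      RealRAM.exists_doubling_decomposition hG hΔ h⟩⟩
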